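/- Let $I=[0,1]$. For a real number $\tau\ge 0$ let $\mathrm{Diff}_+^{1,\tau}(I)$ be the group of orientation-preserving $C^1$ diffeomorphisms $f$ of $I$ whose derivative satisfies $\sup_{x\ne y}|f'(x)-f'(y)|/|x-y|^{\tau}<\infty$. For a group $G$ write $G^{(0)}=G$ and $G^{(k)}=[G^{(k-1)},G^{(k-1)}]$. An action of a group $A$ on $I$ is called overlapping if for all nontrivial $a,b\in A$ there is a point of $I$ moved by both $a$ and $b$. Let $G$ and $H$ be groups. (1) Suppose that $k\ge 3$ is an integer, that $G^{(k)}$ and $H^{(k)}$ are both nontrivial, and that $\tau(1+\tau)^{k-2}\ge 1$. Then there is no embedding $(G\times H)*\mathbb{Z}\to \mathrm{Diff}_+^{1,\tau}(I)$. (2) Suppose that $G$ and $H$ are both non-solvable. Then for every $\tau>0$ there is no embedding $(G\times H)*\mathbb{Z}\to \mathrm{Diff}_+^{1,\tau}(I)$. If, moreover, $G$ and $H$ are finitely generated (or, more generally, each of them contains a finitely generated non-solvable subgroup), then there is no embedding $(G\times H)*\mathbb{Z}\to\bigcup_{\tau>0}\mathrm{Diff}_+^{1,\tau}(I)$. In each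 of these cases, writing $\Gamma$ for the target group $\mathrm{Diff}_+^{1,\tau}(I)$, respectively $\bigcup_{\tau>0}\mathrm{Diff}_+^{1,\tau}(I)$, a faithful action of $G\times H$ on $I$ by elements of $\Gamma$ is never overlapping; in fact there are nontrivial $g\in G$ and $h\in H$ that have disjoint supports. -/

import Mathlib

open scoped unitInterval NNReal

namespace IntervalDiff

/-- A self-homeomorphism of `I = [0,1]`, read as a real function on `[0,1]`
(extended to `ℝ` by constants; only its values on `[0,1]` matter below). -/
noncomputable def toReal (f : I ≃ₜ I) : ℝ → ℝ :=
  Set.IccExtend (zero_le_one' ℝ) (fun x : I => (f x : ℝ))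

/-- The derivative of `f` on `[0,1]` (one-sided at the end points). -/
noncomputable def D (f : I ≃ₜ I) : ℝ → ℝ :=
  derivWithin (toReal f) (Set.Icc 0 1)

/-- `f` is an orientation-preserving `C¹` diffeomorphism of `[0,1]` whose first derivative is
`τ`-Hölder continuous. -/
structure IsC1Holder (τ : ℝ≥0) (f : I ≃ₜ I) : Prop where
  strictMono : StrictMono f
  contDiffOn : ContDiffOn ℝ 1 (toReal f) (Set.Icc 0 1)
  contDiffOn_symm : ContDiffOn ℝ 1 (toReal f.symm) (Set.Icc 0 1)
  holder : ∃ C : ℝ≥0, HolderOnWith C τ (D f) (Set.Icc 0 1)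

theorem toReal_apply (f : I ≃ₜ I) {x : ℝ} (hx : x ∈ Set.Icc (0 : ℝ) 1) :
    toReal f x = (f ⟨x, hx⟩ : ℝ) := by
  simp [toReal, Set.IccExtend_of_mem _ _ hx]

theorem toReal_mem (f : I ≃ₜ I) (x : ℝ) : toReal f x ∈ Set.Icc (0 : ℝ) 1 :=
  (f (Set.projIcc 0 1 (zero_le_one' ℝ) x)).2

theorem toReal_mul (f g : I ≃ₜ I) : toReal (f * g) = toReal f ∘ toReal g := by
  funext x
  rw [Function.comp_apply, toReal_apply f (toReal_mem g x)]
  rfl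

theorem toReal_symm_apply (f : I ≃ₜ I) {x : ℝ} (hx : x ∈ Set.Icc (0 : ℝ) 1) :
    toReal f (toReal f.symm x) = x := by
  rw [toReal_apply f (toReal_mem _ _)]
  have : (⟨toReal f.symm x, toReal_mem _ _⟩ : I) = f.symm ⟨x, hx⟩ :=
    Subtype.ext (toReal_apply f.symm hx)
  rw [this, Homeomorph.apply_symm_apply]

theorem toReal_one : Set.EqOn (toReal (1 : I ≃ₜ I)) id (Set.Icc 0 1) := fun _ hx =>
  toReal_apply 1 hx

theorem D_mul {f g : I ≃ₜ I} (hf : ContDiffOn ℝ 1 (toReal f) (Set.Icc 0 1))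
    (hg : ContDiffOn ℝ 1 (toReal g) (Set.Icc 0 1)) {x : ℝ} (hx : x ∈ Set.Icc (0 : ℝ) 1) :
    D (f * g) x = D f (toReal g x) * D g x := by
  unfold D
  rw [toReal_mul]
  exact derivWithin_comp x (hf.differentiableOn one_ne_zero _ (toReal_mem g x))
    (hg.differentiableOn one_ne_zero x hx) (fun y _ => toReal_mem g y)

theorem D_one {x : ℝ} (hx : x ∈ Set.Icc (0 : ℝ) 1) : D (1 : I ≃ₜ I) x = 1 := by
  unfold D
  rw [derivWithin_congr toReal_one (toReal_one hx)]
  exact derivWithin_id x _ (uniqueDiffOn_Icc zero_lt_one x hx)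

theorem exists_D_bound {f : I ≃ₜ I} (hf : ContDiffOn ℝ 1 (toReal f) (Set.Icc 0 1)) :
    ∃ M : ℝ, 0 ≤ M ∧ ∀ x ∈ Set.Icc (0 : ℝ) 1, |D f x| ≤ M := by
  obtain ⟨M, hM⟩ := isCompact_Icc.exists_bound_of_continuousOn
    (hf.continuousOn_derivWithin (uniqueDiffOn_Icc zero_lt_one) le_rfl)
  exact ⟨M, (norm_nonneg _).trans (hM 0 (by simp)), fun x hx => hM x hx⟩

theorem lipschitz_of_bound {f : I ≃ₜ I} (hf : ContDiffOn ℝ 1 (toReal f) (Set.Icc 0 1)) {M : ℝ}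
    (hM : ∀ x ∈ Set.Icc (0 : ℝ) 1, |D f x| ≤ M) {x y : ℝ} (hx : x ∈ Set.Icc (0 : ℝ) 1)
    (hy : y ∈ Set.Icc (0 : ℝ) 1) : |toReal f x - toReal f y| ≤ M * |x - y| :=
  (convex_Icc (0 : ℝ) 1).norm_image_sub_le_of_norm_derivWithin_le
    (hf.differentiableOn one_ne_zero) (fun z hz => hM z hz) hy hx

/-- Hölder continuity on a set in terms of real inequalities. -/
theorem exists_holderOnWith_iff {τ : ℝ≥0} {u : ℝ → ℝ} {s : Set ℝ} :
    (∃ C : ℝ≥0, HolderOnWith C τ u s) ↔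
      ∃ C : ℝ, 0 ≤ C ∧ ∀ x ∈ s, ∀ y ∈ s, |u x - u y| ≤ C * |x - y| ^ (τ : ℝ) := by
  constructor
  · rintro ⟨C, hC⟩
    exact ⟨C, C.2, fun x hx y hy => by
      have := hC.dist_le hx hy
      rwa [Real.dist_eq, Real.dist_eq] at this⟩
  · rintro ⟨C, h0, hC⟩
    refine ⟨C.toNNReal, fun x hx y hy => ?_⟩
    have := hC x hx y hy
    rw [edist_dist, edist_dist, Real.dist_eq, Real.dist_eq,
      ENNReal.ofReal_rpow_of_nonneg (abs_nonneg _) τ.coe_nonneg]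
    refine (ENNReal.ofReal_le_ofReal this).trans ?_
    exact (ENNReal.ofReal_mul h0).le

theorem IsC1Holder.one (τ : ℝ≥0) : IsC1Holder τ (1 : I ≃ₜ I) where
  strictMono := strictMono_id
  contDiffOn := contDiffOn_id.congr toReal_one
  contDiffOn_symm := contDiffOn_id.congr toReal_one
  holder := ⟨0, fun x hx y hy => by simp [D_one hx, D_one hy]⟩

theorem IsC1Holder.mul {τ : ℝ≥0} {f g : I ≃ₜ I} (hf : IsC1Holder τ f) (hg : IsC1Holder τ g) :
    IsC1Holder τ (f * g) where
  strictMono := hf.strictMono.comp hg.strictMono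
  contDiffOn := by
    rw [toReal_mul]
    exact hf.contDiffOn.comp hg.contDiffOn fun y _ => toReal_mem g y
  contDiffOn_symm := by
    have : (f * g).symm = g.symm * f.symm := rfl
    rw [this, toReal_mul]
    exact hg.contDiffOn_symm.comp hf.contDiffOn_symm fun y _ => toReal_mem f.symm y
  holder := by
    obtain ⟨A, hA0, hA⟩ := exists_holderOnWith_iff.1 hf.holder
    obtain ⟨B, hB0, hB⟩ := exists_holderOnWith_iff.1 hg.holder
    obtain ⟨M, hM0, hM⟩ := exists_D_bound hf.contDiffOn
    obtain ⟨N, hN0, hN⟩ := exists_D_bound hg.contDiffOn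
    refine exists_holderOnWith_iff.2 ⟨A * N ^ (τ : ℝ) * N + M * B, by positivity, ?_⟩
    intro x hx y hy
    rw [D_mul hf.contDiffOn hg.contDiffOn hx, D_mul hf.contDiffOn hg.contDiffOn hy]
    have hL := lipschitz_of_bound hg.contDiffOn hN hx hy
    have h1 : |D f (toReal g x) - D f (toReal g y)| ≤ A * N ^ (τ : ℝ) * |x - y| ^ (τ : ℝ) := by
      refine (hA _ (toReal_mem g x) _ (toReal_mem g y)).trans ?_
      rw [mul_assoc, ← Real.mul_rpow hN0 (abs_nonneg _)]
      gcongr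
    have h2 := hB x hx y hy
    calc |D f (toReal g x) * D g x - D f (toReal g y) * D g y|
        = |(D f (toReal g x) - D f (toReal g y)) * D g x
            + D f (toReal g y) * (D g x - D g y)| := by congr 1; ring
      _ ≤ |D f (toReal g x) - D f (toReal g y)| * |D g x|
            + |D f (toReal g y)| * |D g x - D g y| := by
          rw [← abs_mul, ← abs_mul]; exact abs_add_le _ _
      _ ≤ (A * N ^ (τ : ℝ) * |x - y| ^ (τ : ℝ)) * N + M * (B * |x - y| ^ (τ : ℝ)) := by
          gcongr
          · exact hN x hx
          · exact hM _ (toReal_mem g y)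
      _ = _ := by ring

theorem IsC1Holder.inv {τ : ℝ≥0} {f : I ≃ₜ I} (hf : IsC1Holder τ f) : IsC1Holder τ f⁻¹ where
  strictMono := fun x y hxy => by
    apply hf.strictMono.lt_iff_lt.1
    have h : ∀ z, f (f⁻¹ z) = z := f.apply_symm_apply
    rwa [h, h]
  contDiffOn := hf.contDiffOn_symm
  contDiffOn_symm := hf.contDiffOn
  holder := by
    have hs : ContDiffOn ℝ 1 (toReal f⁻¹) (Set.Icc 0 1) := hf.contDiffOn_symm
    obtain ⟨A, hA0, hA⟩ := exists_holderOnWith_iff.1 hf.holder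
    obtain ⟨N, hN0, hN⟩ := exists_D_bound hs
    refine exists_holderOnWith_iff.2 ⟨N * (A * N ^ (τ : ℝ)) * N, by positivity, ?_⟩
    intro x hx y hy
    have key : ∀ z ∈ Set.Icc (0 : ℝ) 1, D f (toReal f⁻¹ z) * D f⁻¹ z = 1 := fun z hz => by
      rw [← D_mul hf.contDiffOn hs hz, mul_inv_cancel, D_one hz]
    have hL := lipschitz_of_bound hs hN hx hy
    have h1 : |D f (toReal f⁻¹ y) - D f (toReal f⁻¹ x)|
        ≤ A * N ^ (τ : ℝ) * |x - y| ^ (τ : ℝ) := by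
      rw [abs_sub_comm]
      refine (hA _ (toReal_mem _ x) _ (toReal_mem _ y)).trans ?_
      rw [mul_assoc, ← Real.mul_rpow hN0 (abs_nonneg _)]
      gcongr
    have hid : D f⁻¹ x - D f⁻¹ y
        = D f⁻¹ x * (D f (toReal f⁻¹ y) - D f (toReal f⁻¹ x)) * D f⁻¹ y := by
      linear_combination (-D f⁻¹ x) * key y hy + (D f⁻¹ y) * key x hx
    rw [hid, abs_mul, abs_mul]
    calc |D f⁻¹ x| * |D f (toReal f⁻¹ y) - D f (toReal f⁻¹ x)| * |D f⁻¹ y|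
        ≤ N * (A * N ^ (τ : ℝ) * |x - y| ^ (τ : ℝ)) * N := by
          gcongr
          · exact hN x hx
          · exact hN y hy
      _ = _ := by ring

theorem IsC1Holder.mono {r τ : ℝ≥0} (h : r ≤ τ) {f : I ≃ₜ I} (hf : IsC1Holder τ f) :
    IsC1Holder r f where
  strictMono := hf.strictMono
  contDiffOn := hf.contDiffOn
  contDiffOn_symm := hf.contDiffOn_symm
  holder := by
    obtain ⟨A, hA0, hA⟩ := exists_holderOnWith_iff.1 hf.holder
    refine exists_holderOnWith_iff.2 ⟨A, hA0, fun x hx y hy => (hA x hx y hy).trans ?_⟩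
    rcases eq_or_ne x y with rfl | hne
    · rcases eq_or_ne τ 0 with rfl | hτ
      · simp [le_antisymm h zero_le]
      · rw [sub_self, abs_zero, Real.zero_rpow (by exact_mod_cast hτ), mul_zero]
        positivity
    · gcongr A * ?_
      exact Real.rpow_le_rpow_of_exponent_ge (abs_pos.2 (sub_ne_zero.2 hne))
        (abs_sub_le_iff.2 ⟨by linarith [hx.2, hy.1], by linarith [hy.2, hx.1]⟩) h

/-- The group `Diff₊^{1,τ}(I)` of orientation-preserving `C¹` diffeomorphisms of `I = [0,1]` whose
first derivatives are `τ`-Hölder continuous, with composition as multiplication. -/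
def Diff (τ : ℝ≥0) : Subgroup (I ≃ₜ I) where
  carrier := {f | IsC1Holder τ f}
  mul_mem' := IsC1Holder.mul
  one_mem' := IsC1Holder.one τ
  inv_mem' := IsC1Holder.inv

/-- The group `⋃_{τ > 0} Diff₊^{1,τ}(I)`. -/
def DiffUnion : Subgroup (I ≃ₜ I) where
  carrier := {f | ∃ τ : ℝ≥0, 0 < τ ∧ f ∈ Diff τ}
  mul_mem' := by
    rintro f g ⟨r, hr, hf⟩ ⟨τ, hτ, hg⟩
    exact ⟨min r τ, lt_min hr hτ,
      IsC1Holder.mul (IsC1Holder.mono (min_le_left _ _) hf) (IsC1Holder.mono (min_le_right _ _) hg)⟩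
  one_mem' := ⟨1, one_pos, IsC1Holder.one 1⟩
  inv_mem' := by
    rintro f ⟨r, hr, hf⟩
    exact ⟨r, hr, IsC1Holder.inv hf⟩

/-- A group action on a space, given as a homomorphism to its homeomorphism group, is *overlapping*
if any two nontrivial group elements both move some common point,
i.e. if their supports intersect. -/
def IsOverlapping {A X : Type*} [Group A] [TopologicalSpace X] (φ : A →* (X ≃ₜ X)) : Prop :=
  ∀ g h : A, g ≠ 1 → h ≠ 1 → ∃ x : X, φ g x ≠ x ∧ φ h x ≠ x

/-- The two ways in which a subgroup `Γ` of `Homeo(I)` obstructs the product `G × H`: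
`(G × H) ∗ ℤ` does not embed in `Γ`; and any faithful action of `G × H` on `I` by elements of `Γ`
fails to be overlapping, and indeed some nontrivial `g ∈ G` and some nontrivial `h ∈ H` have
disjoint supports. -/
def Obstructs (Γ : Subgroup (I ≃ₜ I)) (G H : Type*) [Group G] [Group H] : Prop :=
  (¬ ∃ ψ : Monoid.Coprod (G × H) (Multiplicative ℤ) →* Γ, Function.Injective ψ) ∧
  ∀ φ : G × H →* Γ, Function.Injective φ →
    ¬ IsOverlapping (Γ.subtype.comp φ) ∧
    ∃ g : G, ∃ h : H, g ≠ 1 ∧ h ≠ 1 ∧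
      ∀ x : I, (φ (g, 1) : I ≃ₜ I) x = x ∨ (φ (1, h) : I ≃ₜ I) x = x

end IntervalDiff

/-! There are two independent halves: produce nontrivial `g` and `h` with disjoint supports, then
show that such a pair prevents an embedding of the free product.

Suppose that all nontrivial `g` and `h` move a common point, and choose them deep in the derived
series, both moving `x`. If two elements of one group were crossed on a support component around
`x`, ping-pong would give a contraction with a hyperbolic fixed point. The commuting group must fix
that point, its commutators are tangent to the identity there, and Kopell's argument makes them
trivial on the component, though one of them moves `x` (`noncrossing_of_commutator_moves`). Without
crossings the action around `x` is Conradian: by Hölder's theorem on Archimedean groups, the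
component around `x` of an element of the commutator subgroup is displaced by some `c` of the group,
inside a component of `c` (`Noncrossing.exists_displacing`). A `C^{1,τ}` map moves the points of a
component of length `L` by `O(L^{1+τ})`, so `k` levels give intervals `J ⊆ U` with `|wJ| ≤ C
|wU|^((1+τ)^k)`, uniformly in the commuting `w` (`exists_dominating`). At the top level an element
of one group displaces an interval `U` belonging to the other. The iterates of `U` do not overlap,
so `τ(1+τ)^k ≥ 1` makes `∑ |wJ|^τ` finite, and Kopell's argument gives a contradiction
(`false_of_displaced`).

If `g` and `h` have disjoint supports and `t` generates `ℤ`, then `g, h` and their conjugates by `t`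
generate a copy of `ℤ² ∗ ℤ²`. A `C¹` estimate shows that `killingWord` in these elements is trivial
near every common fixed point (`eventually_killingWord`). In a faithful action of `ℤ² ∗ ℤ²` only the
identity has this property: its support meets finitely many gaps between common fixed points and can
be pushed off itself in one gap, and commuting is transitive in `ℤ² ∗ ℤ²`
(`IsLocallyTrivial.eq_one`). But the word is not trivial in `ℤ² ∗ ℤ²`. -/

namespace IntervalDiff

/-! ### Iteration of increasing homeomorphisms -/

open Set Filter Topology

theorem toReal_coe (f : I ≃ₜ I) (x : I) : toReal f x = f x := toReal_apply f x.2

@[simp]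
theorem inv_apply_apply (f : I ≃ₜ I) (x : I) : f⁻¹ (f x) = x := f.symm_apply_apply x

@[simp]
theorem apply_inv_apply (f : I ≃ₜ I) (x : I) : f (f⁻¹ x) = x := f.apply_symm_apply x

theorem pow_succ_apply (f : I ≃ₜ I) (n : ℕ) (x : I) : (f ^ (n + 1)) x = f ((f ^ n) x) := by
  rw [pow_succ', Homeomorph.mul_apply]

theorem Commute.homeo_apply {f g : I ≃ₜ I} (h : Commute f g) (x : I) : f (g x) = g (f x) := by
  rw [← Homeomorph.mul_apply, h.eq, Homeomorph.mul_apply]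

theorem inv_fixed {f : I ≃ₜ I} {x : I} (h : f x = x) : f⁻¹ x = x := by
  conv_lhs => rw [← h]
  exact inv_apply_apply f x

theorem inv_fixed_iff {f : I ≃ₜ I} {x : I} : f⁻¹ x = x ↔ f x = x :=
  ⟨fun h => by simpa using inv_fixed h, inv_fixed⟩

theorem pow_fixed {f : I ≃ₜ I} {x : I} (h : f x = x) (n : ℕ) : (f ^ n) x = x := by
  induction n with
  | zero => rfl
  | succ n ih => rw [pow_succ_apply, ih, h]

theorem strictMono_pow {f : I ≃ₜ I} (hf : StrictMono f) (n : ℕ) : StrictMono (f ^ n) := by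
  induction n with
  | zero => exact strictMono_id
  | succ n ih => rw [pow_succ']; exact hf.comp ih

/-- The iterates of a point under an increasing homeomorphism converge to a fixed point. -/
theorem exists_tendsto_pow {f : I ≃ₜ I} (hf : StrictMono f) (x : I) :
    ∃ q, f q = q ∧ Tendsto (fun n : ℕ => (f ^ n) x) atTop (𝓝 q) := by
  have key : ∃ q, Tendsto (fun n : ℕ => (f ^ n) x) atTop (𝓝 q) := by
    rcases le_total x (f x) with h | h
    · refine ⟨_, tendsto_atTop_ciSup (monotone_nat_of_le_succ fun n => ?_) ⟨1, ?_⟩⟩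
      · rw [pow_succ, Homeomorph.mul_apply]
        exact (strictMono_pow hf n).monotone h
      · rintro _ ⟨n, rfl⟩
        exact le_top
    · refine ⟨_, tendsto_atTop_ciInf (antitone_nat_of_succ_le fun n => ?_) ⟨0, ?_⟩⟩
      · rw [pow_succ, Homeomorph.mul_apply]
        exact (strictMono_pow hf n).monotone h
      · rintro _ ⟨n, rfl⟩
        exact bot_le
  obtain ⟨q, hq⟩ := key
  refine ⟨q, ?_, hq⟩
  refine tendsto_nhds_unique ?_ ((tendsto_add_atTop_iff_nat 1).2 hq)
  simp only [pow_succ_apply]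
  exact (f.continuous.tendsto q).comp hq

/-! ### Derivatives, distortion and Kopell's argument -/

section Smooth

variable {τ : ℝ≥0} {f g h : I ≃ₜ I}

theorem IsC1Holder.D_mul_apply (hf : IsC1Holder τ f) (hg : IsC1Holder τ g) (x : I) :
    D (f * g) x = D f (g x) * D g x := by
  rw [D_mul hf.contDiffOn hg.contDiffOn x.2, toReal_coe]

theorem IsC1Holder.pow (hf : IsC1Holder τ f) (n : ℕ) : IsC1Holder τ (f ^ n) :=
  (Diff τ).pow_mem hf n

theorem IsC1Holder.D_pos (hf : IsC1Holder τ f) (x : I) : 0 < D f x := by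
  have h1 : D f⁻¹ (f x) * D f x = 1 := by
    rw [← hf.inv.D_mul_apply hf, inv_mul_cancel, D_one x.2]
  have h2 : 0 ≤ D f x := by
    refine MonotoneOn.derivWithin_nonneg ?_
    intro a ha b hb hab
    rw [toReal_apply f ha, toReal_apply f hb]
    exact hf.strictMono.monotone hab
  exact h2.lt_of_ne fun h => by simp [← h] at h1

theorem IsC1Holder.continuous_D (hf : IsC1Holder τ f) : Continuous fun x : I => D f x := by
  have := hf.contDiffOn.continuousOn_derivWithin (uniqueDiffOn_Icc zero_lt_one) le_rfl
  exact continuousOn_iff_continuous_domRestrict.1 this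

theorem IsC1Holder.exists_D_eq (hf : IsC1Holder τ f) {x y : I} (hxy : x < y) :
    ∃ ξ ∈ Ioo x y, ((f y : ℝ) - f x) = D f ξ * ((y : ℝ) - x) := by
  have hsub : Icc (x : ℝ) y ⊆ Icc 0 1 := Icc_subset_Icc x.2.1 y.2.2
  have hd : ∀ z ∈ Ioo (x : ℝ) y, HasDerivAt (toReal f) (D f z) z := by
    intro z hz
    have hz' : z ∈ Icc (0 : ℝ) 1 := hsub (Ioo_subset_Icc_self hz)
    have := (hf.contDiffOn.differentiableOn one_ne_zero z hz').hasDerivWithinAt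
    exact this.hasDerivAt (Icc_mem_nhds (x.2.1.trans_lt hz.1) (hz.2.trans_le y.2.2))
  obtain ⟨ξ, hξ, he⟩ := exists_hasDerivAt_eq_slope (toReal f) (D f) (show (x : ℝ) < y from hxy)
    (hf.contDiffOn.continuousOn.mono hsub) hd
  refine ⟨⟨ξ, hsub (Ioo_subset_Icc_self hξ)⟩, ⟨hξ.1, hξ.2⟩, ?_⟩
  have hpos : (0 : ℝ) < y - x := sub_pos.2 hxy
  rw [toReal_coe, toReal_coe] at he
  rw [show ((⟨ξ, hsub (Ioo_subset_Icc_self hξ)⟩ : I) : ℝ) = ξ from rfl, he,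
    div_mul_cancel₀ _ hpos.ne']

/-- The derivative has a positive minimum by compactness. Logarithms are used because they add up
along compositions. -/
theorem IsC1Holder.exists_log_holder (hf : IsC1Holder τ f) :
    ∃ C : ℝ, 0 ≤ C ∧ ∀ x y : I,
      |Real.log (D f x) - Real.log (D f y)| ≤ C * |(x : ℝ) - y| ^ (τ : ℝ) := by
  obtain ⟨A, hA0, hA⟩ := exists_holderOnWith_iff.1 hf.holder
  obtain ⟨z, -, hz⟩ := isCompact_univ.exists_isMinOn ⟨(0 : I), mem_univ _⟩
    hf.continuous_D.continuousOn
  set m := D f z with hm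
  have hm0 : 0 < m := hf.D_pos z
  have hmin : ∀ x : I, m ≤ D f x := fun x => hz (mem_univ x)
  have key : ∀ x y : I, Real.log (D f x) - Real.log (D f y) ≤
      A / m * |(x : ℝ) - y| ^ (τ : ℝ) := by
    intro x y
    have hx := hf.D_pos x
    have hy := hf.D_pos y
    rw [← Real.log_div hx.ne' hy.ne']
    have h1 := Real.log_le_sub_one_of_pos (div_pos hx hy)
    have h2 : D f x / D f y - 1 = (D f x - D f y) / D f y := by field_simp
    have h3 : (D f x - D f y) / D f y ≤ A * |(x : ℝ) - y| ^ (τ : ℝ) / m := by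
      apply div_le_div₀ (by positivity) ((le_abs_self _).trans (hA x x.2 y y.2)) hm0 (hmin y)
    calc _ ≤ _ := h1
      _ ≤ _ := h2.le
      _ ≤ _ := h3
      _ = _ := by ring
  refine ⟨A / m, by positivity, fun x y => abs_sub_le_iff.2 ⟨key x y, ?_⟩⟩
  rw [abs_sub_comm]
  exact key y x

/-- Displacement bound: a diffeomorphism fixing both endpoints of `[u, v]` moves the points of
`[u, v]` by at most a constant times `|v - u| ^ (1 + τ)`. -/
theorem IsC1Holder.exists_displacement_le (hf : IsC1Holder τ f) :
    ∃ C : ℝ, 0 ≤ C ∧ ∀ u v x : I, u ≤ x → x ≤ v → f u = u → f v = v →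
      |(f x : ℝ) - x| ≤ C * ((v : ℝ) - u) ^ (1 + (τ : ℝ)) := by
  obtain ⟨A, hA0, hA⟩ := exists_holderOnWith_iff.1 hf.holder
  refine ⟨A, hA0, fun u v x hu hv hfu hfv => ?_⟩
  rcases hu.eq_or_lt with rfl | hux
  · rw [hfu, sub_self, abs_zero]
    have : (0 : ℝ) ≤ (v : ℝ) - u := sub_nonneg.2 hv
    positivity
  have huv := hux.trans_le hv
  obtain ⟨ξ, hξ, h1⟩ := hf.exists_D_eq huv
  obtain ⟨η, hη, h2⟩ := hf.exists_D_eq hux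
  have hpos : (0 : ℝ) < (v : ℝ) - u := sub_pos.2 huv
  have hD : D f ξ = 1 := by
    rw [hfu, hfv] at h1
    exact (mul_right_cancel₀ hpos.ne' (by rw [one_mul]; exact h1)).symm
  rw [hfu] at h2
  -- The derivative is one at `ξ`, so the Hölder bound on `D f η - 1` supplies the exponent `τ` and
  -- the factor `x - u` the additional `1`.
  have h3 : (f x : ℝ) - x = (D f η - D f ξ) * ((x : ℝ) - u) := by rw [hD]; linarith
  have h4 := hA η η.2 ξ ξ.2
  have h5 : |(η : ℝ) - ξ| ≤ (v : ℝ) - u := by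
    have := hξ.1; have := hξ.2; have := hη.1; have := hη.2
    rw [← Subtype.coe_lt_coe] at *
    rw [← Subtype.coe_le_coe] at hv
    rw [abs_le]; constructor <;> linarith
  have h6 : |(x : ℝ) - u| ≤ (v : ℝ) - u := by
    rw [← Subtype.coe_lt_coe] at *
    rw [← Subtype.coe_le_coe] at hv
    rw [abs_le]; constructor <;> linarith
  rw [h3, abs_mul, Real.rpow_add hpos, Real.rpow_one]
  calc _ ≤ (A * |(η : ℝ) - ξ| ^ (τ : ℝ)) * ((v : ℝ) - u) := by gcongr
    _ ≤ (A * ((v : ℝ) - u) ^ (τ : ℝ)) * ((v : ℝ) - u) := by gcongr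
    _ = _ := by ring

theorem IsC1Holder.D_pow_fixed (hf : IsC1Holder τ f) {q : I} (hq : f q = q) (hD : D f q = 1)
    (n : ℕ) : D (f ^ n) q = 1 := by
  induction n with
  | zero => exact D_one q.2
  | succ n ih => rw [pow_succ', hf.D_mul_apply (hf.pow n), pow_fixed hq, hD, ih, one_mul]

/-- Commuting diffeomorphisms with bounded distortion: the argument of Kopell's lemma. -/
theorem eq_of_bounded_distortion (hh : IsC1Holder τ h) {w : ℕ → I ≃ₜ I}
    (hw : ∀ n, IsC1Holder τ (w n)) (hc : ∀ n, Commute h (w n)) {α β q : I}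
    (hα : h α = α) (hβ : h β = β) {C : ℝ}
    (hC : ∀ n, ∀ x ∈ Icc α β, ∀ y ∈ Icc α β,
      |Real.log (D (w n) x) - Real.log (D (w n) y)| ≤ C)
    (hq : ∀ x ∈ Icc α β, Tendsto (fun n => w n x) atTop (𝓝 q))
    (hhq : h q = q) (hDq : D h q = 1) : ∀ x ∈ Icc α β, h x = x := by
  have hmem : ∀ m : ℕ, ∀ x ∈ Icc α β, (h ^ m) x ∈ Icc α β := by
    intro m x hx
    have := (strictMono_pow hh.strictMono m).monotone
    exact ⟨by simpa [pow_fixed hα m] using this hx.1, by simpa [pow_fixed hβ m] using this hx.2⟩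
  -- By commutation, `D (h ^ m) x` is `D (h ^ m) (w n x)` times a ratio of derivatives of `w n`. The
  -- first factor tends to `D (h ^ m) q = 1` and the ratio is at least `exp (-C)`, whatever `m` is.
  have lower : ∀ m : ℕ, ∀ x ∈ Icc α β, Real.exp (-C) ≤ D (h ^ m) x := by
    intro m x hx
    have hm := hh.pow m
    rw [← Real.le_log_iff_exp_le (hm.D_pos x)]
    have hlim : Tendsto (fun n => Real.log (D (h ^ m) (w n x))) atTop (𝓝 (Real.log 1)) := by
      rw [← hh.D_pow_fixed hhq hDq m]
      exact ((Real.continuousAt_log (hm.D_pos q).ne').tendsto).comp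
        ((hm.continuous_D.tendsto q).comp (hq x hx))
    rw [Real.log_one] at hlim
    have hle : ∀ n, Real.log (D (h ^ m) (w n x)) - C ≤ Real.log (D (h ^ m) x) := by
      intro n
      have e : D (h ^ m) (w n x) * D (w n) x = D (w n) ((h ^ m) x) * D (h ^ m) x := by
        rw [← hm.D_mul_apply (hw n), ← (hw n).D_mul_apply hm, ((hc n).pow_left m).eq]
      have e' := congrArg Real.log e
      rw [Real.log_mul (hm.D_pos _).ne' ((hw n).D_pos _).ne',
        Real.log_mul ((hw n).D_pos _).ne' (hm.D_pos _).ne'] at e'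
      have := abs_le.1 (hC n x hx _ (hmem m x hx))
      linarith [this.1, this.2]
    have := le_of_tendsto' (b := Real.log (D (h ^ m) x)) (hlim.sub_const C) hle
    linarith
  intro x hx
  by_contra hne
  -- The steps of the orbit of `x` under `h` stay bounded below, although the orbit converges.
  have grow : ∀ m : ℕ, Real.exp (-C) * |(h x : ℝ) - x| ≤
      |((h ^ (m + 1)) x : ℝ) - (h ^ m) x| := by
    intro m
    have hm := hh.pow m
    rw [pow_succ, Homeomorph.mul_apply]
    have hhx : h x ∈ Icc α β := by simpa using hmem 1 x hx
    rcases lt_or_gt_of_ne hne with hlt | hlt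
    · obtain ⟨ξ, hξ, e⟩ := hm.exists_D_eq hlt
      rw [abs_sub_comm, abs_sub_comm ((h ^ m) (h x) : ℝ), e, abs_mul,
        abs_of_pos (hm.D_pos ξ)]
      gcongr
      exact lower m ξ ⟨hhx.1.trans hξ.1.le, hξ.2.le.trans hx.2⟩
    · obtain ⟨ξ, hξ, e⟩ := hm.exists_D_eq hlt
      rw [e, abs_mul, abs_of_pos (hm.D_pos ξ)]
      gcongr
      exact lower m ξ ⟨hx.1.trans hξ.1.le, hξ.2.le.trans hhx.2⟩
  obtain ⟨y, -, hy⟩ := exists_tendsto_pow hh.strictMono x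
  have hy' : Tendsto (fun m : ℕ => ((h ^ m) x : ℝ)) atTop (𝓝 (y : ℝ)) :=
    (continuous_subtype_val.tendsto y).comp hy
  have hlim : Tendsto (fun m : ℕ => |((h ^ (m + 1)) x : ℝ) - (h ^ m) x|) atTop (𝓝 0) := by
    have := (((tendsto_add_atTop_iff_nat 1).2 hy').sub hy').abs
    simpa using this
  have h0 := ge_of_tendsto' hlim grow
  have hpos : 0 < |(h x : ℝ) - x| := abs_pos.2 (sub_ne_zero.2 fun e => hne (Subtype.ext e))
  have := mul_pos (Real.exp_pos (-C)) hpos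
  linarith

/-- If `f` fixes the endpoints of a sequence of nontrivial intervals shrinking to `q`, then `f`
fixes `q` and has derivative one there. -/
theorem IsC1Holder.D_eq_one_of_tendsto (hf : IsC1Holder τ f) {a b : ℕ → I} {q : I}
    (hab : ∀ n, a n < b n) (ha : ∀ n, f (a n) = a n) (hb : ∀ n, f (b n) = b n)
    (hqa : Tendsto a atTop (𝓝 q)) (hqb : Tendsto b atTop (𝓝 q)) : f q = q ∧ D f q = 1 := by
  constructor
  · refine tendsto_nhds_unique ((f.continuous.tendsto q).comp hqa) ?_
    simpa only [Function.comp_def, ha] using hqa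
  · have : ∀ n, ∃ ξ ∈ Ioo (a n) (b n), D f ξ = 1 := by
      intro n
      obtain ⟨ξ, hξ, e⟩ := hf.exists_D_eq (hab n)
      refine ⟨ξ, hξ, ?_⟩
      rw [ha, hb] at e
      have hpos : (0 : ℝ) < (b n : ℝ) - a n := sub_pos.2 (hab n)
      exact (mul_right_cancel₀ hpos.ne' (by rw [one_mul]; exact e)).symm
    choose ξ hξ hD using this
    have hξq : Tendsto ξ atTop (𝓝 q) :=
      tendsto_of_tendsto_of_tendsto_of_le_of_le hqa hqb (fun n => (hξ n).1.le)
        fun n => (hξ n).2.le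
    have h1 : Tendsto (fun n => D f (ξ n)) atTop (𝓝 (D f q)) :=
      (hf.continuous_D.tendsto q).comp hξq
    simp only [hD] at h1
    exact (tendsto_nhds_unique h1 tendsto_const_nhds)

/-- A hyperbolic fixed point is fixed by the centralizer. -/
theorem fixed_of_hyperbolic (hf : IsC1Holder τ f) (hh : IsC1Holder τ h) (hc : Commute h f)
    {p : I} (hp : f p = p) (hD : D f p ≠ 1) : h p = p := by
  by_contra hne
  obtain ⟨q, -, hq⟩ := exists_tendsto_pow hh.strictMono p
  have hfix : ∀ n : ℕ, f ((h ^ n) p) = (h ^ n) p := fun n => by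
    rw [← Commute.homeo_apply (hc.pow_left n), hp]
  -- The derivative of `f` is constant along the orbit of `p`. The orbit consists of fixed points of
  -- `f` converging to `q`, where the derivative of `f` must be one.
  have hDn : ∀ n : ℕ, D f ((h ^ n) p) = D f p := fun n => by
    have e : D f ((h ^ n) p) * D (h ^ n) p = D (h ^ n) (f p) * D f p := by
      rw [← hf.D_mul_apply (hh.pow n), ← (hh.pow n).D_mul_apply hf, (hc.pow_left n).eq]
    rw [hp, mul_comm] at e
    exact mul_left_cancel₀ ((hh.pow n).D_pos p).ne' e
  have hq' := (tendsto_add_atTop_iff_nat 1).2 hq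
  have h1 : D f q = 1 := by
    rcases lt_or_gt_of_ne hne with hlt | hlt
    · refine (hf.D_eq_one_of_tendsto (a := fun n => (h ^ (n + 1)) p) (b := fun n => (h ^ n) p)
        (fun n => ?_) (fun n => hfix _) (fun n => hfix _) hq' hq).2
      rw [pow_succ, Homeomorph.mul_apply]
      exact strictMono_pow hh.strictMono n hlt
    · refine (hf.D_eq_one_of_tendsto (b := fun n => (h ^ (n + 1)) p) (a := fun n => (h ^ n) p)
        (fun n => ?_) (fun n => hfix _) (fun n => hfix _) hq hq').2
      rw [pow_succ, Homeomorph.mul_apply]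
      exact strictMono_pow hh.strictMono n hlt
  have h2 : Tendsto (fun n : ℕ => D f ((h ^ n) p)) atTop (𝓝 (D f q)) :=
    (hf.continuous_D.tendsto q).comp hq
  simp only [hDn] at h2
  exact hD ((tendsto_nhds_unique tendsto_const_nhds h2).trans h1)

/-- Distortion of powers along an orbit. -/
theorem log_D_pow_sub_le (hf : IsC1Holder τ f) {C : ℝ}
    (hC : ∀ x y : I, |Real.log (D f x) - Real.log (D f y)| ≤ C * |(x : ℝ) - y| ^ (τ : ℝ))
    (n : ℕ) (x y : I) :
    |Real.log (D (f ^ n) x) - Real.log (D (f ^ n) y)| ≤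
      C * ∑ i ∈ Finset.range n, |((f ^ i) x : ℝ) - (f ^ i) y| ^ (τ : ℝ) := by
  induction n with
  | zero => simp [D_one x.2, D_one y.2]
  | succ n ih =>
    rw [pow_succ', hf.D_mul_apply (hf.pow n), hf.D_mul_apply (hf.pow n),
      Real.log_mul (hf.D_pos _).ne' ((hf.pow n).D_pos _).ne',
      Real.log_mul (hf.D_pos _).ne' ((hf.pow n).D_pos _).ne', Finset.sum_range_succ, mul_add]
    have := hC ((f ^ n) x) ((f ^ n) y)
    rw [abs_le] at *
    constructor <;> linarith [this.1, this.2, ih.1, ih.2]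

end Smooth

end IntervalDiff

/-! ### Ping-pong and uniform contractions -/

namespace IntervalDiff

open Set Filter Topology

section PingPong

/-- The composite of the first `i` letters of a word, the head of the list acting first. -/
def wordPrefix (s : Bool → I ≃ₜ I) : List Bool → ℕ → I ≃ₜ I
  | _, 0 => 1
  | [], _ + 1 => 1
  | b :: l, i + 1 => wordPrefix s l i * s b

/-- The average of a function over all words of length `n`. -/
noncomputable def wordAverage : ℕ → (List Bool → ℝ) → ℝ
  | 0, F => F []
  | n + 1, F =>
    (wordAverage n (fun l => F (false :: l)) + wordAverage n (fun l => F (true :: l))) / 2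

theorem wordAverage_mono (n : ℕ) {F F' : List Bool → ℝ} (h : ∀ l, F l ≤ F' l) :
    wordAverage n F ≤ wordAverage n F' := by
  induction n generalizing F F' with
  | zero => exact h []
  | succ n ih =>
    have h1 := ih (fun l => h (false :: l))
    have h2 := ih (fun l => h (true :: l))
    simp only [wordAverage]
    linarith

theorem wordAverage_add (n : ℕ) (F F' : List Bool → ℝ) :
    wordAverage n (fun l => F l + F' l) = wordAverage n F + wordAverage n F' := by
  induction n generalizing F F' with
  | zero => rfl
  | succ n ih => simp only [wordAverage, ih]; ring

theorem wordAverage_const_mul (n : ℕ) (c : ℝ) (F : List Bool → ℝ) :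
    wordAverage n (fun l => c * F l) = c * wordAverage n F := by
  induction n generalizing F with
  | zero => rfl
  | succ n ih => simp only [wordAverage, ih]; ring

theorem wordAverage_const (n : ℕ) (c : ℝ) : wordAverage n (fun _ => c) = c := by
  induction n with
  | zero => rfl
  | succ n ih => simp only [wordAverage, ih]; ring

theorem wordAverage_sum (n m : ℕ) (F : ℕ → List Bool → ℝ) :
    wordAverage n (fun l => ∑ i ∈ Finset.range m, F i l) =
      ∑ i ∈ Finset.range m, wordAverage n (F i) := by
  induction m with
  | zero => simpa using wordAverage_const n 0
  | succ m ih => simp only [Finset.sum_range_succ, wordAverage_add, ih]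

theorem exists_le_of_wordAverage_le {n : ℕ} {F : List Bool → ℝ} {c : ℝ}
    (h : wordAverage n F ≤ c) : ∃ l : List Bool, l.length = n ∧ F l ≤ c := by
  induction n generalizing F with
  | zero => exact ⟨[], rfl, h⟩
  | succ n ih =>
    by_cases h1 : wordAverage n (fun l => F (false :: l)) ≤ c
    · obtain ⟨l, hl, hF⟩ := ih h1
      exact ⟨false :: l, by simp [hl], hF⟩
    · have h2 : wordAverage n (fun l => F (true :: l)) ≤ c := by
        simp only [wordAverage] at h
        linarith
      obtain ⟨l, hl, hF⟩ := ih h2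
      exact ⟨true :: l, by simp [hl], hF⟩

variable {s : Bool → I ≃ₜ I}

theorem strictMono_wordPrefix (hs : ∀ b, StrictMono (s b)) (l : List Bool) (i : ℕ) :
    StrictMono (wordPrefix s l i) := by
  induction l generalizing i with
  | nil => cases i <;> exact strictMono_id
  | cons b l ih =>
    cases i with
    | zero => exact strictMono_id
    | succ i => exact (ih i).comp (hs b)

/-- The two letters map `[α, β]` to non-overlapping subintervals, so each further letter halves the
average length. -/
theorem wordAverage_length_le (hs : ∀ b, StrictMono (s b)) {α β : I}
    (hα : ∀ b, α ≤ s b α) (hβ : ∀ b, s b β ≤ β) (hdis : s false β ≤ s true α) {n i : ℕ}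
    (hi : i ≤ n) :
    wordAverage n (fun l => (wordPrefix s l i β : ℝ) - wordPrefix s l i α) ≤
      (1 / 2) ^ i * ((β : ℝ) - α) := by
  induction n generalizing i with
  | zero =>
    obtain rfl : i = 0 := by omega
    simp [wordAverage, wordPrefix]
  | succ n ih =>
    cases i with
    | zero =>
      have : wordAverage (n + 1) (fun l => (wordPrefix s l 0 β : ℝ) - wordPrefix s l 0 α) =
          wordAverage (n + 1) (fun _ => (β : ℝ) - α) := by
        congr 1; funext l; cases l <;> rfl
      rw [this, wordAverage_const]
      simp
    | succ i =>
      have h1 := ih (i := i) (by omega)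
      simp only [wordAverage, wordPrefix, Homeomorph.mul_apply]
      rw [← wordAverage_add]
      have h2 := wordAverage_mono n (F := fun l =>
        ((wordPrefix s l i (s false β) : ℝ) - wordPrefix s l i (s false α)) +
          ((wordPrefix s l i (s true β) : ℝ) - wordPrefix s l i (s true α)))
        (F' := fun l => (wordPrefix s l i β : ℝ) - wordPrefix s l i α) (fun l => by
          have hm := (strictMono_wordPrefix hs l i).monotone
          have e1 : (wordPrefix s l i α : ℝ) ≤ wordPrefix s l i (s false α) := hm (hα _)
          have e2 : (wordPrefix s l i (s true β) : ℝ) ≤ wordPrefix s l i β := hm (hβ _)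
          have e3 : (wordPrefix s l i (s false β) : ℝ) ≤ wordPrefix s l i (s true α) := hm hdis
          linarith)
      rw [pow_succ]
      linarith

theorem isC1Holder_wordPrefix {τ : ℝ≥0} (hs : ∀ b, IsC1Holder τ (s b)) (l : List Bool) (i : ℕ) :
    IsC1Holder τ (wordPrefix s l i) := by
  induction l generalizing i with
  | nil => cases i <;> exact IsC1Holder.one τ
  | cons b l ih =>
    cases i with
    | zero => exact IsC1Holder.one τ
    | succ i => exact (ih i).mul (hs b)

theorem log_D_wordPrefix_sub_le {τ : ℝ≥0} (hs : ∀ b, IsC1Holder τ (s b)) {C : ℝ}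
    (hC : ∀ b, ∀ x y : I,
      |Real.log (D (s b) x) - Real.log (D (s b) y)| ≤ C * |(x : ℝ) - y| ^ (τ : ℝ))
    (l : List Bool) (x y : I) :
    |Real.log (D (wordPrefix s l l.length) x) - Real.log (D (wordPrefix s l l.length) y)| ≤
      C * ∑ i ∈ Finset.range l.length,
        |(wordPrefix s l i x : ℝ) - wordPrefix s l i y| ^ (τ : ℝ) := by
  induction l generalizing x y with
  | nil => simp [wordPrefix, D_one x.2, D_one y.2]
  | cons b l ih =>
    have hl := isC1Holder_wordPrefix hs l l.length
    rw [List.length_cons, Finset.sum_range_succ', mul_add]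
    simp only [wordPrefix]
    rw [hl.D_mul_apply (hs b), hl.D_mul_apply (hs b),
      Real.log_mul (hl.D_pos _).ne' ((hs b).D_pos _).ne',
      Real.log_mul (hl.D_pos _).ne' ((hs b).D_pos _).ne']
    have h1 := hC b x y
    have h2 := ih (s b x) (s b y)
    simp only [Homeomorph.mul_apply, Homeomorph.one_apply]
    rw [abs_le] at *
    constructor <;> linarith [h1.1, h1.2, h2.1, h2.2]

theorem wordPrefix_mem (l : List Bool) (i : ℕ) :
    wordPrefix s l i ∈ Subgroup.closure (range s) := by
  induction l generalizing i with
  | nil => cases i <;> exact one_mem _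
  | cons b l ih =>
    cases i with
    | zero => exact one_mem _
    | succ i => exact mul_mem (ih i) (Subgroup.subset_closure ⟨b, rfl⟩)

/-- Substitute for Jensen's inequality: with `ε = (1 / 2) ^ i` it turns the bound on average lengths
into one on their `τ`-th powers, at the cost of a factor two. -/
theorem rpow_le_add_mul {t x ε : ℝ} (ht : 0 ≤ t) (ht1 : t ≤ 1) (hx : 0 ≤ x) (hε : 0 < ε) :
    x ^ t ≤ ε ^ t + ε ^ (t - 1) * x := by
  rcases le_total x ε with h | h
  · have := Real.rpow_le_rpow hx h ht
    have : 0 ≤ ε ^ (t - 1) * x := by positivity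
    linarith
  · have hx0 : 0 < x := hε.trans_le h
    have h1 : x ^ t = x ^ (t - 1) * x := by rw [Real.rpow_sub_one hx0.ne']; field_simp
    have h2 : x ^ (t - 1) ≤ ε ^ (t - 1) := Real.rpow_le_rpow_of_nonpos hε h (by linarith)
    have : 0 ≤ ε ^ t := by positivity
    nlinarith

/-- A ping-pong pair of diffeomorphisms generates a uniform contraction. -/
theorem exists_contraction {τ : ℝ≥0} (hτ : 0 < τ) (hτ1 : τ ≤ 1)
    (hs : ∀ b, IsC1Holder τ (s b)) {α β : I} (hαβ : α < β)
    (hα : ∀ b, α < s b α) (hβ : ∀ b, s b β ≤ β) (hdis : s false β ≤ s true α) :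
    ∃ w ∈ Subgroup.closure (range s), IsC1Holder τ w ∧ α < w α ∧ w β ≤ β ∧
      ∀ x ∈ Icc α β, D w x < 1 := by
  obtain ⟨C0, hC00, hC0⟩ := (hs false).exists_log_holder
  obtain ⟨C1, hC10, hC1⟩ := (hs true).exists_log_holder
  set C := max C0 C1 with hCdef
  have hCnn : 0 ≤ C := hC00.trans (le_max_left _ _)
  have hC : ∀ b, ∀ x y : I,
      |Real.log (D (s b) x) - Real.log (D (s b) y)| ≤ C * |(x : ℝ) - y| ^ (τ : ℝ) := by
    intro b x y
    cases b
    · refine (hC0 x y).trans ?_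
      gcongr
      exact le_max_left _ _
    · refine (hC1 x y).trans ?_
      gcongr
      exact le_max_right _ _
  have hsm : ∀ b, StrictMono (s b) := fun b => (hs b).strictMono
  have hτ' : (0 : ℝ) < τ := hτ
  have hτ1' : (τ : ℝ) ≤ 1 := hτ1
  have hlen0 : (0 : ℝ) < (β : ℝ) - α := sub_pos.2 hαβ
  have hlen1 : (β : ℝ) - α ≤ 1 := by linarith [β.2.2, α.2.1]
  set r : ℝ := (1 / 2) ^ (τ : ℝ) with hr
  have hr0 : 0 < r := by positivity
  have hr1 : r < 1 := Real.rpow_lt_one (by norm_num) (by norm_num) hτ'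
  -- `S` is the sum of the series `∑ 2 * r ^ i`, which bounds the averages of the `τ`-th powers of
  -- all prefix lengths.
  set S : ℝ := 2 / (1 - r) with hS
  have hS0 : 0 < S := div_pos two_pos (by linarith)
  have hlen : ∀ l i, 0 ≤ (wordPrefix s l i β : ℝ) - wordPrefix s l i α := fun l i =>
    sub_nonneg.2 ((strictMono_wordPrefix hsm l i).monotone hαβ.le)
  have havg : ∀ n i, i ≤ n →
      wordAverage n (fun l => (wordPrefix s l i β : ℝ) - wordPrefix s l i α) ≤ (1 / 2) ^ i := by
    intro n i hi
    refine (wordAverage_length_le hsm (fun b => (hα b).le) hβ hdis hi).trans ?_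
    exact mul_le_of_le_one_right (by positivity) hlen1
  have havg' : ∀ n i, i ≤ n →
      wordAverage n (fun l => ((wordPrefix s l i β : ℝ) - wordPrefix s l i α) ^ (τ : ℝ)) ≤
        2 * r ^ i := by
    intro n i hi
    have hε : (0 : ℝ) < (1 / 2) ^ i := by positivity
    have h1 := wordAverage_mono n (F := fun l =>
        ((wordPrefix s l i β : ℝ) - wordPrefix s l i α) ^ (τ : ℝ))
      (F' := fun l => ((1 / 2 : ℝ) ^ i) ^ (τ : ℝ) + ((1 / 2 : ℝ) ^ i) ^ ((τ : ℝ) - 1) *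
        ((wordPrefix s l i β : ℝ) - wordPrefix s l i α))
      (fun l => rpow_le_add_mul hτ'.le hτ1' (hlen l i) hε)
    rw [wordAverage_add, wordAverage_const, wordAverage_const_mul] at h1
    have h2 : ((1 / 2 : ℝ) ^ i) ^ (τ : ℝ) = r ^ i := by
      rw [hr, ← Real.rpow_natCast, ← Real.rpow_natCast, ← Real.rpow_mul (by norm_num),
        ← Real.rpow_mul (by norm_num), mul_comm]
    have h3 : ((1 / 2 : ℝ) ^ i) ^ ((τ : ℝ) - 1) * (1 / 2) ^ i = r ^ i := by
      rw [Real.rpow_sub_one hε.ne', h2, div_mul_cancel₀ _ hε.ne']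
    have h4 := mul_le_mul_of_nonneg_left (havg n i hi)
      (show 0 ≤ ((1 / 2 : ℝ) ^ i) ^ ((τ : ℝ) - 1) by positivity)
    rw [h3] at h4
    rw [h2] at h1
    linarith
  -- The distortion bound `exp (C * (2 * S))` does not depend on the word length, so a long word
  -- beats it. The length is `N + 1` because a nonempty word is needed for `α < w α`.
  obtain ⟨N, hN⟩ : ∃ N : ℕ, Real.exp (C * (2 * S)) * (2 / ((β : ℝ) - α)) * (1 / 2) ^ (N + 1) < 1 := by
    have ht : Tendsto (fun N : ℕ => Real.exp (C * (2 * S)) * (2 / ((β : ℝ) - α)) *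
        (1 / 2 : ℝ) ^ (N + 1)) atTop (𝓝 (Real.exp (C * (2 * S)) * (2 / ((β : ℝ) - α)) * 0)) :=
      ((tendsto_add_atTop_iff_nat 1).2
        (tendsto_pow_atTop_nhds_zero_of_lt_one (by norm_num) (by norm_num))).const_mul _
    rw [mul_zero] at ht
    exact (ht.eventually (gt_mem_nhds one_pos)).exists
  set n := N + 1 with hn
  -- Both nonnegative summands have average at most one, so a word with `F l ≤ 2` satisfies both
  -- bounds at once: small distortion and a short image.
  set F : List Bool → ℝ := fun l => S⁻¹ * (∑ i ∈ Finset.range n,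
      ((wordPrefix s l i β : ℝ) - wordPrefix s l i α) ^ (τ : ℝ)) +
    2 ^ n * ((wordPrefix s l n β : ℝ) - wordPrefix s l n α) with hF
  have hFavg : wordAverage n F ≤ 2 := by
    rw [hF, wordAverage_add, wordAverage_const_mul, wordAverage_const_mul, wordAverage_sum]
    have h1 : ∑ i ∈ Finset.range n, wordAverage n
        (fun l => ((wordPrefix s l i β : ℝ) - wordPrefix s l i α) ^ (τ : ℝ)) ≤ S := by
      calc _ ≤ ∑ i ∈ Finset.range n, 2 * r ^ i :=
            Finset.sum_le_sum fun i hi => havg' n i (Finset.mem_range.1 hi).le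
        _ = 2 * ∑ i ∈ Finset.range n, r ^ i := by rw [Finset.mul_sum]
        _ ≤ 2 * (1 - r)⁻¹ := by
            gcongr
            rw [← tsum_geometric_of_lt_one hr0.le hr1]
            exact (summable_geometric_of_lt_one hr0.le hr1).sum_le_tsum _
              fun i _ => by positivity
        _ = S := by rw [hS]; ring
    have h2 := mul_le_mul_of_nonneg_left (havg n n le_rfl) (show (0 : ℝ) ≤ 2 ^ n by positivity)
    rw [← mul_pow] at h2
    norm_num at h2
    have h3 := mul_le_mul_of_nonneg_left h1 (inv_nonneg.2 hS0.le)
    rw [inv_mul_cancel₀ hS0.ne'] at h3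
    linarith
  obtain ⟨l, hl, hFl⟩ := exists_le_of_wordAverage_le hFavg
  have hsum0 : 0 ≤ ∑ i ∈ Finset.range n,
      ((wordPrefix s l i β : ℝ) - wordPrefix s l i α) ^ (τ : ℝ) :=
    Finset.sum_nonneg fun i _ => Real.rpow_nonneg (hlen l i) _
  have hsum : ∑ i ∈ Finset.range n,
      ((wordPrefix s l i β : ℝ) - wordPrefix s l i α) ^ (τ : ℝ) ≤ 2 * S := by
    have : S⁻¹ * (∑ i ∈ Finset.range n,
      ((wordPrefix s l i β : ℝ) - wordPrefix s l i α) ^ (τ : ℝ)) ≤ 2 := by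
      have : 0 ≤ (2 : ℝ) ^ n * ((wordPrefix s l n β : ℝ) - wordPrefix s l n α) :=
        mul_nonneg (by positivity) (hlen l n)
      simp only [hF] at hFl
      linarith
    rw [inv_mul_le_iff₀ hS0] at this
    linarith
  have hend : (wordPrefix s l n β : ℝ) - wordPrefix s l n α ≤ 2 * (1 / 2) ^ n := by
    have : 2 ^ n * ((wordPrefix s l n β : ℝ) - wordPrefix s l n α) ≤ 2 := by
      have : 0 ≤ S⁻¹ * (∑ i ∈ Finset.range n,
        ((wordPrefix s l i β : ℝ) - wordPrefix s l i α) ^ (τ : ℝ)) := by positivity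
      simp only [hF] at hFl
      linarith
    rw [one_div, inv_pow, ← div_eq_mul_inv, le_div_iff₀ (by positivity)]
    linarith
  have hw := isC1Holder_wordPrefix hs l n
  refine ⟨wordPrefix s l n, wordPrefix_mem l n, hw, ?_, ?_, ?_⟩
  · have hle : ∀ (l : List Bool) i, α ≤ wordPrefix s l i α := by
      intro l
      induction l with
      | nil => intro i; cases i <;> exact le_rfl
      | cons b l ih =>
        intro i
        cases i with
        | zero => exact le_rfl
        | succ i => exact (ih i).trans ((strictMono_wordPrefix hsm l i).monotone (hα b).le)
    cases l with
    | nil => simp [hn] at hl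
    | cons b l => exact (hle l N).trans_lt (strictMono_wordPrefix hsm l N (hα b))
  · have hle : ∀ (l : List Bool) i, wordPrefix s l i β ≤ β := by
      intro l
      induction l with
      | nil => intro i; cases i <;> exact le_rfl
      | cons b l ih =>
        intro i
        cases i with
        | zero => exact le_rfl
        | succ i => exact ((strictMono_wordPrefix hsm l i).monotone (hβ b)).trans (ih i)
    exact hle l n
  · intro x hx
    obtain ⟨ξ, hξ, e⟩ := hw.exists_D_eq hαβ
    have hdist := log_D_wordPrefix_sub_le hs hC l x ξ
    rw [hl] at hdist
    have hdist2 : Real.log (D (wordPrefix s l n) x) - Real.log (D (wordPrefix s l n) ξ) ≤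
        C * (2 * S) := by
      refine (le_abs_self _).trans (hdist.trans ?_)
      refine mul_le_mul_of_nonneg_left (le_trans (Finset.sum_le_sum fun i _ => ?_) hsum) hCnn
      refine Real.rpow_le_rpow (abs_nonneg _) ?_ hτ'.le
      have hm := (strictMono_wordPrefix hsm l i).monotone
      have e1 : (wordPrefix s l i α : ℝ) ≤ wordPrefix s l i x := hm hx.1
      have e2 : (wordPrefix s l i x : ℝ) ≤ wordPrefix s l i β := hm hx.2
      have e3 : (wordPrefix s l i α : ℝ) ≤ wordPrefix s l i ξ := hm hξ.1.le
      have e4 : (wordPrefix s l i ξ : ℝ) ≤ wordPrefix s l i β := hm hξ.2.le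
      rw [abs_le]; constructor <;> linarith
    have hx0 := hw.D_pos x
    have hξ0 := hw.D_pos ξ
    rw [← Real.log_div hx0.ne' hξ0.ne', Real.log_le_iff_le_exp (div_pos hx0 hξ0),
      div_le_iff₀ hξ0] at hdist2
    have hDξ : D (wordPrefix s l n) ξ ≤ 2 * (1 / 2) ^ n / ((β : ℝ) - α) := by
      rw [le_div_iff₀ hlen0, ← e]
      exact hend
    calc _ ≤ _ := hdist2
      _ ≤ Real.exp (C * (2 * S)) * (2 * (1 / 2) ^ n / ((β : ℝ) - α)) := by gcongr
      _ = Real.exp (C * (2 * S)) * (2 / ((β : ℝ) - α)) * (1 / 2) ^ n := by ring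
      _ < 1 := hN

end PingPong

end IntervalDiff

/-! ### Support components and crossed elements -/

namespace IntervalDiff

open Set Filter Topology
open scoped commutatorElement

/-- `(u, v)` is a connected component of the support of `f`. -/
structure IsComp (f : I ≃ₜ I) (u v : I) : Prop where
  left : f u = u
  right : f v = v
  moves : ∀ z ∈ Ioo u v, f z ≠ z

theorem map_zero_of_strictMono {f : I ≃ₜ I} (hf : StrictMono f) : f 0 = 0 := by
  refine le_antisymm ?_ unitInterval.nonneg'
  have := hf.monotone (show (0 : I) ≤ f⁻¹ 0 from unitInterval.nonneg')
  rwa [apply_inv_apply] at this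

theorem map_one_of_strictMono {f : I ≃ₜ I} (hf : StrictMono f) : f 1 = 1 := by
  refine le_antisymm unitInterval.le_one' ?_
  have := hf.monotone (show f⁻¹ 1 ≤ (1 : I) from unitInterval.le_one')
  rwa [apply_inv_apply] at this

theorem isClosed_fixed (f : I ≃ₜ I) : IsClosed {z | f z = z} :=
  isClosed_eq f.continuous continuous_id

theorem exists_isComp {f : I ≃ₜ I} (hf : StrictMono f) {x : I} (hx : f x ≠ x) :
    ∃ u v, IsComp f u v ∧ x ∈ Ioo u v := by
  obtain ⟨u, hu, hu'⟩ := ((isClosed_fixed f).inter isClosed_Iic).isCompact.exists_isGreatest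
    (s := {z | f z = z} ∩ Iic x) ⟨0, map_zero_of_strictMono hf, unitInterval.nonneg'⟩
  obtain ⟨v, hv, hv'⟩ := ((isClosed_fixed f).inter isClosed_Ici).isCompact.exists_isLeast
    (s := {z | f z = z} ∩ Ici x) ⟨1, map_one_of_strictMono hf, unitInterval.le_one'⟩
  have hux : u < x := lt_of_le_of_ne hu.2 fun e => hx (e ▸ hu.1)
  have hxv : x < v := lt_of_le_of_ne hv.2 fun e => hx (e ▸ hv.1)
  refine ⟨u, v, ⟨hu.1, hv.1, fun z hz e => ?_⟩, hux, hxv⟩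
  rcases le_total z x with h | h
  · exact absurd (hu' ⟨e, h⟩) (not_le.2 hz.1)
  · exact absurd (hv' ⟨e, h⟩) (not_le.2 hz.2)

theorem lt_or_gt_of_no_fixed (f : I ≃ₜ I) {u v : I} (h : ∀ z ∈ Ioo u v, f z ≠ z) :
    (∀ z ∈ Ioo u v, f z < z) ∨ ∀ z ∈ Ioo u v, z < f z := by
  by_contra! hcon
  obtain ⟨⟨a, ha, ha'⟩, b, hb, hb'⟩ := hcon
  obtain ⟨c, hc, e⟩ := isPreconnected_Ioo.intermediate_value₂ hb ha f.continuous.continuousOn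
    continuousOn_id hb' ha'
  exact h c hc e

namespace IsComp

variable {f g : I ≃ₜ I} {u v : I}

theorem inv (h : IsComp f u v) : IsComp f⁻¹ u v :=
  ⟨inv_fixed h.left, inv_fixed h.right, fun z hz e => h.moves z hz (inv_fixed_iff.1 e)⟩

theorem pow_mem (h : IsComp f u v) (hf : StrictMono f) {z : I} (hz : z ∈ Ioo u v) (n : ℕ) :
    (f ^ n) z ∈ Ioo u v := by
  have hm := strictMono_pow hf n
  exact ⟨by simpa [pow_fixed h.left n] using hm hz.1, by simpa [pow_fixed h.right n] using hm hz.2⟩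

theorem tendsto_pow_left (h : IsComp f u v) (hf : StrictMono f) (hlt : ∀ z ∈ Ioo u v, f z < z)
    {z : I} (hz : z ∈ Ioo u v) : Tendsto (fun n : ℕ => (f ^ n) z) atTop (𝓝 u) := by
  obtain ⟨q, hq, hlim⟩ := exists_tendsto_pow hf z
  have h1 : u ≤ q := ge_of_tendsto' hlim fun n => (h.pow_mem hf hz n).1.le
  have h2 : q ≤ z := le_of_tendsto' hlim fun n => by
    induction n with
    | zero => exact le_rfl
    | succ n ih => rw [pow_succ_apply]; exact (hlt _ (h.pow_mem hf hz n)).le.trans ih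
  rcases h1.eq_or_lt with rfl | h3
  · exact hlim
  · exact absurd hq (h.moves q ⟨h3, h2.trans_lt hz.2⟩)

theorem tendsto_pow_right (h : IsComp f u v) (hf : StrictMono f) (hlt : ∀ z ∈ Ioo u v, z < f z)
    {z : I} (hz : z ∈ Ioo u v) : Tendsto (fun n : ℕ => (f ^ n) z) atTop (𝓝 v) := by
  obtain ⟨q, hq, hlim⟩ := exists_tendsto_pow hf z
  have h1 : q ≤ v := le_of_tendsto' hlim fun n => (h.pow_mem hf hz n).2.le
  have h2 : z ≤ q := ge_of_tendsto' hlim fun n => by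
    induction n with
    | zero => exact le_rfl
    | succ n ih => rw [pow_succ_apply]; exact ih.trans (hlt _ (h.pow_mem hf hz n)).le
  rcases h1.eq_or_lt with rfl | h3
  · exact hlim
  · exact absurd hq (h.moves q ⟨hz.1.trans_le h2, h3⟩)

/-- A commuting homeomorphism fixing a point of a component fixes its endpoints. -/
theorem fixed_left (hA : IsComp f u v) (hg : StrictMono g) (hc : Commute g f) {p : I}
    (hp : p ∈ Ioo u v) (hgp : g p = p) : g u = u := by
  have h1 : f (g u) = g u := by rw [← Commute.homeo_apply hc, hA.left]
  rcases lt_trichotomy (g u) u with h | h | h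
  · exfalso
    have h2 : u < g⁻¹ u := by
      rw [← hg.lt_iff_lt, apply_inv_apply]; exact h
    have h3 : g⁻¹ u < p := by
      rw [← hg.lt_iff_lt, apply_inv_apply, hgp]; exact hp.1
    refine hA.moves _ ⟨h2, h3.trans hp.2⟩ ?_
    rw [← Commute.homeo_apply hc.inv_left, hA.left]
  · exact h
  · refine absurd h1 (hA.moves _ ⟨h, ?_⟩)
    have := hg hp.1
    rw [hgp] at this
    exact this.trans hp.2

theorem map_commute (hA : IsComp f u v) (hg : StrictMono g) (hc : Commute g f) :
    IsComp f (g u) (g v) := by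
  refine ⟨by rw [← Commute.homeo_apply hc, hA.left], by rw [← Commute.homeo_apply hc, hA.right],
    fun z hz e => hA.moves (g⁻¹ z) ⟨?_, ?_⟩ ?_⟩
  · rw [← hg.lt_iff_lt, apply_inv_apply]; exact hz.1
  · rw [← hg.lt_iff_lt, apply_inv_apply]; exact hz.2
  · rw [← Commute.homeo_apply hc.inv_left, e]

end IsComp

/-- The diffeomorphisms fixing `p` with derivative one. -/
def tangentToId (τ : ℝ≥0) (p : I) : Subgroup (I ≃ₜ I) where
  carrier := {h | IsC1Holder τ h ∧ h p = p ∧ D h p = 1}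
  mul_mem' := by
    rintro a b ⟨ha, ha', ha''⟩ ⟨hb, hb', hb''⟩
    refine ⟨ha.mul hb, by rw [Homeomorph.mul_apply, hb', ha'], ?_⟩
    rw [ha.D_mul_apply hb, hb', ha'', hb'', one_mul]
  one_mem' := ⟨IsC1Holder.one τ, rfl, D_one p.2⟩
  inv_mem' := by
    rintro a ⟨ha, ha', ha''⟩
    refine ⟨ha.inv, inv_fixed ha', ?_⟩
    have := ha.D_mul_apply ha.inv p
    rw [mul_inv_cancel, D_one p.2, inv_fixed ha', ha'', one_mul] at this
    exact this.symm

/-- At a common fixed point the derivative is a homomorphism to the abelian group of positive reals.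
-/
theorem commutator_le_tangentToId {τ : ℝ≥0} {T : Subgroup (I ≃ₜ I)} (hT : T ≤ Diff τ) {p : I}
    (hp : ∀ h ∈ T, h p = p) : ⁅T, T⁆ ≤ tangentToId τ p := by
  rw [Subgroup.commutator_le]
  intro a ha b hb
  have ha1 : IsC1Holder τ a := hT ha
  have hb1 : IsC1Holder τ b := hT hb
  have hab := ha1.mul hb1
  have hba := hb1.mul ha1
  have e1 : ⁅a, b⁆ * (b * a) = a * b := by rw [commutatorElement_def]; group
  have hcomm : IsC1Holder τ ⁅a, b⁆ := by
    rw [commutatorElement_def]; exact (hab.mul ha1.inv).mul hb1.inv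
  have hfix : ⁅a, b⁆ p = p := by
    simp only [commutatorElement_def, Homeomorph.mul_apply, inv_fixed (hp a ha),
      inv_fixed (hp b hb), hp a ha, hp b hb]
  refine ⟨hcomm, hfix, ?_⟩
  have e2 := hcomm.D_mul_apply hba p
  rw [e1, Homeomorph.mul_apply, hp a ha, hp b hb, ha1.D_mul_apply hb1, hb1.D_mul_apply ha1,
    hp a ha, hp b hb, mul_comm (D b p)] at e2
  have hpos := mul_pos (ha1.D_pos p) (hb1.D_pos p)
  exact (mul_right_cancel₀ hpos.ne' (by rw [one_mul]; exact e2)).symm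

/-- A uniform contraction of `[α, p]` to a hyperbolic fixed point `p` forces commuting
diffeomorphisms which fix `α` and are tangent to the identity at `p` to be trivial. -/
theorem eq_of_contraction {τ : ℝ≥0} (hτ : 0 < τ) {w h : I ≃ₜ I} (hw : IsC1Holder τ w)
    (hh : IsC1Holder τ h) (hc : Commute h w) {α p : I} (hαp : α ≤ p) (hα : α ≤ w α)
    (hp : w p = p) (hD : ∀ x ∈ Icc α p, D w x < 1) (hhα : h α = α) (hhp : h p = p)
    (hDp : D h p = 1) : ∀ x ∈ Icc α p, h x = x := by
  obtain ⟨C, hC0, hC⟩ := hw.exists_log_holder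
  obtain ⟨z, hz, hzmax⟩ := (isCompact_Icc (a := α) (b := p)).exists_isMaxOn
    ⟨α, le_rfl, hαp⟩ hw.continuous_D.continuousOn
  set r := D w z with hr
  have hr0 : 0 < r := hw.D_pos z
  have hr1 : r < 1 := hD z hz
  have hmap : ∀ x ∈ Icc α p, w x ∈ Icc α p := fun x hx =>
    ⟨hα.trans (hw.strictMono.monotone hx.1), hp ▸ hw.strictMono.monotone hx.2⟩
  have hmapn : ∀ n : ℕ, ∀ x ∈ Icc α p, (w ^ n) x ∈ Icc α p := by
    intro n
    induction n with
    | zero => exact fun x hx => hx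
    | succ n ih => intro x hx; rw [pow_succ_apply]; exact hmap _ (ih x hx)
  have hcon : ∀ x ∈ Icc α p, ∀ y ∈ Icc α p, |(w x : ℝ) - w y| ≤ r * |(x : ℝ) - y| := by
    intro x hx y hy
    wlog hxy : x ≤ y generalizing x y
    · rw [abs_sub_comm, abs_sub_comm (x : ℝ)]
      exact this y hy x hx (le_of_not_ge hxy)
    rcases hxy.eq_or_lt with rfl | hlt
    · simp
    · obtain ⟨ξ, hξ, e⟩ := hw.exists_D_eq hlt
      rw [abs_sub_comm, abs_sub_comm (x : ℝ), e, abs_mul, abs_of_pos (hw.D_pos ξ)]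
      gcongr
      exact hzmax ⟨hx.1.trans hξ.1.le, hξ.2.le.trans hy.2⟩
  have hconn : ∀ n : ℕ, ∀ x ∈ Icc α p, ∀ y ∈ Icc α p,
      |((w ^ n) x : ℝ) - (w ^ n) y| ≤ r ^ n := by
    intro n x hx y hy
    induction n with
    | zero =>
      simp only [pow_zero, Homeomorph.one_apply]
      rw [abs_le]; constructor <;> linarith [x.2.1, x.2.2, y.2.1, y.2.2]
    | succ n ih =>
      rw [pow_succ_apply, pow_succ_apply, pow_succ']
      exact (hcon _ (hmapn n x hx) _ (hmapn n y hy)).trans (by gcongr)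
  set ρ := r ^ (τ : ℝ) with hρ
  have hρ0 : 0 < ρ := by positivity
  have hρ1 : ρ < 1 := Real.rpow_lt_one hr0.le hr1 hτ
  -- The images of `[α, p]` under `w ^ i` have length at most `r ^ i`, so their `τ`-th powers are
  -- dominated by a geometric series and the powers of `w` have bounded distortion.
  refine eq_of_bounded_distortion hh (w := fun n => w ^ n) (fun n => hw.pow n)
    (fun n => hc.pow_right n) hhα hhp (C := C * (1 - ρ)⁻¹) (q := p) ?_ ?_ hhp hDp
  · intro n x hx y hy
    refine (log_D_pow_sub_le hw hC n x y).trans (mul_le_mul_of_nonneg_left ?_ hC0)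
    rw [← tsum_geometric_of_lt_one hρ0.le hρ1]
    refine le_trans (Finset.sum_le_sum fun i _ => ?_)
      ((summable_geometric_of_lt_one hρ0.le hρ1).sum_le_tsum (Finset.range n)
        fun i _ => by positivity)
    calc _ ≤ (r ^ i) ^ (τ : ℝ) := Real.rpow_le_rpow (abs_nonneg _) (hconn i x hx y hy) τ.2
      _ = ρ ^ i := by
        rw [hρ, ← Real.rpow_natCast, ← Real.rpow_natCast, ← Real.rpow_mul hr0.le,
          ← Real.rpow_mul hr0.le, mul_comm]
  · intro x hx
    rw [tendsto_iff_dist_tendsto_zero]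
    refine squeeze_zero (fun _ => dist_nonneg) (fun n => ?_)
      (tendsto_pow_atTop_nhds_zero_of_lt_one hr0.le hr1)
    rw [Subtype.dist_eq, Real.dist_eq]
    have := hconn n x hx p ⟨hαp, le_rfl⟩
    rwa [pow_fixed hp] at this

/-- Powers of `f` pull points towards `u`, while `g` moves `u` inside the component; together they
play ping-pong near `u`. The resulting contraction `w` has a hyperbolic fixed point `p`, which `T`
must fix, and then `T` also fixes `u`. Kopell's argument applies to the commutators on `[u, p]`, and
powers of `f` carry the conclusion to the whole component. -/
theorem commutator_trivial_of_crossing_aux {τ : ℝ≥0} (hτ : 0 < τ) (hτ1 : τ ≤ 1)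
    {T : Subgroup (I ≃ₜ I)}
    (hT : T ≤ Diff τ) {f g : I ≃ₜ I} (hf : IsC1Holder τ f) (hg : IsC1Holder τ g)
    (hcf : f ∈ Subgroup.centralizer (T : Set (I ≃ₜ I)))
    (hcg : g ∈ Subgroup.centralizer (T : Set (I ≃ₜ I))) {u v : I} (hA : IsComp f u v)
    (hlt : ∀ z ∈ Ioo u v, f z < z) (hgu : g u ∈ Ioo u v) :
    ∀ h ∈ ⁅T, T⁆, ∀ z ∈ Ioo u v, h z = z := by
  have hfm := hf.strictMono
  have hgm := hg.strictMono
  -- With `v'` below `g⁻¹ v`, the point `g v'` remains in the component, and a power of `f` brings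
  -- it below `v'`.
  obtain ⟨v', hv1, hv2⟩ : ∃ v', u < v' ∧ v' < min v (g⁻¹ v) := by
    apply exists_between
    refine lt_min (hgu.1.trans hgu.2) ?_
    rw [← hgm.lt_iff_lt, apply_inv_apply]
    exact hgu.2
  have hv'v : v' < v := hv2.trans_le (min_le_left _ _)
  have hgv' : g v' < v := by
    have := hgm (hv2.trans_le (min_le_right _ _))
    rwa [apply_inv_apply] at this
  have hgv'' : g v' ∈ Ioo u v := ⟨hgu.1.trans (hgm hv1), hgv'⟩
  obtain ⟨M, hM⟩ := ((hA.tendsto_pow_left hfm hlt hgv'').eventually (gt_mem_nhds hv1)).exists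
  set s1 := f ^ M * g with hs1
  have hs1u : u < s1 u := (hA.pow_mem hfm hgu M).1
  have hs1v : s1 v' < v' := hM
  obtain ⟨N, hN⟩ := ((hA.tendsto_pow_left hfm hlt ⟨hv1, hv'v⟩).eventually
    (gt_mem_nhds hs1u)).exists
  set s0 := f ^ N with hs0
  have hs0u : s0 u = u := pow_fixed hA.left N
  have hs0v : s0 v' < s1 u := hN
  have hs1C : IsC1Holder τ s1 := (hf.pow M).mul hg
  have hs0C : IsC1Holder τ s0 := hf.pow N
  have hs1m := hs1C.strictMono
  -- The map `s0` fixes `u`, whereas both letters must move it strictly to the right. Composing with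
  -- `s1` repairs this and keeps the two images apart.
  obtain ⟨w, hwcl, hw, hwu, hwv, hDw⟩ := exists_contraction hτ hτ1
    (s := fun b => cond b (s1 * s1) (s1 * s0)) (by
      intro b; cases b
      · exact hs1C.mul hs0C
      · exact hs1C.mul hs1C) hv1 (by
      intro b; cases b
      · change u < s1 (s0 u)
        rwa [hs0u]
      · exact hs1u.trans (hs1m hs1u)) (by
      intro b; cases b
      · exact (hs1m (hs0v.trans (hs1m hv1))).le.trans ((hs1m hs1v).le.trans hs1v.le)
      · exact (hs1m hs1v).le.trans hs1v.le) (hs1m hs0v).le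
  have hs0c : s0 ∈ Subgroup.centralizer (T : Set (I ≃ₜ I)) := pow_mem hcf N
  have hs1c : s1 ∈ Subgroup.centralizer (T : Set (I ≃ₜ I)) := mul_mem (pow_mem hcf M) hcg
  have hwc : w ∈ Subgroup.centralizer (T : Set (I ≃ₜ I)) := by
    refine (Subgroup.closure_le _).2 ?_ hwcl
    rintro _ ⟨b, rfl⟩
    cases b
    · exact mul_mem hs1c hs0c
    · exact mul_mem hs1c hs1c
  have hcommw : ∀ h ∈ T, Commute h w := fun h hh => Subgroup.mem_centralizer_iff.1 hwc h hh
  have hcommf : ∀ h ∈ T, Commute h f := fun h hh => Subgroup.mem_centralizer_iff.1 hcf h hh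
  obtain ⟨p, hwp, hp⟩ := exists_tendsto_pow hw.strictMono u
  have hup : u < p := by
    have hle : ∀ n : ℕ, u ≤ (w ^ n) u := fun n => by
      induction n with
      | zero => exact le_rfl
      | succ n ih => rw [pow_succ_apply]; exact hwu.le.trans (hw.strictMono.monotone ih)
    refine hwu.trans_le (ge_of_tendsto' ((tendsto_add_atTop_iff_nat 1).2 hp) fun n => ?_)
    rw [pow_succ_apply]
    exact hw.strictMono.monotone (hle n)
  have hpv : p ≤ v' := by
    refine le_of_tendsto' hp fun n => ?_
    induction n with
    | zero => exact hv1.le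
    | succ n ih => rw [pow_succ_apply]; exact (hw.strictMono.monotone ih).trans hwv
  have hpA : p ∈ Ioo u v := ⟨hup, hpv.trans_lt hv'v⟩
  have hTp : ∀ h ∈ T, h p = p := fun h hh =>
    fixed_of_hyperbolic hw (hT hh) (hcommw h hh) hwp (hDw p ⟨hup.le, hpv⟩).ne
  have hle : ⁅T, T⁆ ≤ T := by
    rw [Subgroup.commutator_le]
    intro a ha b hb
    rw [commutatorElement_def]
    exact mul_mem (mul_mem (mul_mem ha hb) (inv_mem ha)) (inv_mem hb)
  intro h hh
  have hhT : h ∈ T := hle hh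
  have hhC : IsC1Holder τ h := hT hhT
  have hDh := (commutator_le_tangentToId hT hTp hh).2.2
  have hhu : h u = u := hA.fixed_left hhC.strictMono (hcommf h hhT) hpA (hTp h hhT)
  have key := eq_of_contraction hτ hw hhC (hcommw h hhT) hup.le hwu.le hwp
    (fun x hx => hDw x ⟨hx.1, hx.2.trans hpv⟩) hhu (hTp h hhT) hDh
  intro z hz
  -- A power of `f`, which commutes with `h`, brings `z` into `[u, p]`.
  obtain ⟨n, hn⟩ := ((hA.tendsto_pow_left hfm hlt hz).eventually (gt_mem_nhds hup)).exists
  have h1 := key _ ⟨(hA.pow_mem hfm hz n).1.le, le_of_lt hn⟩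
  rw [Commute.homeo_apply ((hcommf h hhT).pow_right n)] at h1
  exact (f ^ n).injective h1

/-- If `f` and `g` are crossed on a component of the support of `f`, then the commutator subgroup
of any group of diffeomorphisms commuting with `f` and `g` is trivial on this component. -/
theorem commutator_trivial_of_crossing_left {τ : ℝ≥0} (hτ : 0 < τ) (hτ1 : τ ≤ 1)
    {T : Subgroup (I ≃ₜ I)}
    (hT : T ≤ Diff τ) {f g : I ≃ₜ I} (hf : IsC1Holder τ f) (hg : IsC1Holder τ g)
    (hcf : f ∈ Subgroup.centralizer (T : Set (I ≃ₜ I)))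
    (hcg : g ∈ Subgroup.centralizer (T : Set (I ≃ₜ I))) {u v : I} (hA : IsComp f u v)
    (hgu : g u ∈ Ioo u v) : ∀ h ∈ ⁅T, T⁆, ∀ z ∈ Ioo u v, h z = z := by
  rcases lt_or_gt_of_no_fixed f hA.moves with h | h
  · exact commutator_trivial_of_crossing_aux hτ hτ1 hT hf hg hcf hcg hA h hgu
  · refine commutator_trivial_of_crossing_aux hτ hτ1 hT hf.inv hg (inv_mem hcf) hcg hA.inv ?_ hgu
    intro z hz
    rw [← hf.strictMono.lt_iff_lt, apply_inv_apply]
    exact h z hz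

end IntervalDiff

/-! ### Reflection of the interval and absence of crossings -/

namespace IntervalDiff

open Set Filter Topology
open scoped commutatorElement

section Reflection

theorem toReal_symmHomeomorph :
    EqOn (toReal unitInterval.symmHomeomorph) (fun x => 1 - x) (Icc 0 1) := fun _ hx =>
  toReal_apply _ hx

theorem contDiffOn_symmHomeomorph :
    ContDiffOn ℝ 1 (toReal unitInterval.symmHomeomorph) (Icc 0 1) :=
  (contDiffOn_const.sub contDiffOn_id).congr toReal_symmHomeomorph

theorem D_symmHomeomorph {x : ℝ} (hx : x ∈ Icc (0 : ℝ) 1) :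
    D unitInterval.symmHomeomorph x = -1 := by
  unfold D
  rw [derivWithin_congr toReal_symmHomeomorph (toReal_symmHomeomorph hx)]
  have h := ((hasDerivAt_id x).const_sub 1).hasDerivWithinAt (s := Icc (0 : ℝ) 1)
  exact h.derivWithin (uniqueDiffOn_Icc zero_lt_one x hx)

/-- Conjugation by the reflection of the interval. -/
noncomputable def reflect : (I ≃ₜ I) →* (I ≃ₜ I) :=
  (MulAut.conj (unitInterval.symmHomeomorph : I ≃ₜ I)).toMonoidHom

theorem reflect_apply (f : I ≃ₜ I) (x : I) :
    reflect f x = unitInterval.symm (f (unitInterval.symm x)) := rfl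

theorem reflect_eq (f : I ≃ₜ I) :
    reflect f = unitInterval.symmHomeomorph * (f * unitInterval.symmHomeomorph) := rfl

theorem IsC1Holder.reflect {τ : ℝ≥0} {f : I ≃ₜ I} (hf : IsC1Holder τ f) :
    IsC1Holder τ (reflect f) where
  strictMono := fun x y hxy => by
    rw [reflect_apply, reflect_apply]
    exact unitInterval.strictAnti_symm (hf.strictMono (unitInterval.strictAnti_symm hxy))
  contDiffOn := by
    rw [reflect_eq, toReal_mul, toReal_mul]
    exact contDiffOn_symmHomeomorph.comp (hf.contDiffOn.comp contDiffOn_symmHomeomorph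
      fun y _ => toReal_mem _ y) fun y _ => toReal_mem f _
  contDiffOn_symm := by
    have : (IntervalDiff.reflect f).symm =
      unitInterval.symmHomeomorph * (f.symm * unitInterval.symmHomeomorph) := rfl
    rw [this, toReal_mul, toReal_mul]
    exact contDiffOn_symmHomeomorph.comp (hf.contDiffOn_symm.comp contDiffOn_symmHomeomorph
      fun y _ => toReal_mem _ y) fun y _ => toReal_mem f.symm _
  holder := by
    obtain ⟨A, hA0, hA⟩ := exists_holderOnWith_iff.1 hf.holder
    refine exists_holderOnWith_iff.2 ⟨A, hA0, fun x hx y hy => ?_⟩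
    have key : ∀ z ∈ Icc (0 : ℝ) 1, D (IntervalDiff.reflect f) z = D f (1 - z) := by
      intro z hz
      have h1 : ContDiffOn ℝ 1 (toReal (f * unitInterval.symmHomeomorph)) (Icc 0 1) := by
        rw [toReal_mul]
        exact hf.contDiffOn.comp contDiffOn_symmHomeomorph fun y _ => toReal_mem _ y
      rw [reflect_eq, D_mul contDiffOn_symmHomeomorph h1 hz,
        D_mul hf.contDiffOn contDiffOn_symmHomeomorph hz, D_symmHomeomorph (toReal_mem _ _),
        D_symmHomeomorph hz, toReal_symmHomeomorph hz]
      ring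
    rw [key x hx, key y hy]
    refine (hA (1 - x) ⟨by linarith [hx.2], by linarith [hx.1]⟩ (1 - y)
      ⟨by linarith [hy.2], by linarith [hy.1]⟩).trans (le_of_eq ?_)
    rw [sub_sub_sub_cancel_left, abs_sub_comm]

end Reflection

theorem IsComp.reflect {f : I ≃ₜ I} {u v : I} (h : IsComp f u v) :
    IsComp (reflect f) (unitInterval.symm v) (unitInterval.symm u) where
  left := by rw [reflect_apply, unitInterval.symm_symm, h.right]
  right := by rw [reflect_apply, unitInterval.symm_symm, h.left]
  moves := fun z hz e => by
    refine h.moves (unitInterval.symm z) ⟨?_, ?_⟩ ?_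
    · rw [← unitInterval.strictAnti_symm.lt_iff_gt, unitInterval.symm_symm]; exact hz.2
    · rw [← unitInterval.strictAnti_symm.lt_iff_gt, unitInterval.symm_symm]; exact hz.1
    · rw [reflect_apply] at e
      have := congrArg unitInterval.symm e
      rwa [unitInterval.symm_symm] at this

theorem reflect_mem_centralizer {T : Subgroup (I ≃ₜ I)} {f : I ≃ₜ I}
    (hf : f ∈ Subgroup.centralizer (T : Set (I ≃ₜ I))) :
    reflect f ∈ Subgroup.centralizer (T.map reflect : Set (I ≃ₜ I)) := by
  rw [Subgroup.mem_centralizer_iff]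
  rintro _ ⟨h, hh, rfl⟩
  rw [← map_mul, ← map_mul, Subgroup.mem_centralizer_iff.1 hf h hh]

/-- The reflection `x ↦ 1 - x` exchanges the endpoints and reduces this to the left-hand case. -/
theorem commutator_trivial_of_crossing_right {τ : ℝ≥0} (hτ : 0 < τ) (hτ1 : τ ≤ 1)
    {T : Subgroup (I ≃ₜ I)}
    (hT : T ≤ Diff τ) {f g : I ≃ₜ I} (hf : IsC1Holder τ f) (hg : IsC1Holder τ g)
    (hcf : f ∈ Subgroup.centralizer (T : Set (I ≃ₜ I)))
    (hcg : g ∈ Subgroup.centralizer (T : Set (I ≃ₜ I))) {u v : I} (hA : IsComp f u v)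
    (hgv : g v ∈ Ioo u v) : ∀ h ∈ ⁅T, T⁆, ∀ z ∈ Ioo u v, h z = z := by
  have hT' : T.map reflect ≤ Diff τ := by
    rintro _ ⟨h, hh, rfl⟩
    exact IsC1Holder.reflect (hT hh)
  have key := commutator_trivial_of_crossing_left hτ hτ1 hT' hf.reflect hg.reflect
    (reflect_mem_centralizer hcf) (reflect_mem_centralizer hcg) hA.reflect (by
      rw [reflect_apply, unitInterval.symm_symm]
      exact ⟨unitInterval.strictAnti_symm hgv.2, unitInterval.strictAnti_symm hgv.1⟩)
  intro h hh z hz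
  rw [← Subgroup.map_commutator] at key
  have := key (reflect h) ⟨h, hh, rfl⟩ (unitInterval.symm z)
    ⟨unitInterval.strictAnti_symm hz.2, unitInterval.strictAnti_symm hz.1⟩
  rw [reflect_apply, unitInterval.symm_symm] at this
  exact unitInterval.symm_bijective.injective this

/-- No two elements of `E` are crossed on a component containing `x`. -/
def Noncrossing (E : Subgroup (I ≃ₜ I)) (x : I) : Prop :=
  ∀ f ∈ E, ∀ g ∈ E, ∀ u v, IsComp f u v → x ∈ Ioo u v → (g u = u ∧ g v = v) ∨ g v ≤ u ∨ v ≤ g u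

/-- If an element of `E` sent an endpoint of the component into its interior, the crossing lemmas
would make `h` fix `x`. Excluding this for both `g` and `g⁻¹` leaves only the three alternatives. -/
theorem noncrossing_of_commutator_moves {τ : ℝ≥0} (hτ : 0 < τ) (hτ1 : τ ≤ 1)
    {E T : Subgroup (I ≃ₜ I)} (hE : E ≤ Diff τ) (hT : T ≤ Diff τ)
    (hc : E ≤ Subgroup.centralizer (T : Set (I ≃ₜ I))) {x : I} {h : I ≃ₜ I} (hh : h ∈ ⁅T, T⁆)
    (hx : h x ≠ x) : Noncrossing E x := by
  intro f hf g hg u v hA hxA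
  have left : ∀ g ∈ E, g u ∉ Ioo u v := fun g hg hgu =>
    hx (commutator_trivial_of_crossing_left hτ hτ1 hT (hE hf) (hE hg) (hc hf) (hc hg) hA hgu
      h hh x hxA)
  have right : ∀ g ∈ E, g v ∉ Ioo u v := fun g hg hgv =>
    hx (commutator_trivial_of_crossing_right hτ hτ1 hT (hE hf) (hE hg) (hc hf) (hc hg) hA hgv
      h hh x hxA)
  have hgm : StrictMono g := (hE hg : IsC1Holder τ g).strictMono
  have huv : u < v := hxA.1.trans hxA.2
  have hguv := hgm huv
  rcases lt_trichotomy (g u) u with h1 | h1 | h1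
  · right; left
    have h2 : u < g⁻¹ u := by rw [← hgm.lt_iff_lt, apply_inv_apply]; exact h1
    have h3 : v ≤ g⁻¹ u := le_of_not_gt fun h3 => left _ (inv_mem hg) ⟨h2, h3⟩
    have := hgm.monotone h3
    rwa [apply_inv_apply] at this
  · left
    refine ⟨h1, ?_⟩
    rcases lt_trichotomy (g v) v with h2 | h2 | h2
    · exact absurd ⟨h1 ▸ hguv, h2⟩ (right g hg)
    · exact h2
    · refine absurd ⟨?_, ?_⟩ (right _ (inv_mem hg))
      · rw [← hgm.lt_iff_lt, apply_inv_apply, h1]; exact huv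
      · rw [← hgm.lt_iff_lt, apply_inv_apply]; exact h2
  · right; right
    exact le_of_not_gt fun h3 => left g hg ⟨h1, h3⟩

end IntervalDiff

/-! ### Hölder's theorem and the Conradian structure -/

namespace IntervalDiff

open Set Filter Topology
open scoped commutatorElement

section Holder

theorem exists_zpow_le_lt {α : Type*} [Group α] [LinearOrder α] [MulLeftMono α]
    [MulRightMono α] (harch : ∀ p : α, 1 < p → ∀ s, ∃ n : ℕ, s < p ^ n) {d : α} (hd : 1 < d)
    (s : α) : ∃ m : ℤ, d ^ m ≤ s ∧ s < d ^ (m + 1) := by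
  have hmono : StrictMono fun n : ℤ => d ^ n := by
    refine strictMono_int_of_lt_succ fun n => ?_
    rw [zpow_add_one]
    exact lt_mul_of_one_lt_right' _ hd
  obtain ⟨n, hn⟩ := harch d hd s
  obtain ⟨n', hn'⟩ := harch d hd s⁻¹
  obtain ⟨m, hm, hmax⟩ := Int.exists_greatest_of_bdd (P := fun z => d ^ z ≤ s)
    ⟨n, fun z hz => by
      by_contra! h
      have h1 := hmono h
      simp only [zpow_natCast] at h1
      exact lt_irrefl _ ((h1.trans_le hz).trans hn)⟩
    ⟨-n', by
      rw [zpow_neg, zpow_natCast]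
      exact (inv_lt'.1 hn').le⟩
  refine ⟨m, hm, lt_of_not_ge fun h => ?_⟩
  have := hmax _ h
  omega

/-- A least positive element generates the group, which is then cyclic. Otherwise some `d > 1` has
`d * d ≤ e` for the commutator `e`; enclosing `a` and `b` between consecutive powers of `d` gives `e
< d * d`. -/
theorem mul_le_mul_comm_of_archimedean {α : Type*} [Group α] [LinearOrder α] [MulLeftMono α]
    [MulRightMono α] (harch : ∀ p : α, 1 < p → ∀ s, ∃ n : ℕ, s < p ^ n) (a b : α) :
    a * b ≤ b * a := by
  by_contra! hlt
  set e := a * b * (b * a)⁻¹ with he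
  have he1 : 1 < e := by
    have := mul_lt_mul_left hlt (b * a)⁻¹
    rwa [mul_inv_cancel] at this
  by_cases hmin : ∃ d : α, 1 < d ∧ ∀ x, 1 < x → d ≤ x
  · obtain ⟨d, hd, hmin⟩ := hmin
    have hpow : ∀ s, ∃ m : ℤ, s = d ^ m := by
      intro s
      obtain ⟨m, h1, h2⟩ := exists_zpow_le_lt harch hd s
      refine ⟨m, ?_⟩
      by_contra hne
      have h3 : 1 < (d ^ m)⁻¹ * s := by
        rw [lt_inv_mul_iff_mul_lt, mul_one]
        exact lt_of_le_of_ne h1 (Ne.symm hne)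
      have h4 := hmin _ h3
      rw [le_inv_mul_iff_mul_le, ← zpow_add_one] at h4
      exact absurd h2 (not_lt.2 h4)
    obtain ⟨m, rfl⟩ := hpow a
    obtain ⟨n, rfl⟩ := hpow b
    rw [← zpow_add, ← zpow_add, add_comm] at hlt
    exact lt_irrefl _ hlt
  · push Not at hmin
    obtain ⟨c, hc1, hce⟩ := hmin e he1
    have h1 : 1 < c⁻¹ * e := by rwa [lt_inv_mul_iff_mul_lt, mul_one]
    obtain ⟨d, hd1, hd2⟩ : ∃ d, 1 < d ∧ d * d ≤ e := by
      refine ⟨min c (c⁻¹ * e), lt_min hc1 h1, ?_⟩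
      calc _ ≤ c * (c⁻¹ * e) := mul_le_mul' (min_le_left _ _) (min_le_right _ _)
        _ = e := by group
    obtain ⟨m, hm1, hm2⟩ := exists_zpow_le_lt harch hd1 a
    obtain ⟨n, hn1, hn2⟩ := exists_zpow_le_lt harch hd1 b
    have h2 : a * b < d ^ (m + 1) * d ^ (n + 1) := mul_lt_mul_of_lt_of_lt hm2 hn2
    have h3 : d ^ n * d ^ m ≤ b * a := mul_le_mul' hn1 hm1
    have h4 : (b * a)⁻¹ ≤ (d ^ n * d ^ m)⁻¹ := inv_le_inv_iff.2 h3
    have h5 : e < d ^ (m + 1) * d ^ (n + 1) * (d ^ n * d ^ m)⁻¹ := mul_lt_mul_of_lt_of_le h2 h4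
    have h6 : d ^ (m + 1) * d ^ (n + 1) * (d ^ n * d ^ m)⁻¹ = d * d := by
      rw [← zpow_add, ← zpow_add, ← zpow_neg, ← zpow_add, ← zpow_two]
      congr 1
      ring
    rw [h6] at h5
    exact absurd hd2 (not_le.2 h5)

/-- **Hölder's theorem**: an Archimedean bi-ordered group is abelian, in terms of its positive
cone. -/
theorem mul_comm_of_archimedean_cone {α : Type*} [Group α] (P : Set α)
    (hmul : ∀ s ∈ P, ∀ t ∈ P, s * t ∈ P) (hconj : ∀ s ∈ P, ∀ t, t * s * t⁻¹ ∈ P)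
    (htri : ∀ s, s = 1 ∨ s ∈ P ∨ s⁻¹ ∈ P) (h1 : (1 : α) ∉ P)
    (harch : ∀ p ∈ P, ∀ s, ∃ n : ℕ, s⁻¹ * p ^ n ∈ P) (a b : α) : a * b = b * a := by
  classical
  let r : α → α → Prop := fun s t => s⁻¹ * t ∈ P
  have : IsStrictTotalOrder α r :=
    { irrefl := fun s hs => h1 (by simpa [r] using hs)
      trans := fun s t u hst htu => by
        have := hmul _ hst _ htu
        simpa [r, mul_assoc] using this
      trichotomous := fun s t hst hts => by
        rcases htri (s⁻¹ * t) with h | h | h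
        · exact (inv_mul_eq_one.1 h)
        · exact absurd h hst
        · rw [mul_inv_rev, inv_inv] at h
          exact absurd h hts }
  let : LinearOrder α := linearOrderOfSTO r
  have hlt : ∀ s t : α, s < t ↔ s⁻¹ * t ∈ P := fun s t => Iff.rfl
  have : MulLeftStrictMono α := ⟨fun c s t h => by
    rw [hlt] at *
    simpa [mul_assoc] using h⟩
  have : MulRightStrictMono α := ⟨fun c s t h => by
    change s * c < t * c
    rw [hlt] at *
    simpa [mul_assoc] using hconj _ h c⁻¹⟩
  have : MulLeftMono α := ⟨fun c s t h => by
    rcases h.eq_or_lt with rfl | h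
    · exact le_rfl
    · exact (mul_lt_mul_right h c).le⟩
  have : MulRightMono α := ⟨fun c s t h => by
    rcases h.eq_or_lt with rfl | h
    · exact le_rfl
    · exact (mul_lt_mul_left h c).le⟩
  have harch' : ∀ p : α, 1 < p → ∀ s, ∃ n : ℕ, s < p ^ n := fun p hp s =>
    harch p (by simpa [hlt] using hp) s
  exact le_antisymm (mul_le_mul_comm_of_archimedean harch' a b)
    (mul_le_mul_comm_of_archimedean harch' b a)

end Holder

theorem IsComp.unique {f : I ≃ₜ I} {u v p q x : I} (h : IsComp f u v) (h' : IsComp f p q)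
    (hx : x ∈ Ioo u v) (hx' : x ∈ Ioo p q) : u = p ∧ v = q := by
  constructor
  · rcases lt_trichotomy u p with h1 | h1 | h1
    · exact absurd h'.left (h.moves p ⟨h1, hx'.1.trans hx.2⟩)
    · exact h1
    · exact absurd h.left (h'.moves u ⟨h1, hx.1.trans hx'.2⟩)
  · rcases lt_trichotomy v q with h1 | h1 | h1
    · exact absurd h.right (h'.moves v ⟨hx'.1.trans hx.2, h1⟩)
    · exact h1
    · exact absurd h'.right (h.moves q ⟨hx.1.trans hx'.2, h1⟩)

/-- A homeomorphism preserving `u` and `v` preserves each component which meets `(u, v)`, and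
that component is contained in `(u, v)`. -/
theorem IsComp.subset {f : I ≃ₜ I} {u v p q x : I} (h : IsComp f p q) (hx : x ∈ Ioo p q)
    (hu : f u = u) (hv : f v = v) (hxu : u < x) (hxv : x < v) : u ≤ p ∧ q ≤ v :=
  ⟨le_of_not_gt fun h1 => h.moves u ⟨h1, hxu.trans hx.2⟩ hu,
    le_of_not_gt fun h1 => h.moves v ⟨hx.1.trans hxv, h1⟩ hv⟩

theorem moves_of_displaced {g : I ≃ₜ I} (hg : StrictMono g) {a b : I} (h : g b ≤ a ∨ b ≤ g a)
    {z : I} (hz : z ∈ Ioo a b) : g z ≠ z := by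
  intro e
  rcases h with h | h
  · have := hg hz.2
    rw [e] at this
    exact lt_irrefl _ (this.trans (h.trans_lt hz.1))
  · have := hg hz.1
    rw [e] at this
    exact lt_irrefl _ (this.trans (hz.2.trans_le h))

section Conradian

variable {E : Subgroup (I ≃ₜ I)} {x : I}

theorem Noncrossing.fixes (hE : ∀ g ∈ E, StrictMono g) (hN : Noncrossing E x) {f g : I ≃ₜ I}
    (hf : f ∈ E) (hg : g ∈ E) {u v z : I} (hA : IsComp f u v) (hx : x ∈ Ioo u v)
    (hz : z ∈ Ioo u v) (hgz : g z = z) : g u = u ∧ g v = v :=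
  (hN f hf g hg u v hA hx).resolve_right fun h => moves_of_displaced (hE g hg) h hz hgz

/-- Of two noncrossing elements, not both fixing `x`, one has a component around `x` whose
endpoints are fixed by both. -/
theorem Noncrossing.exists_common (hE : ∀ g ∈ E, StrictMono g) (hN : Noncrossing E x)
    {s t : I ≃ₜ I} (hs : s ∈ E) (ht : t ∈ E) (h : s x ≠ x ∨ t x ≠ x) :
    ∃ c p q, (c = s ∨ c = t) ∧ IsComp c p q ∧ x ∈ Ioo p q ∧ (s p = p ∧ s q = q) ∧
      (t p = p ∧ t q = q) := by
  by_cases hsx : s x = x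
  · obtain ⟨p, q, hA, hx⟩ := exists_isComp (hE t ht) (h.resolve_left (not_not.2 hsx))
    exact ⟨t, p, q, Or.inr rfl, hA, hx, hN.fixes hE ht hs hA hx hx hsx, hA.left, hA.right⟩
  obtain ⟨p, q, hA, hx⟩ := exists_isComp (hE s hs) hsx
  by_cases htx : t x = x
  · exact ⟨s, p, q, Or.inl rfl, hA, hx, ⟨hA.left, hA.right⟩, hN.fixes hE hs ht hA hx hx htx⟩
  obtain ⟨p', q', hA', hx'⟩ := exists_isComp (hE t ht) htx
  rcases hN s hs t ht p q hA hx with h1 | h1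
  · exact ⟨s, p, q, Or.inl rfl, hA, hx, ⟨hA.left, hA.right⟩, h1⟩
  rcases hN t ht s hs p' q' hA' hx' with h2 | h2
  · exact ⟨t, p', q', Or.inr rfl, hA', hx', h2, hA'.left, hA'.right⟩
  exfalso
  -- Each of `s` and `t` now displaces the component of the other. An endpoint of one inside the
  -- other would be fixed and moved, so the left endpoints agree; but then `t` fixes `p` and cannot
  -- displace `(p, q)`.
  have hp : p = p' := by
    rcases lt_trichotomy p p' with h3 | h3 | h3
    · exact absurd hA'.left
        (moves_of_displaced (hE t ht) h1 ⟨h3, hx'.1.trans hx.2⟩)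
    · exact h3
    · exact absurd hA.left
        (moves_of_displaced (hE s hs) h2 ⟨h3, hx.1.trans hx'.2⟩)
  have hlt := hE t ht hx.2
  subst hp
  rcases h1 with h1 | h1
  · have := hE t ht (hx.1.trans hx.2)
    rw [hA'.left] at this
    exact absurd h1 (not_le.2 this)
  · rw [hA'.left] at h1
    exact absurd h1 (not_le.2 (hx.1.trans hx.2))

/-- Take the component `(p, q)` with endpoints fixed by both elements. It is a component of one of
them, whose fixed point in `(u, v)` lies outside `(p, q)`; this forces `p` or `q` to lie strictly
inside `(u, v)`. -/
theorem Noncrossing.exists_fixed_mul (hE : ∀ g ∈ E, StrictMono g) (hN : Noncrossing E x)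
    {s t : I ≃ₜ I} (hs : s ∈ E) (ht : t ∈ E) {u v : I} (hx : x ∈ Ioo u v)
    (hsu : s u = u) (hsv : s v = v) (htu : t u = u) (htv : t v = v)
    (hsz : ∃ z ∈ Ioo u v, s z = z) (htz : ∃ z ∈ Ioo u v, t z = z) :
    ∃ z ∈ Ioo u v, (s * t) z = z := by
  by_cases h : s x = x ∧ t x = x
  · exact ⟨x, hx, by rw [Homeomorph.mul_apply, h.2, h.1]⟩
  obtain ⟨c, p, q, hc, hA, hxA, ⟨hsp, hsq⟩, htp, htq⟩ := hN.exists_common hE hs ht (by tauto)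
  have hcz : c u = u ∧ c v = v ∧ ∃ z ∈ Ioo u v, c z = z := by
    rcases hc with rfl | rfl
    · exact ⟨hsu, hsv, hsz⟩
    · exact ⟨htu, htv, htz⟩
  obtain ⟨hcu, hcv, z, hz, hcz⟩ := hcz
  obtain ⟨hup, hqv⟩ := hA.subset hxA hcu hcv hx.1 hx.2
  rcases le_or_gt z p with h1 | h1
  · exact ⟨p, ⟨hz.1.trans_le h1, hxA.1.trans hx.2⟩, by rw [Homeomorph.mul_apply, htp, hsp]⟩
  · have h2 : q ≤ z := le_of_not_gt fun h2 => hA.moves z ⟨h1, h2⟩ hcz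
    exact ⟨q, ⟨hx.1.trans hxA.2, h2.trans_lt hz.2⟩, by rw [Homeomorph.mul_apply, htq, hsq]⟩

/-- The elements of `E` fixing both `u` and `v`. -/
def fixingPair (E : Subgroup (I ≃ₜ I)) (u v : I) : Subgroup (I ≃ₜ I) where
  carrier := {g | g ∈ E ∧ g u = u ∧ g v = v}
  mul_mem' := by
    rintro a b ⟨ha, ha1, ha2⟩ ⟨hb, hb1, hb2⟩
    exact ⟨mul_mem ha hb, by rw [Homeomorph.mul_apply, hb1, ha1],
      by rw [Homeomorph.mul_apply, hb2, ha2]⟩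
  one_mem' := ⟨one_mem _, rfl, rfl⟩
  inv_mem' := by
    rintro a ⟨ha, ha1, ha2⟩
    exact ⟨inv_mem ha, inv_fixed ha1, inv_fixed ha2⟩

/-- Commutators of noncrossing elements preserving an interval around `x` have fixed points in
that interval. -/
theorem Noncrossing.exists_fixed_commutator (hE : ∀ g ∈ E, StrictMono g) (hN : Noncrossing E x)
    {a b : I ≃ₜ I} (ha : a ∈ E) (hb : b ∈ E) {u v : I} (hx : x ∈ Ioo u v)
    (hau : a u = u ∧ a v = v) (hbu : b u = u ∧ b v = v) :
    ∃ z ∈ Ioo u v, ⁅a, b⁆ z = z := by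
  let Λ := fixingPair E u v
  have hΛm : ∀ s : Λ, StrictMono (s : I ≃ₜ I) := fun s => hE _ s.2.1
  have hΛmem : ∀ s : Λ, ∀ z ∈ Ioo u v, (s : I ≃ₜ I) z ∈ Ioo u v := fun s z hz =>
    ⟨by simpa [s.2.2.1] using hΛm s hz.1, by simpa [s.2.2.2] using hΛm s hz.2⟩
  -- An element outside `N` moves all points of `(u, v)` in one direction, so `Λ ⧸ N` is bi-ordered.
  -- It is Archimedean because the iterates of a positive element push `x` towards `v`. Hölder's
  -- theorem makes it abelian, so commutators lie in `N`.
  let N : Subgroup Λ :=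
    { carrier := {s | ∃ z ∈ Ioo u v, (s : I ≃ₜ I) z = z}
      mul_mem' := fun {s t} hs ht => hN.exists_fixed_mul hE s.2.1 t.2.1 hx s.2.2.1 s.2.2.2
        t.2.2.1 t.2.2.2 hs ht
      one_mem' := ⟨x, hx, rfl⟩
      inv_mem' := fun {s} ⟨z, hz, e⟩ => ⟨z, hz, inv_fixed e⟩ }
  have hNmem : ∀ s : Λ, s ∈ N ↔ ∃ z ∈ Ioo u v, (s : I ≃ₜ I) z = z := fun s => Iff.rfl
  have : N.Normal := ⟨fun s ⟨z, hz, e⟩ t => ⟨(t : I ≃ₜ I) z, hΛmem t z hz, by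
    simp only [Subgroup.coe_mul, Subgroup.coe_inv, Homeomorph.mul_apply, inv_apply_apply, e]⟩⟩
  let P : Set Λ := {s | ∀ z ∈ Ioo u v, z < (s : I ≃ₜ I) z}
  have hPN : ∀ s ∈ P, s ∉ N := fun s hs ⟨z, hz, e⟩ => (hs z hz).ne' e
  have htri : ∀ s : Λ, s ∈ N ∨ s ∈ P ∨ s⁻¹ ∈ P := by
    intro s
    by_cases h : s ∈ N
    · exact Or.inl h
    rcases lt_or_gt_of_no_fixed (s : I ≃ₜ I) (u := u) (v := v)
      (fun z hz e => h ⟨z, hz, e⟩) with h1 | h1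
    · right; right
      intro z hz
      rw [← (hΛm s).lt_iff_lt, Subgroup.coe_inv, apply_inv_apply]
      exact h1 z hz
    · exact Or.inr (Or.inl h1)
  have hcomm := mul_comm_of_archimedean_cone ((QuotientGroup.mk (s := N)) '' P)
    (by
      rintro _ ⟨s, hs, rfl⟩ _ ⟨t, ht, rfl⟩
      exact ⟨s * t, fun z hz => (ht z hz).trans (hs _ (hΛmem t z hz)), rfl⟩)
    (by
      rintro _ ⟨s, hs, rfl⟩ t
      obtain ⟨t, rfl⟩ := QuotientGroup.mk_surjective t
      refine ⟨t * s * t⁻¹, fun z hz => ?_, rfl⟩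
      have := hΛm t (hs _ (hΛmem t⁻¹ z hz))
      rw [Subgroup.coe_inv, apply_inv_apply] at this
      exact this)
    (by
      intro s
      obtain ⟨s, rfl⟩ := QuotientGroup.mk_surjective s
      rcases htri s with h | h | h
      · exact Or.inl ((QuotientGroup.eq_one_iff s).2 h)
      · exact Or.inr (Or.inl ⟨s, h, rfl⟩)
      · exact Or.inr (Or.inr ⟨s⁻¹, h, rfl⟩))
    (by
      rintro ⟨s, hs, e⟩
      exact hPN s hs ((QuotientGroup.eq_one_iff s).1 e))
    (by
      rintro _ ⟨p, hp, rfl⟩ s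
      obtain ⟨s, rfl⟩ := QuotientGroup.mk_surjective s
      have hcomp : IsComp (p : I ≃ₜ I) u v := ⟨p.2.2.1, p.2.2.2, fun z hz => (hp z hz).ne'⟩
      obtain ⟨n, hn⟩ := ((hcomp.tendsto_pow_right (hΛm p) hp hx).eventually
        (lt_mem_nhds (hΛmem s x hx).2)).exists
      have h1 : x < ((s⁻¹ * p ^ n : Λ) : I ≃ₜ I) x := by
        rw [← (hΛm s).lt_iff_lt]
        simpa [Homeomorph.mul_apply] using hn
      rcases htri (s⁻¹ * p ^ n) with h | h | h
      -- Here `s` and `p ^ n` agree in the quotient, so one more factor `p` gives a positive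
      -- difference.
      · refine ⟨n + 1, p, hp, ?_⟩
        have h2 : (QuotientGroup.mk (s⁻¹ * p ^ n) : Λ ⧸ N) = 1 := (QuotientGroup.eq_one_iff _).2 h
        rw [QuotientGroup.mk_mul, QuotientGroup.mk_inv, QuotientGroup.mk_pow] at h2
        rw [pow_succ, ← mul_assoc, h2, one_mul]
      · exact ⟨n, _, h, rfl⟩
      · exfalso
        have h2 := h x hx
        rw [← (hΛm (s⁻¹ * p ^ n)).lt_iff_lt, Subgroup.coe_inv, apply_inv_apply] at h2
        exact lt_asymm h1 h2)
    (QuotientGroup.mk (⟨a, ha, hau⟩ : Λ)) (QuotientGroup.mk (⟨b, hb, hbu⟩ : Λ))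
  rw [← commutatorElement_eq_one_iff_mul_comm] at hcomm
  have hmem : (⁅(⟨a, ha, hau⟩ : Λ), (⟨b, hb, hbu⟩ : Λ)⁆ : Λ) ∈ N := by
    rw [← QuotientGroup.eq_one_iff]
    exact hcomm
  exact hmem

/-- Nontrivial elements of the commutator subgroup are dominated around `x`. -/
theorem Noncrossing.exists_displacing (hE : ∀ g ∈ E, StrictMono g) (hN : Noncrossing E x)
    {f : I ≃ₜ I} (hf : f ∈ ⁅E, E⁆) {p q : I} (hA : IsComp f p q)
    (hx : x ∈ Ioo p q) : ∃ c ∈ E, ∃ u v, IsComp c u v ∧ u ≤ p ∧ q ≤ v ∧ (c q ≤ p ∨ q ≤ c p) := by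
  -- Membership in `S` says that the element fixes `x` or is smaller than some `c ∈ E` around `x`.
  -- Closure under products takes the larger of two dominating components; commutators of `E` belong
  -- to `S` by `exists_fixed_commutator`.
  let S : Subgroup (I ≃ₜ I) :=
    { carrier := {f | f ∈ E ∧ (f x = x ∨ ∃ c ∈ E, ∃ u v, IsComp c u v ∧ x ∈ Ioo u v ∧ f u = u ∧
        f v = v ∧ ∃ z ∈ Ioo u v, f z = z)}
      mul_mem' := by
        rintro s t ⟨hs, hs'⟩ ⟨ht, ht'⟩
        refine ⟨mul_mem hs ht, ?_⟩
        have key : ∀ c ∈ E, ∀ u v, IsComp c u v → x ∈ Ioo u v → (∃ z ∈ Ioo u v, s z = z) →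
            (∃ z ∈ Ioo u v, t z = z) → ∃ c ∈ E, ∃ u v, IsComp c u v ∧ x ∈ Ioo u v ∧
              (s * t) u = u ∧ (s * t) v = v ∧ ∃ z ∈ Ioo u v, (s * t) z = z := by
          rintro c hc u v hcA hcx ⟨z, hz, hsz⟩ ⟨z', hz', htz⟩
          obtain ⟨hsu, hsv⟩ := hN.fixes hE hc hs hcA hcx hz hsz
          obtain ⟨htu, htv⟩ := hN.fixes hE hc ht hcA hcx hz' htz
          exact ⟨c, hc, u, v, hcA, hcx, by rw [Homeomorph.mul_apply, htu, hsu],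
            by rw [Homeomorph.mul_apply, htv, hsv],
            hN.exists_fixed_mul hE hs ht hcx hsu hsv htu htv ⟨z, hz, hsz⟩ ⟨z', hz', htz⟩⟩
        rcases hs' with hsx | ⟨c, hc, u, v, hcA, hcx, -, -, z, hz, hsz⟩
        · rcases ht' with htx | ⟨c', hc', u', v', hcA', hcx', -, -, z', hz', htz⟩
          · exact Or.inl (by rw [Homeomorph.mul_apply, htx, hsx])
          · exact Or.inr (key c' hc' u' v' hcA' hcx' ⟨x, hcx', hsx⟩ ⟨z', hz', htz⟩)
        · rcases ht' with htx | ⟨c', hc', u', v', hcA', hcx', -, -, z', hz', htz⟩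
          · exact Or.inr (key c hc u v hcA hcx ⟨z, hz, hsz⟩ ⟨x, hcx, htx⟩)
          · obtain ⟨d, p, q, hd, hdA, hdx, ⟨h1, h2⟩, h3, h4⟩ :=
              hN.exists_common hE hc hc' (Or.inl (hcA.moves x hcx))
            have hdE : d ∈ E := by rcases hd with rfl | rfl <;> assumption
            obtain ⟨h5, h6⟩ := hcA.subset (u := p) (v := q) hcx h1 h2 hdx.1 hdx.2
            obtain ⟨h7, h8⟩ := hcA'.subset (u := p) (v := q) hcx' h3 h4 hdx.1 hdx.2
            exact Or.inr (key d hdE p q hdA hdx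
              ⟨z, ⟨h5.trans_lt hz.1, hz.2.trans_le h6⟩, hsz⟩
              ⟨z', ⟨h7.trans_lt hz'.1, hz'.2.trans_le h8⟩, htz⟩)
      one_mem' := ⟨one_mem _, Or.inl rfl⟩
      inv_mem' := by
        rintro s ⟨hs, hs'⟩
        refine ⟨inv_mem hs, ?_⟩
        rcases hs' with h | ⟨c, hc, u, v, hcA, hcx, hu, hv, z, hz, hsz⟩
        · exact Or.inl (inv_fixed h)
        · exact Or.inr ⟨c, hc, u, v, hcA, hcx, inv_fixed hu, inv_fixed hv, z, hz, inv_fixed hsz⟩ }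
  have hle : ⁅E, E⁆ ≤ S := by
    rw [Subgroup.commutator_le]
    intro a ha b hb
    have hab : ⁅a, b⁆ ∈ E := by
      rw [commutatorElement_def]
      exact mul_mem (mul_mem (mul_mem ha hb) (inv_mem ha)) (inv_mem hb)
    refine ⟨hab, ?_⟩
    by_cases h : a x = x ∧ b x = x
    · left
      simp only [commutatorElement_def, Homeomorph.mul_apply, inv_fixed h.1, inv_fixed h.2, h.1,
        h.2]
    · right
      obtain ⟨c, p, q, hc, hcA, hcx, h1, h2⟩ := hN.exists_common hE ha hb (by tauto)
      have hcE : c ∈ E := by rcases hc with rfl | rfl <;> assumption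
      obtain ⟨z, hz, e⟩ := hN.exists_fixed_commutator hE ha hb hcx h1 h2
      obtain ⟨h3, h4⟩ := hN.fixes hE hcE hab hcA hcx hz e
      exact ⟨c, hcE, p, q, hcA, hcx, h3, h4, z, hz, e⟩
  obtain ⟨hfE, hfS⟩ := hle hf
  obtain ⟨c, hc, u, v, hcA, hcx, hu, hv, z, hz, hfz⟩ := hfS.resolve_left (hA.moves x hx)
  obtain ⟨h1, h2⟩ := hA.subset hx hu hv hcx.1 hcx.2
  -- The fixed point `z` of `f` lies in `(u, v)` but not in `(p, q)`, so `p` or `q` is interior to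
  -- `(u, v)` and is moved by `c`.
  refine ⟨c, hc, u, v, hcA, h1, h2, (hN f hfE c hc p q hA hx).resolve_left fun h => ?_⟩
  rcases le_or_gt z p with h3 | h3
  · exact hcA.moves p ⟨hz.1.trans_le h3, hx.1.trans hcx.2⟩ h.1
  · have h4 : q ≤ z := le_of_not_gt fun h4 => hA.moves z ⟨h3, h4⟩ hfz
    exact hcA.moves q ⟨hcx.1.trans hx.2, h4.trans_lt hz.2⟩ h.2

end Conradian
end IntervalDiff

/-! ### Displacement estimates and elements with disjoint supports -/

namespace IntervalDiff

open Set Filter Topology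
open scoped commutatorElement

theorem IsComp.eq_or_disjoint {f : I ≃ₜ I} {u v p q : I} (h : IsComp f u v) (h' : IsComp f p q)
    (huv : u < v) (hpq : p < q) : (u = p ∧ v = q) ∨ q ≤ u ∨ v ≤ p := by
  by_contra! hcon
  obtain ⟨h1, h2, h3⟩ := hcon
  obtain ⟨x, hx1, hx2⟩ := exists_between (max_lt (lt_min huv h2) (lt_min h3 hpq))
  rw [max_lt_iff] at hx1
  rw [lt_min_iff] at hx2
  obtain ⟨e1, e2⟩ := h.unique h' ⟨hx1.1, hx2.1⟩ ⟨hx1.2, hx2.2⟩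
  exact h1 e1 e2

/-- Iterated displacement estimates along a chain of components given by iterated commutator
subgroups. -/
theorem exists_dominating {τ : ℝ≥0} {E : ℕ → Subgroup (I ≃ₜ I)}
    (hE : ∀ n, E (n + 1) = ⁅E n, E n⁆) (hC : ∀ n, E n ≤ Diff τ) {x : I}
    (hN : ∀ n, Noncrossing (E n) x) (n : ℕ) {f : I ≃ₜ I} (hf : f ∈ E n) {p q : I}
    (hA : IsComp f p q) (hx : x ∈ Ioo p q) :
    ∃ c ∈ E 0, ∃ u v, IsComp c u v ∧ u ≤ p ∧ q ≤ v ∧ ∃ C : ℝ, 0 ≤ C ∧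
      ∀ w : I ≃ₜ I, StrictMono w → (∀ m, ∀ g ∈ E m, Commute w g) →
        (w q : ℝ) - w p ≤ C * ((w v : ℝ) - w u) ^ ((1 + (τ : ℝ)) ^ n) := by
  induction n generalizing f p q with
  | zero => exact ⟨f, hf, p, q, hA, le_rfl, le_rfl, 1, zero_le_one, fun w _ _ => by simp⟩
  | succ n ih =>
    rw [hE] at hf
    obtain ⟨c, hc, u, v, hcA, hup, hqv, hdis⟩ := (hN n).exists_displacing
      (fun g hg => (hC n hg : IsC1Holder τ g).strictMono) hf hA hx
    obtain ⟨c', hc', u', v', hcA', hu, hv, C, hC0, hbound⟩ := ih hc hcA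
      ⟨hup.trans_lt hx.1, hx.2.trans_le hqv⟩
    have hcC : IsC1Holder τ c := hC n hc
    obtain ⟨A, hA0, hdisp⟩ := hcC.exists_displacement_le
    refine ⟨c', hc', u', v', hcA', hu.trans hup, hqv.trans hv, A * C ^ (1 + (τ : ℝ)),
      by positivity, fun w hw hcomm => ?_⟩
    have hwc := hcomm n c hc
    have hpq := hx.1.trans hx.2
    have hw1 : w u ≤ w p := hw.monotone hup
    have hw2 : w q ≤ w v := hw.monotone hqv
    have hw3 : w p ≤ w q := hw.monotone hpq.le
    have hcu : c (w u) = w u := by rw [← Commute.homeo_apply hwc, hcA.left]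
    have hcv : c (w v) = w v := by rw [← Commute.homeo_apply hwc, hcA.right]
    -- Since `w` commutes with `c`, the image of `(p, q)` is displaced by `c` within the image of
    -- `(u, v)`, whose endpoints `c` fixes. The constant `A` depends on `c` only, whence the
    -- uniformity in `w`.
    have h1 : (w q : ℝ) - w p ≤ A * ((w v : ℝ) - w u) ^ (1 + (τ : ℝ)) := by
      rcases hdis with h | h
      · have h2 := hw.monotone h
        rw [Commute.homeo_apply hwc] at h2
        have h3 := hdisp (w u) (w v) (w q) (hw1.trans hw3) hw2 hcu hcv
        rw [← Subtype.coe_le_coe] at h2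
        rw [abs_le] at h3
        linarith [h3.1]
      · have h2 := hw.monotone h
        rw [Commute.homeo_apply hwc] at h2
        have h3 := hdisp (w u) (w v) (w p) hw1 (hw3.trans hw2) hcu hcv
        rw [← Subtype.coe_le_coe] at h2
        rw [abs_le] at h3
        linarith [h3.2]
    have h2 := hbound w hw hcomm
    have h3 : 0 ≤ (w v : ℝ) - w u := sub_nonneg.2 ((hw1.trans hw3).trans hw2)
    have h4 : 0 ≤ (w v' : ℝ) - w u' := by
      have e1 : w u' ≤ w u := hw.monotone hu
      have e2 : w v ≤ w v' := hw.monotone hv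
      rw [← Subtype.coe_le_coe] at e1 e2
      linarith
    calc _ ≤ _ := h1
      _ ≤ A * (C * ((w v' : ℝ) - w u') ^ ((1 + (τ : ℝ)) ^ n)) ^ (1 + (τ : ℝ)) := by gcongr
      _ = _ := by
        rw [Real.mul_rpow hC0 (by positivity), ← Real.rpow_mul h4, ← pow_succ, mul_assoc]

/-- The intervals `h ^ n [u, v]` do not overlap, so their lengths sum to at most one. With `τ * e ≥
1` this bounds the sum of the `τ`-th powers of the lengths of `h ^ n [p, q]`, hence the distortion
of `h ^ n` there, and Kopell's argument makes `f` trivial on its own component. -/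
theorem false_of_displaced_aux {τ : ℝ≥0} {f h : I ≃ₜ I} (hf : IsC1Holder τ f)
    (hh : IsC1Holder τ h) (hc : Commute f h) {p q u v : I} (hA : IsComp f p q) (hpq : p < q)
    (hup : u ≤ p) (hqv : q ≤ v) (hdis : h v ≤ u) {C e : ℝ} (hC : 0 ≤ C) (he : 1 ≤ τ * e)
    (hbound : ∀ n : ℕ, ((h ^ n) q : ℝ) - (h ^ n) p ≤ C * (((h ^ n) v : ℝ) - (h ^ n) u) ^ e) :
    False := by
  obtain ⟨A, hA0, hlog⟩ := hh.exists_log_holder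
  have hm : ∀ n : ℕ, StrictMono (h ^ n) := strictMono_pow hh.strictMono
  obtain ⟨y, -, hy⟩ := exists_tendsto_pow hh.strictMono q
  have hyp : Tendsto (fun n : ℕ => (h ^ n) p) atTop (𝓝 y) := by
    refine tendsto_of_tendsto_of_tendsto_of_le_of_le ((tendsto_add_atTop_iff_nat 1).2 hy) hy
      (fun n => ?_) fun n => (hm n).monotone hpq.le
    simp only [pow_succ, Homeomorph.mul_apply]
    exact (hm n).monotone (((hh.strictMono.monotone hqv).trans hdis).trans hup)
  have hfix : f y = y ∧ D f y = 1 := by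
    refine hf.D_eq_one_of_tendsto (fun n => hm n hpq) (fun n => ?_) (fun n => ?_) hyp hy
    · rw [Commute.homeo_apply (hc.pow_right n), hA.left]
    · rw [Commute.homeo_apply (hc.pow_right n), hA.right]
  have hlen0 : ∀ n : ℕ, 0 ≤ ((h ^ n) v : ℝ) - (h ^ n) u := fun n =>
    sub_nonneg.2 ((hm n).monotone ((hup.trans hpq.le).trans hqv))
  have hlen1 : ∀ n : ℕ, ((h ^ n) v : ℝ) - (h ^ n) u ≤ 1 := fun n => by
    linarith [((h ^ n) v).2.2, ((h ^ n) u).2.1]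
  have hsum : ∀ n : ℕ, ∑ i ∈ Finset.range n, (((h ^ i) v : ℝ) - (h ^ i) u) ≤
      (v : ℝ) - (h ^ n) v := by
    intro n
    induction n with
    | zero => simp
    | succ n ih =>
      rw [Finset.sum_range_succ]
      have : ((h ^ (n + 1)) v : ℝ) ≤ (h ^ n) u := by
        rw [pow_succ, Homeomorph.mul_apply]
        exact (hm n).monotone hdis
      linarith
  obtain ⟨x, hx1, hx2⟩ := exists_between hpq
  refine hA.moves x ⟨hx1, hx2⟩ (eq_of_bounded_distortion hf (w := fun n => h ^ n)
    (fun n => hh.pow n) (fun n => hc.pow_right n) hA.left hA.right (C := A * C ^ (τ : ℝ))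
    (q := y) ?_ ?_ hfix.1 hfix.2 x ⟨hx1.le, hx2.le⟩)
  · intro n a ha b hb
    refine (log_D_pow_sub_le hh hlog n a b).trans (mul_le_mul_of_nonneg_left ?_ hA0)
    calc _ ≤ ∑ i ∈ Finset.range n, C ^ (τ : ℝ) * (((h ^ i) v : ℝ) - (h ^ i) u) := by
          refine Finset.sum_le_sum fun i _ => ?_
          have h1 : |((h ^ i) a : ℝ) - (h ^ i) b| ≤
              C * (((h ^ i) v : ℝ) - (h ^ i) u) ^ e := by
            refine le_trans ?_ (hbound i)
            have e1 := (hm i).monotone ha.1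
            have e2 := (hm i).monotone ha.2
            have e3 := (hm i).monotone hb.1
            have e4 := (hm i).monotone hb.2
            rw [← Subtype.coe_le_coe] at e1 e2 e3 e4
            rw [abs_le]; constructor <;> linarith
          calc _ ≤ (C * (((h ^ i) v : ℝ) - (h ^ i) u) ^ e) ^ (τ : ℝ) :=
                Real.rpow_le_rpow (abs_nonneg _) h1 τ.2
            _ = C ^ (τ : ℝ) * (((h ^ i) v : ℝ) - (h ^ i) u) ^ ((τ : ℝ) * e) := by
                rw [Real.mul_rpow hC (Real.rpow_nonneg (hlen0 i) _), ← Real.rpow_mul (hlen0 i),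
                  mul_comm e]
            _ ≤ _ := by
                gcongr
                calc _ ≤ (((h ^ i) v : ℝ) - (h ^ i) u) ^ (1 : ℝ) :=
                      Real.rpow_le_rpow_of_exponent_ge_of_imp (hlen0 i) (hlen1 i) he
                        (fun _ h0 => absurd he (by rw [h0]; norm_num))
                  _ = _ := Real.rpow_one _
      _ = C ^ (τ : ℝ) * ∑ i ∈ Finset.range n, (((h ^ i) v : ℝ) - (h ^ i) u) := by
          rw [Finset.mul_sum]
      _ ≤ C ^ (τ : ℝ) * 1 := by
          gcongr
          refine (hsum n).trans ?_
          linarith [v.2.2, ((h ^ n) v).2.1]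
      _ = _ := mul_one _
  · intro a ha
    exact tendsto_of_tendsto_of_tendsto_of_le_of_le hyp hy (fun n => (hm n).monotone ha.1)
      fun n => (hm n).monotone ha.2

theorem false_of_displaced {τ : ℝ≥0} {f h : I ≃ₜ I} (hf : IsC1Holder τ f)
    (hh : IsC1Holder τ h) (hc : Commute f h) {p q u v : I} (hA : IsComp f p q) (hpq : p < q)
    (hup : u ≤ p) (hqv : q ≤ v) (hdis : h v ≤ u ∨ v ≤ h u) {C e : ℝ} (hC : 0 ≤ C)
    (he : 1 ≤ τ * e)
    (hbound : ∀ w ∈ Subgroup.zpowers h, (w q : ℝ) - w p ≤ C * ((w v : ℝ) - w u) ^ e) :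
    False := by
  rcases hdis with h1 | h1
  · exact false_of_displaced_aux hf hh hc hA hpq hup hqv h1 hC he
      fun n => hbound _ (Subgroup.npow_mem_zpowers h n)
  · refine false_of_displaced_aux hf hh.inv hc.inv_right hA hpq hup hqv ?_ hC he
      fun n => hbound _ ?_
    · rw [← hh.strictMono.le_iff_le, apply_inv_apply]; exact h1
    · exact pow_mem (inv_mem (Subgroup.mem_zpowers h)) n

/-- Commuting faithful actions of two groups with long derived series, by diffeomorphisms of
sufficient regularity, contain nontrivial elements with disjoint supports. -/
theorem exists_disjoint_support {G H : Type*} [Group G] [Group H] {τ : ℝ≥0} (hτ : 0 < τ)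
    (hτ1 : τ ≤ 1) (Φ : G →* (I ≃ₜ I)) (Ψ : H →* (I ≃ₜ I)) (hcomm : ∀ g h, Commute (Φ g) (Ψ h))
    (hΦC : ∀ g, IsC1Holder τ (Φ g)) (hΨC : ∀ h, IsC1Holder τ (Ψ h)) {k : ℕ}
    (hk : 1 ≤ (τ : ℝ) * (1 + (τ : ℝ)) ^ k) (hG : derivedSeries G (k + 1) ≠ ⊥)
    (hH : derivedSeries H (k + 1) ≠ ⊥) :
    ∃ g : G, ∃ h : H, g ≠ 1 ∧ h ≠ 1 ∧ ∀ x : I, Φ g x = x ∨ Ψ h x = x := by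
  by_contra! hcon
  obtain ⟨⟨g, hg⟩, hg'⟩ := Subgroup.ne_bot_iff_exists_ne_one.1 hG
  obtain ⟨⟨h, hh⟩, hh'⟩ := Subgroup.ne_bot_iff_exists_ne_one.1 hH
  have hg1 : g ≠ 1 := fun e => hg' (Subtype.ext e)
  have hh1 : h ≠ 1 := fun e => hh' (Subtype.ext e)
  obtain ⟨x, hgx, hhx⟩ := hcon g h hg1 hh1
  let E : ℕ → Subgroup (I ≃ₜ I) := fun n => (derivedSeries G n).map Φ
  let F : ℕ → Subgroup (I ≃ₜ I) := fun n => (derivedSeries H n).map Ψ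
  have hE : ∀ n, E (n + 1) = ⁅E n, E n⁆ := fun n => by
    simp only [E, derivedSeries_succ, Subgroup.map_commutator]
  have hF : ∀ n, F (n + 1) = ⁅F n, F n⁆ := fun n => by
    simp only [F, derivedSeries_succ, Subgroup.map_commutator]
  have hEC : ∀ n, E n ≤ Diff τ := by
    rintro n _ ⟨a, -, rfl⟩
    exact hΦC a
  have hFC : ∀ n, F n ≤ Diff τ := by
    rintro n _ ⟨a, -, rfl⟩
    exact hΨC a
  have hEF : ∀ m n, ∀ a ∈ E m, ∀ b ∈ F n, Commute a b := by
    rintro m n _ ⟨a, -, rfl⟩ _ ⟨b, -, rfl⟩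
    exact hcomm a b
  have hEm : ∀ n, ∀ a ∈ E n, StrictMono a := fun n a ha => (hEC n ha : IsC1Holder τ a).strictMono
  have hFm : ∀ n, ∀ a ∈ F n, StrictMono a := fun n a ha => (hFC n ha : IsC1Holder τ a).strictMono
  have hgE : Φ g ∈ E (k + 1) := ⟨g, hg, rfl⟩
  have hhF : Ψ h ∈ F (k + 1) := ⟨h, hh, rfl⟩
  have hgE1 : Φ g ∈ ⁅E 0, E 0⁆ := by
    rw [← hE]; exact ⟨g, derivedSeries_antitone G (by omega) hg, rfl⟩
  have hhF1 : Ψ h ∈ ⁅F 0, F 0⁆ := by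
    rw [← hF]; exact ⟨h, derivedSeries_antitone H (by omega) hh, rfl⟩
  -- Each group is noncrossing around `x` because a product of commutators of the other one moves
  -- `x`.
  have hNE : ∀ n, Noncrossing (E n) x := fun n =>
    noncrossing_of_commutator_moves hτ hτ1 (hEC n) (hFC 0)
      (fun a ha => Subgroup.mem_centralizer_iff.2 fun b hb => (hEF n 0 a ha b hb).eq.symm) hhF1 hhx
  have hNF : ∀ n, Noncrossing (F n) x := fun n =>
    noncrossing_of_commutator_moves hτ hτ1 (hFC n) (hEC 0)
      (fun a ha => Subgroup.mem_centralizer_iff.2 fun b hb => (hEF 0 n b hb a ha).eq) hgE1 hgx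
  obtain ⟨p, q, hA, hxA⟩ := exists_isComp (hEm _ _ hgE) hgx
  obtain ⟨r, s, hB, hxB⟩ := exists_isComp (hFm _ _ hhF) hhx
  -- The chains stop at level one, after `k` steps, so that `c1` and `d1` still lie in commutator
  -- subgroups and their components are displaced by elements `c0`, `d0` of level zero.
  obtain ⟨c1, hc1, u1, v1, hcA1, hu1, hv1, C, hC0, hCb⟩ := exists_dominating
    (E := fun n => E (n + 1)) (fun n => hE _) (fun n => hEC _) (fun n => hNE _) k hgE hA hxA
  obtain ⟨d1, hd1, m1, n1, hdA1, hm1, hn1, C', hC0', hCb'⟩ := exists_dominating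
    (E := fun n => F (n + 1)) (fun n => hF _) (fun n => hFC _) (fun n => hNF _) k hhF hB hxB
  have hx1 : x ∈ Ioo u1 v1 := ⟨hu1.trans_lt hxA.1, hxA.2.trans_le hv1⟩
  have hy1 : x ∈ Ioo m1 n1 := ⟨hm1.trans_lt hxB.1, hxB.2.trans_le hn1⟩
  obtain ⟨c0, hc0, u0, v0, hcA0, hu0, hv0, hcd⟩ := (hNE 0).exists_displacing (hEm 0)
    (hE 0 ▸ hc1) hcA1 hx1
  obtain ⟨d0, hd0, m0, n0, hdA0, hm0, hn0, hdd⟩ := (hNF 0).exists_displacing (hFm 0)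
    (hF 0 ▸ hd1) hdA1 hy1
  have hx0 : x ∈ Ioo u0 v0 := ⟨hu0.trans_lt hx1.1, hx1.2.trans_le hv0⟩
  have hy0 : x ∈ Ioo m0 n0 := ⟨hm0.trans_lt hy1.1, hy1.2.trans_le hn0⟩
  have hd0m := hFm 0 d0 hd0
  have hc0m := hEm 0 c0 hc0
  -- Either `d0` throws the component of `c0` off itself, and with it that of `c1`, or it preserves
  -- it. In the latter case the component of `d0` lies inside that of `c0`, and `c0` must displace
  -- the component of `d1`: otherwise these components would coincide, while `d0` preserves one and
  -- displaces the other.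
  rcases hcA0.eq_or_disjoint (hcA0.map_commute hd0m (hEF 0 0 c0 hc0 d0 hd0).symm)
    (hx0.1.trans hx0.2) (hd0m (hx0.1.trans hx0.2)) with h1 | h1
  · -- `d0` preserves the component of `c0`, which displaces the component of `d1`
    obtain ⟨h2, h3⟩ := hdA0.subset hy0 h1.1.symm h1.2.symm hx0.1 hx0.2
    have h4 : c0 n1 ≤ m1 ∨ n1 ≤ c0 m1 := by
      rcases hdA1.eq_or_disjoint (hdA1.map_commute hc0m (hEF 0 1 c0 hc0 d1 hd1))
        (hy1.1.trans hy1.2) (hc0m (hy1.1.trans hy1.2)) with h5 | h5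
      · exfalso
        have e1 : m1 = u0 := by
          by_contra hne
          exact hcA0.moves m1 ⟨lt_of_le_of_ne (h2.trans hm0) (Ne.symm hne), hy1.1.trans hx0.2⟩
            h5.1.symm
        have e2 : n1 = v0 := by
          by_contra hne
          exact hcA0.moves n1 ⟨hx0.1.trans hy1.2, lt_of_le_of_ne (hn0.trans h3) hne⟩ h5.2.symm
        rw [e1, e2, ← h1.1, ← h1.2] at hdd
        have := hx0.1.trans hx0.2
        rcases hdd with h6 | h6 <;> exact absurd this (not_lt.2 h6)
      · exact h5
    refine false_of_displaced (hΨC h) (hEC 0 hc0) (hEF 0 (k + 1) c0 hc0 _ hhF).symm hB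
      (hxB.1.trans hxB.2) hm1 hn1 h4 hC0' hk fun w hw => ?_
    have hwE : w ∈ E 0 := (Subgroup.zpowers_le.2 hc0) hw
    exact hCb' w (hEm 0 w hwE) fun m b hb => hEF 0 (m + 1) w hwE b hb
  · refine false_of_displaced (hΦC g) (hFC 0 hd0) (hEF (k + 1) 0 _ hgE d0 hd0) hA
      (hxA.1.trans hxA.2) hu1 hv1 ?_ hC0 hk fun w hw => ?_
    · rcases h1 with h1 | h1
      · exact Or.inl (((hd0m.monotone hv0).trans h1).trans hu0)
      · exact Or.inr ((hv0.trans h1).trans (hd0m.monotone hu0))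
    · have hwF : w ∈ F 0 := (Subgroup.zpowers_le.2 hd0) hw
      exact hCb w (hFm 0 w hwF) fun m b hb => (hEF (m + 1) 0 b hb w hwF).symm

end IntervalDiff

/-! ### Commutation in `ℤ² ∗ ℤ²` through matrices over `ℝ[X]` -/

namespace IntervalDiff

open scoped Polynomial Matrix commutatorElement

section TwoByTwo

variable {R : Type*} [CommRing R]

theorem commute_fin_two_iff {A B : Matrix (Fin 2) (Fin 2) R} :
    Commute A B ↔ A 0 1 * B 1 0 = B 0 1 * A 1 0 ∧
      (A 0 0 - A 1 1) * B 0 1 = (B 0 0 - B 1 1) * A 0 1 ∧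
      (A 0 0 - A 1 1) * B 1 0 = (B 0 0 - B 1 1) * A 1 0 := by
  unfold Commute SemiconjBy
  rw [← Matrix.ext_iff]
  simp only [Fin.forall_fin_two, Matrix.mul_apply, Fin.sum_univ_two]
  constructor
  · rintro ⟨⟨h1, h2⟩, h3, h4⟩
    refine ⟨?_, ?_, ?_⟩
    · linear_combination h1
    · linear_combination h2
    · linear_combination -h3
  · rintro ⟨h1, h2, h3⟩
    refine ⟨⟨?_, ?_⟩, ?_, ?_⟩
    · linear_combination h1
    · linear_combination h2
    · linear_combination -h3
    · linear_combination -h1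

/-- Commutation is transitive on nonscalar two by two matrices. -/
theorem commute_trans_fin_two [IsDomain R] {A B C : Matrix (Fin 2) (Fin 2) R}
    (hA : A 0 1 ≠ 0 ∨ A 1 0 ≠ 0) (hB : Commute A B) (hC : Commute A C) : Commute B C := by
  rw [commute_fin_two_iff] at *
  obtain ⟨b1, b2, b3⟩ := hB
  obtain ⟨c1, c2, c3⟩ := hC
  rcases hA with h | h
  · have h2 : (B 0 0 - B 1 1) * C 0 1 = (C 0 0 - C 1 1) * B 0 1 := by
      refine mul_left_cancel₀ h ?_
      linear_combination C 0 1 * (-b2) + B 0 1 * c2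
    refine ⟨mul_left_cancel₀ h ?_, h2, mul_left_cancel₀ h ?_⟩
    · linear_combination B 0 1 * c1 - C 0 1 * b1
    · linear_combination (B 0 0 - B 1 1) * c1 - (C 0 0 - C 1 1) * b1 + A 1 0 * h2
  · have h3 : (B 0 0 - B 1 1) * C 1 0 = (C 0 0 - C 1 1) * B 1 0 := by
      refine mul_left_cancel₀ h ?_
      linear_combination C 1 0 * (-b3) + B 1 0 * c3
    refine ⟨mul_left_cancel₀ h ?_, mul_left_cancel₀ h ?_, h3⟩
    · linear_combination B 1 0 * c1 - C 1 0 * b1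
    · linear_combination -(B 0 0 - B 1 1) * c1 + (C 0 0 - C 1 1) * b1 + A 0 1 * h3

end TwoByTwo

/-- The free product of two free abelian groups of rank two. -/
abbrev FreeProd : Type := Monoid.CoprodI (fun _ : Bool => Multiplicative (ℤ × ℤ))

/-- An injective additive homomorphism from `ℤ²` to the reals. -/
noncomputable def latticeVal (m : Multiplicative (ℤ × ℤ)) : ℝ :=
  (m.toAdd.1 : ℝ) + m.toAdd.2 * √2

theorem latticeVal_one : latticeVal 1 = 0 := by simp [latticeVal]

theorem latticeVal_mul (m n : Multiplicative (ℤ × ℤ)) :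
    latticeVal (m * n) = latticeVal m + latticeVal n := by
  simp only [latticeVal, toAdd_mul, Prod.fst_add, Prod.snd_add, Int.cast_add]
  ring

theorem latticeVal_ne_zero {m : Multiplicative (ℤ × ℤ)} (hm : m ≠ 1) : latticeVal m ≠ 0 := by
  intro h
  obtain ⟨i, j⟩ := m
  change (i : ℝ) + j * √2 = 0 at h
  have hj : j = 0 := by
    by_contra hj
    have := (irrational_sqrt_two.intCast_mul hj).intCast_add i
    rw [h] at this
    exact this ⟨0, by simp⟩
  have hi : i = 0 := by simpa [hj] using h
  exact hm (by subst hi; subst hj; rfl)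

open Polynomial in
/-- The linear representation of the free product over the polynomial ring, by upper and lower
unipotent matrices. -/
noncomputable def linearRep : FreeProd →* Matrix (Fin 2) (Fin 2) ℝ[X] :=
  Monoid.CoprodI.lift fun b => match b with
    | false =>
      { toFun := fun m => !![1, C (latticeVal m); 0, 1]
        map_one' := by rw [latticeVal_one, map_zero, Matrix.one_fin_two]
        map_mul' := fun m n => by
          rw [latticeVal_mul, map_add, Matrix.mul_fin_two]
          simp [add_comm] }
    | true =>
      { toFun := fun m => !![1, 0; X * C (latticeVal m), 1]
        map_one' := by rw [latticeVal_one, map_zero, mul_zero, Matrix.one_fin_two]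
        map_mul' := fun m n => by
          rw [latticeVal_mul, map_add, Matrix.mul_fin_two]
          simp [mul_add] }

open Polynomial in
theorem linearRep_of_false (m : Multiplicative (ℤ × ℤ)) :
    linearRep (Monoid.CoprodI.of (i := false) m) = !![1, C (latticeVal m); 0, 1] := by
  simp [linearRep]

open Polynomial in
theorem linearRep_of_true (m : Multiplicative (ℤ × ℤ)) :
    linearRep (Monoid.CoprodI.of (i := true) m) = !![1, 0; X * C (latticeVal m), 1] := by
  simp [linearRep]

/-- The vectors on which a letter of the given type increases the degree. -/
def IsReady : Bool → (Fin 2 → ℝ[X]) → Prop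
  | false, v => (v 0).degree < (v 1).degree
  | true, v => v 0 ≠ 0 ∧ (v 1).degree ≤ (v 0).degree

open Polynomial in
-- An upper letter copies the dominant second coordinate into the first; a lower letter adds `X`
-- times the first coordinate to the second. Either way the vector becomes ready for the other type.
theorem IsReady.letter {b : Bool} {v : Fin 2 → ℝ[X]} (h : IsReady b v)
    {m : Multiplicative (ℤ × ℤ)} (hm : m ≠ 1) :
    IsReady (!b) (linearRep (Monoid.CoprodI.of (i := b) m) *ᵥ v) ∧
      (linearRep (Monoid.CoprodI.of (i := b) m) *ᵥ v) 0 ≠ 0 ∧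
      (linearRep (Monoid.CoprodI.of (i := b) m) *ᵥ v) 1 ≠ 0 := by
  have hx := latticeVal_ne_zero hm
  cases b
  · have e0 : (linearRep (Monoid.CoprodI.of (i := false) m) *ᵥ v) 0 =
        v 0 + C (latticeVal m) * v 1 := by
      rw [linearRep_of_false]; simp [Matrix.mulVec, dotProduct, Fin.sum_univ_two]
    have e1 : (linearRep (Monoid.CoprodI.of (i := false) m) *ᵥ v) 1 = v 1 := by
      rw [linearRep_of_false]; simp [Matrix.mulVec, dotProduct, Fin.sum_univ_two]
    have h' : (v 0).degree < (v 1).degree := h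
    have hv1 : v 1 ≠ 0 := by
      intro h0
      rw [h0, degree_zero] at h'
      exact not_lt_bot h'
    have hd : (C (latticeVal m) * v 1).degree = (v 1).degree := degree_C_mul hx
    have hd2 : (v 0 + C (latticeVal m) * v 1).degree = (v 1).degree := by
      rw [degree_add_eq_right_of_degree_lt (by rwa [hd]), hd]
    have hne : v 0 + C (latticeVal m) * v 1 ≠ 0 := by
      rw [← degree_ne_bot, hd2, degree_ne_bot]
      exact hv1
    simp only [IsReady, Bool.not_false, e0, e1]
    exact ⟨⟨hne, hd2.ge⟩, hne, hv1⟩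
  · have e0 : (linearRep (Monoid.CoprodI.of (i := true) m) *ᵥ v) 0 = v 0 := by
      rw [linearRep_of_true]; simp [Matrix.mulVec, dotProduct, Fin.sum_univ_two]
    have e1 : (linearRep (Monoid.CoprodI.of (i := true) m) *ᵥ v) 1 =
        X * (C (latticeVal m) * v 0) + v 1 := by
      rw [linearRep_of_true]; simp [Matrix.mulVec, dotProduct, Fin.sum_univ_two]; ring
    obtain ⟨hv0, hle⟩ : v 0 ≠ 0 ∧ (v 1).degree ≤ (v 0).degree := h
    have hd : (X * (C (latticeVal m) * v 0)).degree = (v 0).degree + 1 := by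
      rw [degree_mul, degree_X, degree_C_mul hx, add_comm]
    have hlt : (v 0).degree < (v 0).degree + 1 := by
      rw [degree_eq_natDegree hv0]
      exact_mod_cast Nat.lt_succ_self _
    have hd2 : (X * (C (latticeVal m) * v 0) + v 1).degree = (v 0).degree + 1 := by
      rw [degree_add_eq_left_of_degree_lt (by rw [hd]; exact hle.trans_lt hlt), hd]
    have hne : X * (C (latticeVal m) * v 0) + v 1 ≠ 0 := by
      intro h0
      rw [h0, degree_zero] at hd2
      rw [← hd2] at hlt
      exact not_lt_bot hlt
    simp only [IsReady, Bool.not_true, e0, e1]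
    exact ⟨hd2 ▸ hlt, hv0, hne⟩

theorem IsReady.neWord {i j : Bool}
    (w : Monoid.CoprodI.NeWord (fun _ : Bool => Multiplicative (ℤ × ℤ)) i j) {v : Fin 2 → ℝ[X]}
    (h : IsReady j v) :
    IsReady (!i) (linearRep w.prod *ᵥ v) ∧ (linearRep w.prod *ᵥ v) 0 ≠ 0 ∧
      (linearRep w.prod *ᵥ v) 1 ≠ 0 := by
  induction w generalizing v with
  | singleton x hx =>
    rw [Monoid.CoprodI.NeWord.prod_singleton]
    exact h.letter hx
  | @append i j k l w₁ hne w₂ ih₁ ih₂ =>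
    rw [Monoid.CoprodI.NeWord.append_prod, map_mul, ← Matrix.mulVec_mulVec]
    have h2 := (ih₂ h).1
    have hjk : (!k) = j := by revert hne; cases j <;> cases k <;> simp
    rw [hjk] at h2
    exact ih₁ h2

theorem exists_neWord_of_ne_one {ι : Type*} {M : ι → Type*} [∀ i, Monoid (M i)]
    {p : Monoid.CoprodI M} (hp : p ≠ 1) :
    ∃ i j, ∃ w : Monoid.CoprodI.NeWord M i j, w.prod = p := by
  classical
  obtain ⟨i, j, w, hw⟩ := Monoid.CoprodI.NeWord.of_word (Monoid.CoprodI.Word.equiv p)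
    (fun h => hp (by
      rw [← Monoid.CoprodI.Word.equiv.symm_apply_apply p, h]
      rfl))
  refine ⟨i, j, w, ?_⟩
  rw [Monoid.CoprodI.NeWord.prod, hw]
  exact Monoid.CoprodI.Word.equiv.symm_apply_apply p

theorem neWord_prod_ne_one {ι : Type*} {M : ι → Type*} [∀ i, Monoid (M i)] {i j : ι}
    (w : Monoid.CoprodI.NeWord M i j) : w.prod ≠ 1 := by
  classical
  intro h
  have h1 : Monoid.CoprodI.Word.equiv.symm w.toWord =
      Monoid.CoprodI.Word.equiv.symm (Monoid.CoprodI.Word.empty : Monoid.CoprodI.Word M) := h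
  have h2 := Monoid.CoprodI.Word.equiv.symm.injective h1
  exact w.toList_ne_nil (congrArg Monoid.CoprodI.Word.toList h2)

/-- The last letter decides which basis vector is ready; its image is a column of the matrix, with
nonzero off-diagonal entry. Being nonscalar, not merely nontrivial, is what transitivity of
commutation requires. -/
theorem linearRep_nonscalar {p : FreeProd} (hp : p ≠ 1) :
    linearRep p 0 1 ≠ 0 ∨ linearRep p 1 0 ≠ 0 := by
  obtain ⟨i, j, w, rfl⟩ := exists_neWord_of_ne_one hp
  cases j
  · left
    have h := (IsReady.neWord w (v := ![0, 1]) (by simp [IsReady])).2.1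
    simpa [Matrix.mulVec, dotProduct, Fin.sum_univ_two] using h
  · right
    have h := (IsReady.neWord w (v := ![1, 0]) (by simp [IsReady])).2.2
    simpa [Matrix.mulVec, dotProduct, Fin.sum_univ_two] using h

theorem linearRep_injective : Function.Injective linearRep := by
  rw [injective_iff_map_eq_one]
  intro p hp
  by_contra hne
  have := linearRep_nonscalar hne
  simp [hp] at this

theorem freeProd_commute_trans {r s t : FreeProd} (hr : r ≠ 1) (hs : Commute r s)
    (ht : Commute r t) : Commute s t := by
  have := commute_trans_fin_two (linearRep_nonscalar hr) (hs.map linearRep) (ht.map linearRep)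
  refine linearRep_injective ?_
  rw [map_mul, map_mul]
  exact this

/-- A free product of two nontrivial free abelian groups has no nontrivial element commuting with
all its conjugates. -/
theorem freeProd_eq_one_of_commute_conj {r : FreeProd}
    (h : ∀ s, Commute r (s * r * s⁻¹)) : r = 1 := by
  by_contra hne
  have key : ∀ s : FreeProd, ∃ M', Commute (linearRep r) M' ∧
      M' * linearRep s = linearRep s * linearRep r := fun s =>
    ⟨linearRep (s * r * s⁻¹), (h s).map linearRep, by
      rw [← map_mul, ← map_mul, inv_mul_cancel_right]⟩
  set M := linearRep r with hM
  let m : Multiplicative (ℤ × ℤ) := Multiplicative.ofAdd (1, 0)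
  have hm : latticeVal m = 1 := by simp [latticeVal, m]
  -- Conjugating by a unipotent matrix of the opposite triangular type and comparing entries forces
  -- the square of the nonzero off-diagonal entry to vanish.
  rcases linearRep_nonscalar hne with h1 | h1
  · obtain ⟨M', hc, he⟩ := key (Monoid.CoprodI.of (i := true) m)
    rw [linearRep_of_true, hm, map_one, mul_one] at he
    have hc' : M * M' = M' * M := hc
    rw [← Matrix.ext_iff] at he hc'
    simp only [Fin.forall_fin_two, Matrix.mul_apply, Fin.sum_univ_two, Matrix.of_apply,
      Matrix.cons_val', Matrix.cons_val_zero, Matrix.cons_val_one, Matrix.cons_val_fin_one,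
      mul_one, mul_zero, one_mul, zero_mul, zero_add, add_zero] at he hc'
    obtain ⟨⟨e1, e2⟩, e3, e4⟩ := he
    obtain ⟨⟨c1, c2⟩, c3, c4⟩ := hc'
    have : (2 * Polynomial.X) * (M 0 1) ^ 2 = 0 := by
      rw [e2, e4] at c2
      have e5 : M' 0 0 = M 0 0 - M 0 1 * Polynomial.X := by rw [← e1, e2]; ring
      rw [e5] at c2
      linear_combination c2
    rcases mul_eq_zero.1 this with h2 | h2
    · simp at h2
    · exact h1 (pow_eq_zero_iff (two_ne_zero) |>.1 h2)
  · obtain ⟨M', hc, he⟩ := key (Monoid.CoprodI.of (i := false) m)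
    rw [linearRep_of_false, hm, map_one] at he
    have hc' : M * M' = M' * M := hc
    rw [← Matrix.ext_iff] at he hc'
    simp only [Fin.forall_fin_two, Matrix.mul_apply, Fin.sum_univ_two, Matrix.of_apply,
      Matrix.cons_val', Matrix.cons_val_zero, Matrix.cons_val_one, Matrix.cons_val_fin_one,
      mul_one, mul_zero, one_mul, zero_mul, zero_add, add_zero] at he hc'
    obtain ⟨⟨e1, e2⟩, e3, e4⟩ := he
    obtain ⟨⟨c1, c2⟩, c3, c4⟩ := hc'
    have : 2 * (M 1 0) ^ 2 = 0 := by
      rw [e3, e1] at c3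
      have e5 : M' 1 1 = M 1 1 - M 1 0 := by rw [← e4, e3]; ring
      rw [e5] at c3
      linear_combination c3
    rcases mul_eq_zero.1 this with h2 | h2
    · simp at h2
    · exact h1 (pow_eq_zero_iff (two_ne_zero) |>.1 h2)

/-- Homomorphisms injective on the factors induce an injective homomorphism of free products. -/
theorem coprodI_lift_of_comp_injective {ι : Type*} {A' B : Type*} [Group B]
    [Group A'] (φ : A' →* B) (hφ : Function.Injective φ) :
    Function.Injective (Monoid.CoprodI.lift
      (fun i : ι => (Monoid.CoprodI.of (M := fun _ : ι => B) (i := i)).comp φ) :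
        Monoid.CoprodI (fun _ : ι => A') →* Monoid.CoprodI (fun _ : ι => B)) := by
  rw [injective_iff_map_eq_one]
  intro p hp
  by_contra hne
  obtain ⟨i, j, w, rfl⟩ := exists_neWord_of_ne_one hne
  have key : ∀ {i j} (w : Monoid.CoprodI.NeWord (fun _ : ι => A') i j),
      ∃ w' : Monoid.CoprodI.NeWord (fun _ : ι => B) i j, w'.prod = Monoid.CoprodI.lift
        (fun i : ι => (Monoid.CoprodI.of (M := fun _ : ι => B) (i := i)).comp φ) w.prod := by
    intro i j w
    induction w with
    | singleton x hx =>
      refine ⟨.singleton (φ x) fun e => hx (hφ (e.trans (map_one φ).symm)), ?_⟩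
      simp
    | append w₁ hne w₂ ih₁ ih₂ =>
      obtain ⟨w₁', h₁⟩ := ih₁
      obtain ⟨w₂', h₂⟩ := ih₂
      exact ⟨.append w₁' hne w₂', by
        rw [Monoid.CoprodI.NeWord.append_prod, Monoid.CoprodI.NeWord.append_prod, map_mul, h₁, h₂]⟩
  obtain ⟨w', hw'⟩ := key w
  exact neWord_prod_ne_one w' (hw'.trans hp)

/-- The homomorphism from the free product of two copies of `ℤ²` to `A ∗ ℤ` which sends the first
copy to `A` and the second one to the conjugate of `A` by the generator of `ℤ`. -/
def freeProdHom {A : Type*} [Group A] (φ : Multiplicative (ℤ × ℤ) →* A) :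
    FreeProd →* Monoid.Coprod A (Multiplicative ℤ) :=
  Monoid.CoprodI.lift fun b => match b with
    | false => Monoid.Coprod.inl.comp φ
    | true => (MulAut.conj (Monoid.Coprod.inr (Multiplicative.ofAdd (1 : ℤ)) :
        Monoid.Coprod A (Multiplicative ℤ))).toMonoidHom.comp (Monoid.Coprod.inl.comp φ)

theorem freeProdHom_of_false {A : Type*} [Group A] (φ : Multiplicative (ℤ × ℤ) →* A)
    (m : Multiplicative (ℤ × ℤ)) :
    freeProdHom φ (Monoid.CoprodI.of (i := false) m) = Monoid.Coprod.inl (φ m) := by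
  simp [freeProdHom]

theorem freeProdHom_of_true {A : Type*} [Group A] (φ : Multiplicative (ℤ × ℤ) →* A)
    (m : Multiplicative (ℤ × ℤ)) :
    freeProdHom φ (Monoid.CoprodI.of (i := true) m) =
      Monoid.Coprod.inr (Multiplicative.ofAdd (1 : ℤ)) * Monoid.Coprod.inl (φ m) *
        (Monoid.Coprod.inr (Multiplicative.ofAdd (1 : ℤ)))⁻¹ := by
  simp [freeProdHom]

/-- The automorphism of a free product of two copies of a group exchanging the copies. -/
def swapFactors (A : Type*) [Group A] :
    Monoid.CoprodI (fun _ : Bool => A) ≃* Monoid.CoprodI (fun _ : Bool => A) :=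
  MonoidHom.toMulEquiv
    (Monoid.CoprodI.lift fun b => Monoid.CoprodI.of (M := fun _ : Bool => A) (i := !b))
    (Monoid.CoprodI.lift fun b => Monoid.CoprodI.of (M := fun _ : Bool => A) (i := !b))
    (by ext b m; cases b <;> simp) (by ext b m; cases b <;> simp)

theorem swapFactors_of (A : Type*) [Group A] (b : Bool) (m : A) :
    swapFactors A (Monoid.CoprodI.of (M := fun _ : Bool => A) (i := b) m) =
      Monoid.CoprodI.of (M := fun _ : Bool => A) (i := !b) m := by
  simp [swapFactors]

/-- Let `A ∗ ℤ` act on the set `A ∗ A`: `A` by left multiplication through one factor, the generator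
of `ℤ` by exchanging factors. The conjugate of `A` then acts by left multiplication through the
other factor, and left multiplication is faithful. -/
theorem freeProdHom_injective {A : Type*} [Group A] {φ : Multiplicative (ℤ × ℤ) →* A}
    (hφ : Function.Injective φ) : Function.Injective (freeProdHom φ) := by
  let C := Monoid.CoprodI (fun _ : Bool => A)
  let L : C →* Equiv.Perm C := MulAction.toPermHom C C
  let π : Monoid.Coprod A (Multiplicative ℤ) →* Equiv.Perm C :=
    Monoid.Coprod.lift (L.comp (Monoid.CoprodI.of (M := fun _ : Bool => A) (i := false)))
      (zpowersHom _ (swapFactors A).toEquiv)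
  have hπ : π.comp (freeProdHom φ) = L.comp (Monoid.CoprodI.lift
      (fun i : Bool => (Monoid.CoprodI.of (M := fun _ : Bool => A) (i := i)).comp φ)) := by
    refine Monoid.CoprodI.ext_hom _ _ fun b => ?_
    refine MonoidHom.ext fun m => ?_
    cases b
    · simp only [MonoidHom.comp_apply, freeProdHom_of_false, Monoid.CoprodI.lift_of]
      simp [π]
    · simp only [MonoidHom.comp_apply, freeProdHom_of_true, Monoid.CoprodI.lift_of]
      refine Equiv.ext fun c => ?_
      simp only [π, map_mul, map_inv, Monoid.Coprod.lift_apply_inl, Monoid.Coprod.lift_apply_inr,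
        MonoidHom.comp_apply, Equiv.Perm.mul_apply, zpowersHom_apply, toAdd_ofAdd, zpow_one]
      change swapFactors A (Monoid.CoprodI.of (M := fun _ : Bool => A) (i := false) (φ m) *
        (swapFactors A).symm c) = Monoid.CoprodI.of (M := fun _ : Bool => A) (i := true) (φ m) * c
      rw [map_mul, MulEquiv.apply_symm_apply, swapFactors_of]
  have hinj : Function.Injective (π.comp (freeProdHom φ)) := by
    rw [hπ]
    exact (MulAction.toPerm_injective).comp (coprodI_lift_of_comp_injective φ hφ)
  exact Function.Injective.of_comp hinj

end IntervalDiff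

/-! ### A word trivial near common fixed points -/

namespace IntervalDiff

open Set Filter Topology
open scoped commutatorElement

variable {a b c d f g : I ≃ₜ I} {q : I}

theorem tendsto_of_fixed (hf : f q = q) : Tendsto f (𝓝 q) (𝓝 q) := by
  have := f.continuous.tendsto q
  rwa [hf] at this

/-- Two diffeomorphisms tangent to the identity at a common fixed point cannot both jump over
fixed points of the other one, starting from the same point. -/
theorem eventually_not_two_jumps (hf : IsC1Holder 0 f) (hg : IsC1Holder 0 g) (hfq : f q = q)
    (hgq : g q = q) (hDf : D f q = 1) (hDg : D g q = 1) :
    ∀ᶠ y in 𝓝 q, f y ≠ y → g y ≠ y → g (f y) = f y → f (g y) = g y → False := by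
  have h1 : ∀ {f : I ≃ₜ I}, IsC1Holder 0 f → D f q = 1 → ∀ᶠ y : I in 𝓝 q, D f y < 2 := by
    intro f hf hD
    refine (hf.continuous_D.tendsto q).eventually (gt_mem_nhds ?_)
    rw [hD]
    exact one_lt_two
  obtain ⟨ε, hε, hU⟩ := Metric.eventually_nhds_iff_ball.1 ((h1 hf hDf).and (h1 hg hDg))
  have hconv : ∀ x y z : I, x ∈ Metric.ball q ε → z ∈ Metric.ball q ε → x ≤ y → y ≤ z →
      y ∈ Metric.ball q ε := by
    intro x y z hx hz hxy hyz
    rw [Metric.mem_ball, Subtype.dist_eq, Real.dist_eq, abs_lt] at *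
    rw [← Subtype.coe_le_coe] at hxy hyz
    constructor <;> linarith
  have key : ∀ {f g : I ≃ₜ I}, IsC1Holder 0 f → IsC1Holder 0 g →
      (∀ y ∈ Metric.ball q ε, D f y < 2 ∧ D g y < 2) → ∀ y : I, f y ∈ Metric.ball q ε →
        g y ∈ Metric.ball q ε → f y < y → g y ≠ y → g (f y) = f y → f (g y) = g y → False := by
    intro f g hf hg hU y hfy hgy hlt hne hgf hfg
    have h2 : f y < g y := by
      have := hg.strictMono hlt
      rwa [hgf] at this
    have h3 : y < g y := by
      refine lt_of_le_of_ne (le_of_not_gt fun h3 => ?_) (Ne.symm hne)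
      have := hf.strictMono h3
      rw [hfg] at this
      exact lt_asymm h2 this
    -- Both `f [y, g y]` and `g [f y, y]` equal `[f y, g y]`. Derivatives below two would make each
    -- of the adjacent intervals `[f y, y]` and `[y, g y]` shorter than the other.
    obtain ⟨ξ, hξ, e1⟩ := hf.exists_D_eq h3
    obtain ⟨η, hη, e2⟩ := hg.exists_D_eq hlt
    have hξU := (hU ξ (hconv _ _ _ hfy hgy (hlt.le.trans hξ.1.le) hξ.2.le)).1
    have hηU := (hU η (hconv _ _ _ hfy hgy hη.1.le (hη.2.le.trans h3.le))).2
    rw [hfg] at e1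
    rw [hgf] at e2
    have p1 : (0 : ℝ) < (g y : ℝ) - y := sub_pos.2 h3
    have p2 : (0 : ℝ) < (y : ℝ) - f y := sub_pos.2 hlt
    nlinarith
  have hball := Metric.ball_mem_nhds q hε
  filter_upwards [(tendsto_of_fixed hfq).eventually hball, (tendsto_of_fixed hgq).eventually hball]
    with y hfy hgy hf1 hg1 hgf hfg
  rcases lt_or_gt_of_ne hf1 with h | h
  · exact key hf hg hU y hfy hgy h hg1 hgf hfg
  · rcases lt_or_gt_of_ne hg1 with h' | h'
    · exact key hg hf (fun z hz => (hU z hz).symm) y hgy hfy h' hf1 hfg hgf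
    · have h2 := hg.strictMono h
      have h3 := hf.strictMono h'
      rw [hgf] at h2
      rw [hfg] at h3
      exact lt_asymm h2 h3

theorem eventually_eq_of_D_ne_one (hf : IsC1Holder 0 f) (hfq : f q = q) (hD : D f q ≠ 1) :
    ∀ᶠ y in 𝓝 q, f y = y → y = q := by
  obtain ⟨ε, hε, hU⟩ := Metric.eventually_nhds_iff_ball.1
    ((hf.continuous_D.tendsto q).eventually_ne hD)
  filter_upwards [Metric.ball_mem_nhds q hε] with y hy hfy
  rw [Metric.mem_ball, Subtype.dist_eq, Real.dist_eq, abs_lt] at hy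
  by_contra hne
  have key : ∀ x y : I, x < y → f x = x → f y = y → ∃ ξ ∈ Ioo x y, D f ξ = 1 := by
    intro x y hxy hx hy
    obtain ⟨ξ, hξ, e⟩ := hf.exists_D_eq hxy
    refine ⟨ξ, hξ, ?_⟩
    rw [hx, hy] at e
    have hpos : (0 : ℝ) < (y : ℝ) - x := sub_pos.2 hxy
    exact (mul_right_cancel₀ hpos.ne' (by rw [one_mul]; exact e)).symm
  rcases lt_or_gt_of_ne hne with h | h
  · obtain ⟨ξ, hξ, e⟩ := key _ _ h hfy hfq
    refine hU ξ ?_ e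
    rw [Metric.mem_ball, Subtype.dist_eq, Real.dist_eq, abs_lt]
    have h1 : (y : ℝ) < ξ := hξ.1
    have h2 : (ξ : ℝ) < q := hξ.2
    constructor <;> linarith
  · obtain ⟨ξ, hξ, e⟩ := key _ _ h hfq hfy
    refine hU ξ ?_ e
    rw [Metric.mem_ball, Subtype.dist_eq, Real.dist_eq, abs_lt]
    have h1 : (q : ℝ) < ξ := hξ.1
    have h2 : (ξ : ℝ) < y := hξ.2
    constructor <;> linarith

theorem eventually_trivial_of_D_ne_one (hf : IsC1Holder 0 f) (hfq : f q = q) (hgq : g q = q)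
    (hfg : ∀ x, f x = x ∨ g x = x) (hD : D f q ≠ 1) : ∀ᶠ y in 𝓝 q, g y = y := by
  filter_upwards [eventually_eq_of_D_ne_one hf hfq hD] with y hy
  rcases hfg y with h | h
  · rw [hy h, hgq]
  · exact h

/-- Locates the support of a commutator in terms of points moved by both elements; all later support
computations rest on it. -/
theorem exists_moved_of_commutator {y : I} (h : ⁅f, g⁆ y ≠ y) :
    ∃ z, (z = y ∨ z = f⁻¹ y ∨ z = g⁻¹ y) ∧ f z ≠ z ∧ g z ≠ z := by
  by_contra! hcon
  refine h ?_
  simp only [commutatorElement_def, Homeomorph.mul_apply]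
  have h2 := hcon _ (Or.inr (Or.inl rfl))
  have h3 := hcon _ (Or.inr (Or.inr rfl))
  rw [apply_inv_apply] at h2 h3
  by_cases hf : f y = y
  · by_cases h4 : f (g⁻¹ y) = g⁻¹ y
    · rw [inv_fixed h4, apply_inv_apply, hf]
    · have h5 := (h3 h4).symm
      have h6 : g y = y := inv_fixed_iff.1 h5
      rw [h5, inv_fixed hf, h6, hf]
  · have hg := hcon y (Or.inl rfl) hf
    have h4 : f⁻¹ y ≠ y := fun e => hf (inv_fixed_iff.1 e)
    rw [inv_fixed hg, h2 (Ne.symm h4), apply_inv_apply]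

theorem eventually_commutator_left (hfq : f q = q) (hgq : g q = q)
    (h : ∀ᶠ y in 𝓝 q, f y = y) : ∀ᶠ y in 𝓝 q, ⁅f, g⁆ y = y := by
  filter_upwards [h, (tendsto_of_fixed (inv_fixed hfq)).eventually h,
    (tendsto_of_fixed (inv_fixed hgq)).eventually h] with y h1 h2 h3
  by_contra hne
  obtain ⟨z, hz, hfz, -⟩ := exists_moved_of_commutator hne
  rcases hz with rfl | rfl | rfl <;> exact hfz ‹_›

theorem eventually_commutator_right (hfq : f q = q) (hgq : g q = q)
    (h : ∀ᶠ y in 𝓝 q, g y = y) : ∀ᶠ y in 𝓝 q, ⁅f, g⁆ y = y := by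
  filter_upwards [h, (tendsto_of_fixed (inv_fixed hfq)).eventually h,
    (tendsto_of_fixed (inv_fixed hgq)).eventually h] with y h1 h2 h3
  by_contra hne
  obtain ⟨z, hz, -, hgz⟩ := exists_moved_of_commutator hne
  rcases hz with rfl | rfl | rfl <;> exact hgz ‹_›

theorem commutator_fixed (hfq : f q = q) (hgq : g q = q) : ⁅f, g⁆ q = q := by
  simp only [commutatorElement_def, Homeomorph.mul_apply, inv_fixed hfq, inv_fixed hgq, hfq, hgq]

theorem eventually_inv (h : ∀ᶠ y in 𝓝 q, f y = y) : ∀ᶠ y in 𝓝 q, f⁻¹ y = y := by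
  filter_upwards [h] with y hy using inv_fixed hy

/-- The conjugate of `d` by `c * a⁻¹`. -/
def conjWord {Γ : Type*} [Group Γ] (a c d : Γ) : Γ := c * a⁻¹ * d * (c * a⁻¹)⁻¹

/-- A word which is trivial near the common fixed points of diffeomorphisms `a, b, c, d`, when
`a` and `b`, respectively `c` and `d`, have disjoint supports. -/
def killingWord {Γ : Type*} [Group Γ] (a b c d : Γ) : Γ := ⁅⁅⁅b, conjWord a c d⁆⁻¹, a⁆, c⁆

theorem map_killingWord {Γ Γ' : Type*} [Group Γ] [Group Γ'] (φ : Γ →* Γ') (a b c d : Γ) :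
    φ (killingWord a b c d) = killingWord (φ a) (φ b) (φ c) (φ d) := by
  simp only [killingWord, conjWord, map_commutatorElement, map_mul, map_inv]

theorem moved_apply {x : I} (h : f x ≠ x) : f (f x) ≠ f x := fun e => h (f.injective e)

/-- If the conclusion failed, `a` and `c` would both move `y = c⁻¹ k`, with `c` fixing `a y` and `a`
fixing `c y`: a double jump, excluded by `hj`. -/
theorem conjWord_moved (hab : ∀ x, a x = x ∨ b x = x) (hcd : ∀ x, c x = x ∨ d x = x)
    {k : I} (hb : b k ≠ k) (hθ : conjWord a c d k ≠ k)
    (hj : a (c⁻¹ k) ≠ c⁻¹ k → c (c⁻¹ k) ≠ c⁻¹ k → c (a (c⁻¹ k)) = a (c⁻¹ k) →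
      a (c (c⁻¹ k)) = c (c⁻¹ k) → False) : d k ≠ k := by
  have hak : a k = k := (hab k).resolve_right hb
  have hd : d (a (c⁻¹ k)) ≠ a (c⁻¹ k) := by
    intro e
    refine hθ ?_
    simp only [conjWord, Homeomorph.mul_apply, mul_inv_rev, inv_inv, e, inv_apply_apply,
      apply_inv_apply]
  have hc : c (a (c⁻¹ k)) = a (c⁻¹ k) := (hcd _).resolve_right hd
  rw [apply_inv_apply] at hj
  by_cases hck : k = c⁻¹ k
  · rw [← hck, hak] at hd
    exact hd
  · by_cases ha : a (c⁻¹ k) = c⁻¹ k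
    · rw [ha, apply_inv_apply] at hc
      exact absurd hc hck
    · exact (hj ha hck hc hak).elim

/-- Both `a` and `c` fix `k`, so only `c (a⁻¹ (d k))` is left. If `d` fixed `a⁻¹ (d k)`, then `a⁻¹`
and `d⁻¹` would make a double jump at `d k`. -/
theorem conjWord_apply (hab : ∀ x, a x = x ∨ b x = x) (hcd : ∀ x, c x = x ∨ d x = x)
    {k : I} (hb : b k ≠ k) (hd : d k ≠ k)
    (hj : a⁻¹ (d k) ≠ d k → d⁻¹ (d k) ≠ d k → d⁻¹ (a⁻¹ (d k)) = a⁻¹ (d k) →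
      a⁻¹ (d⁻¹ (d k)) = d⁻¹ (d k) → False) :
    conjWord a c d k = a⁻¹ (d k) ∧ d (conjWord a c d k) ≠ conjWord a c d k := by
  have hak : a k = k := (hab k).resolve_right hb
  have hck : c k = k := (hcd k).resolve_right hd
  have hdd := moved_apply hd
  have e1 : conjWord a c d k = c (a⁻¹ (d k)) := by
    simp only [conjWord, Homeomorph.mul_apply, mul_inv_rev, inv_inv, inv_fixed hck, hak]
  have hm : d (a⁻¹ (d k)) ≠ a⁻¹ (d k) := by
    by_cases ha : a⁻¹ (d k) = d k
    · rw [ha]; exact hdd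
    · intro e
      refine hj ha ?_ (inv_fixed e) ?_
      · rw [inv_apply_apply]; exact Ne.symm hd
      · rw [inv_apply_apply, inv_fixed hak]
  have e2 : c (a⁻¹ (d k)) = a⁻¹ (d k) := (hcd _).resolve_right hm
  rw [e1, e2]
  exact ⟨rfl, hm⟩

/-- Near `q`, a point `z` moved by `a` and by `u = ⁅b, θ⁆` is `θ k` for some `k` moved by `b` and
`d`, and `a z = d k`. Hence `d` moves `z`, `a z` and `u⁻¹ z`, so the support of `⁅u⁻¹, a⁆` near `q`
lies in that of `d`, where `c` is trivial. -/
theorem eventually_killingWord_of_tangent (hab : ∀ x, a x = x ∨ b x = x)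
    (hcd : ∀ x, c x = x ∨ d x = x)
    (haq : a q = q) (hbq : b q = q) (hcq : c q = q) (hdq : d q = q)
    (ha : IsC1Holder 0 a) (hb : IsC1Holder 0 b)
    (hc : IsC1Holder 0 c) (hd : IsC1Holder 0 d)
    (hDa : D a q = 1) (hDb : D b q = 1) (hDc : D c q = 1) (hDd : D d q = 1) :
    ∀ᶠ y in 𝓝 q, killingWord a b c d y = y := by
  have hDinv : ∀ {f : I ≃ₜ I}, IsC1Holder 0 f → f q = q → D f q = 1 → D f⁻¹ q = 1 :=
    fun hf hfq hD => ((tangentToId 0 q).inv_mem ⟨hf, hfq, hD⟩).2.2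
  set θ := conjWord a c d with hθ
  have hwq : (c * a⁻¹) q = q := by rw [Homeomorph.mul_apply, inv_fixed haq, hcq]
  have hθq : θ q = q := by
    rw [hθ, conjWord, Homeomorph.mul_apply, inv_fixed hwq, Homeomorph.mul_apply, hdq, hwq]
  set u := ⁅b, θ⁆ with hu
  have huq : u q = q := commutator_fixed hbq hθq
  have L1 : ∀ᶠ k in 𝓝 q, b k ≠ k → θ k ≠ k → d k ≠ k := by
    filter_upwards [(tendsto_of_fixed (inv_fixed hcq)).eventually
      (eventually_not_two_jumps ha hc haq hcq hDa hDc)] with k hj h1 h2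
    exact conjWord_moved hab hcd h1 h2 hj
  have L2 : ∀ᶠ k in 𝓝 q, b k ≠ k → d k ≠ k → θ k = a⁻¹ (d k) ∧ d (θ k) ≠ θ k := by
    filter_upwards [(tendsto_of_fixed hdq).eventually (eventually_not_two_jumps ha.inv hd.inv
      (inv_fixed haq) (inv_fixed hdq) (hDinv ha haq hDa) (hDinv hd hdq hDd))] with k hj h1 h2
    exact conjWord_apply hab hcd h1 h2 hj
  have L3 := eventually_not_two_jumps hb hd hbq hdq hDb hDd
  have key : ∀ᶠ z in 𝓝 q, u z ≠ z → a z ≠ z →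
      d z ≠ z ∧ d (a z) ≠ a z ∧ d (u⁻¹ z) ≠ u⁻¹ z := by
    have tθ := tendsto_of_fixed (inv_fixed hθq)
    filter_upwards [tθ.eventually L1, tθ.eventually L2, tθ.eventually L3,
      tθ.eventually ((tendsto_of_fixed hbq).eventually L2)] with z h1 h2 h3 h4 huz haz
    have hbz : b z = z := (hab z).resolve_left haz
    obtain ⟨k, hk, hbk, hθk⟩ := exists_moved_of_commutator huz
    have hk' : k = θ⁻¹ z := by
      rcases hk with rfl | rfl | rfl
      · exact absurd hbz hbk
      · rw [inv_fixed hbz] at hbk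
        exact absurd hbz hbk
      · rfl
    subst hk'
    set k := θ⁻¹ z with hk0
    have hθkz : θ k = z := apply_inv_apply θ z
    have hdk := h1 hbk hθk
    obtain ⟨e1, e2⟩ := h2 hbk hdk
    rw [hθkz] at e1 e2
    have hazd : a z = d k := by rw [e1, apply_inv_apply]
    have hadk : a (d k) ≠ d k := by
      intro e
      rw [inv_fixed e] at e1
      exact haz (by rw [e1, e])
    have hbdk : b (d k) = d k := (hab _).resolve_left hadk
    have hdbk : d (b k) ≠ b k := fun e => h3 hbk hdk e hbdk
    refine ⟨e2, by rw [hazd]; exact moved_apply hdk, ?_⟩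
    have e3 : u⁻¹ z = θ (b k) := by
      rw [hu, commutatorElement_inv, commutatorElement_def, Homeomorph.mul_apply,
        Homeomorph.mul_apply, Homeomorph.mul_apply, inv_fixed hbz]
    rw [e3]
    exact (h4 (moved_apply hbk) hdbk).2
  have L5 : ∀ᶠ y in 𝓝 q, ⁅u⁻¹, a⁆ y ≠ y → c y = y := by
    filter_upwards [key, (tendsto_of_fixed huq).eventually key,
      (tendsto_of_fixed (inv_fixed haq)).eventually key] with y h1 h2 h3 hy
    refine (hcd y).resolve_right ?_
    obtain ⟨z, hz, huz, haz⟩ := exists_moved_of_commutator hy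
    rw [inv_inv] at hz
    have huz' : u z ≠ z := fun e => huz (inv_fixed e)
    rcases hz with rfl | rfl | rfl
    · exact (h1 huz' haz).1
    · have := (h2 huz' haz).2.2
      rwa [inv_apply_apply] at this
    · have := (h3 huz' haz).2.1
      rwa [apply_inv_apply] at this
  have hvq : ⁅u⁻¹, a⁆ q = q := commutator_fixed (inv_fixed huq) haq
  filter_upwards [L5, (tendsto_of_fixed (inv_fixed hvq)).eventually L5,
    (tendsto_of_fixed (inv_fixed hcq)).eventually L5] with y h1 h2 h3
  rw [killingWord, ← hθ, ← hu]
  by_contra hne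
  obtain ⟨z, hz, hvz, hcz⟩ := exists_moved_of_commutator hne
  rcases hz with rfl | rfl | rfl
  · exact hcz (h1 hvz)
  · exact hcz (h2 hvz)
  · exact hcz (h3 hvz)

/-- A letter with derivative other than one at `q` has `q` as an isolated fixed point; its partner
is then trivial near `q`, which kills one of the nested commutators. Otherwise all letters are
tangent to the identity. -/
theorem eventually_killingWord (hab : ∀ x, a x = x ∨ b x = x) (hcd : ∀ x, c x = x ∨ d x = x)
    (haq : a q = q) (hbq : b q = q) (hcq : c q = q) (hdq : d q = q)
    (ha : IsC1Holder 0 a) (hb : IsC1Holder 0 b)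
    (hc : IsC1Holder 0 c) (hd : IsC1Holder 0 d) :
    ∀ᶠ y in 𝓝 q, killingWord a b c d y = y := by
  have hwq : (c * a⁻¹) q = q := by rw [Homeomorph.mul_apply, inv_fixed haq, hcq]
  have hθq : conjWord a c d q = q := by
    rw [conjWord, Homeomorph.mul_apply, inv_fixed hwq, Homeomorph.mul_apply, hdq, hwq]
  have huq : ⁅b, conjWord a c d⁆ q = q := commutator_fixed hbq hθq
  have hvq := commutator_fixed (inv_fixed huq) haq
  have of_u : (∀ᶠ y in 𝓝 q, ⁅b, conjWord a c d⁆ y = y) →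
      ∀ᶠ y in 𝓝 q, killingWord a b c d y = y := fun h =>
    eventually_commutator_left hvq hcq
      (eventually_commutator_left (inv_fixed huq) haq (eventually_inv h))
  by_cases hDa : D a q = 1
  swap
  · exact of_u (eventually_commutator_left hbq hθq
      (eventually_trivial_of_D_ne_one ha haq hbq hab hDa))
  by_cases hDb : D b q = 1
  swap
  · exact eventually_commutator_left hvq hcq (eventually_commutator_right (inv_fixed huq) haq
      (eventually_trivial_of_D_ne_one hb hbq haq (fun x => (hab x).symm) hDb))
  by_cases hDc : D c q = 1
  swap
  · refine of_u (eventually_commutator_right hbq hθq ?_)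
    filter_upwards [(tendsto_of_fixed (inv_fixed hwq)).eventually
      (eventually_trivial_of_D_ne_one hc hcq hdq hcd hDc)] with y hy
    rw [conjWord, Homeomorph.mul_apply, Homeomorph.mul_apply, hy, apply_inv_apply]
  by_cases hDd : D d q = 1
  swap
  · exact eventually_commutator_right hvq hcq
      (eventually_trivial_of_D_ne_one hd hdq hcq (fun x => (hcd x).symm) hDd)
  exact eventually_killingWord_of_tangent hab hcd haq hbq hcq hdq ha hb hc hd hDa hDb hDc hDd

end IntervalDiff

/-! ### Faithful actions have no locally trivial elements; the free product does not embed -/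

namespace IntervalDiff

open Set Filter Topology
open scoped commutatorElement

section Compression

variable {S : Type*} [Group S]

/-- The common fixed points of an action. -/
def commonFixed (κ : S →* (I ≃ₜ I)) : Set I := {q | ∀ p, κ p q = q}

/-- The point `x` is not a common fixed point, and `l` is the last common fixed point before it. -/
def IsGap (κ : S →* (I ≃ₜ I)) (l x : I) : Prop :=
  l ∈ commonFixed κ ∧ l < x ∧ ∀ z ∈ Ioc l x, z ∉ commonFixed κ

/-- The left end points of the components of the complement of the common fixed points in which
`p` acts nontrivially. -/
def movedGaps (κ : S →* (I ≃ₜ I)) (p : S) : Set I := {l | ∃ x, κ p x ≠ x ∧ IsGap κ l x}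

/-- `p` acts trivially near the common fixed points. -/
def IsLocallyTrivial (κ : S →* (I ≃ₜ I)) (p : S) : Prop :=
  ∀ q ∈ commonFixed κ, ∀ᶠ y in 𝓝 q, κ p y = y

variable {κ : S →* (I ≃ₜ I)} {p p' r s : S} {l x : I}

theorem isClosed_commonFixed (κ : S →* (I ≃ₜ I)) : IsClosed (commonFixed κ) := by
  have : commonFixed κ = ⋂ p, {q | κ p q = q} := by ext q; simp [commonFixed]
  rw [this]
  exact isClosed_iInter fun p => isClosed_eq (κ p).continuous continuous_id

theorem map_apply_inv_apply (κ : S →* (I ≃ₜ I)) (s : S) (x : I) : κ s (κ s⁻¹ x) = x := by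
  rw [map_inv, apply_inv_apply]

theorem conj_moved (h : κ (s * r * s⁻¹) x ≠ x) : κ r (κ s⁻¹ x) ≠ κ s⁻¹ x := by
  intro e
  refine h ?_
  rw [map_mul, map_mul, Homeomorph.mul_apply, Homeomorph.mul_apply, e, map_apply_inv_apply]

theorem IsLocallyTrivial.conj (hr : IsLocallyTrivial κ r) (s : S) :
    IsLocallyTrivial κ (s * r * s⁻¹) := by
  intro q hq
  filter_upwards [(tendsto_of_fixed (hq s⁻¹)).eventually (hr q hq)] with y hy
  by_contra h
  exact conj_moved h hy

theorem IsLocallyTrivial.commutator (hr : IsLocallyTrivial κ r) (s : S) :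
    IsLocallyTrivial κ ⁅r, s⁆ := by
  intro q hq
  rw [map_commutatorElement]
  exact eventually_commutator_left (hq r) (hq s) (hr q hq)

theorem IsGap.map (hκ : ∀ p, StrictMono (κ p)) (h : IsGap κ l x) (s : S) :
    IsGap κ l (κ s x) := by
  obtain ⟨hl, hlx, hz⟩ := h
  refine ⟨hl, ?_, fun z hzI hzF => hz z ⟨hzI.1, ?_⟩ hzF⟩
  · have := hκ s hlx
    rwa [hl s] at this
  · have := hzI.2
    rwa [← hzF s, (hκ s).le_iff_le] at this

theorem exists_isGap (hκ : ∀ p, StrictMono (κ p)) (h : κ p x ≠ x) : ∃ l, IsGap κ l x := by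
  have h0 : (0 : I) ∈ commonFixed κ := fun p => map_zero_of_strictMono (hκ p)
  obtain ⟨l, hl⟩ := ((isClosed_commonFixed κ).inter isClosed_Iic).isCompact.exists_isGreatest
    ⟨0, h0, (unitInterval.nonneg' : (0 : I) ≤ x)⟩
  refine ⟨l, hl.1.1, lt_of_le_of_ne hl.1.2 ?_, fun z hz hzF => not_le_of_gt hz.1 (hl.2 ⟨hzF, hz.2⟩)⟩
  rintro rfl
  exact h (hl.1.1 p)

theorem eq_one_of_movedGaps_eq_empty (hinj : Function.Injective κ) (hκ : ∀ p, StrictMono (κ p))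
    (h : movedGaps κ p = ∅) : p = 1 := by
  refine hinj ?_
  rw [map_one]
  ext1 x
  by_contra hx
  obtain ⟨l, hl⟩ := exists_isGap hκ hx
  exact (h ▸ (⟨x, hx, hl⟩ : l ∈ movedGaps κ p) : l ∈ (∅ : Set I))

theorem exists_moved_of_mem_movedGaps_commutator (hκ : ∀ p, StrictMono (κ p))
    (h : l ∈ movedGaps κ ⁅p, p'⁆) : ∃ x, IsGap κ l x ∧ κ p x ≠ x ∧ κ p' x ≠ x := by
  obtain ⟨x, hx, hl⟩ := h
  rw [map_commutatorElement] at hx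
  obtain ⟨z, hz, h1, h2⟩ := exists_moved_of_commutator hx
  refine ⟨z, ?_, h1, h2⟩
  rcases hz with rfl | rfl | rfl
  · exact hl
  · rw [← map_inv]; exact hl.map hκ _
  · rw [← map_inv]; exact hl.map hκ _

theorem movedGaps_conj_subset (hκ : ∀ p, StrictMono (κ p)) :
    movedGaps κ (s * r * s⁻¹) ⊆ movedGaps κ r := by
  rintro l ⟨x, hx, hl⟩
  exact ⟨_, conj_moved hx, hl.map hκ _⟩

/-- By compactness `p` is trivial on a `δ`-neighbourhood of the common fixed points, so left
endpoints of moved gaps are `δ`-separated. -/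
theorem IsLocallyTrivial.finite_movedGaps (hp : IsLocallyTrivial κ p) :
    (movedGaps κ p).Finite := by
  obtain ⟨δ, hδ, hU⟩ := (isClosed_commonFixed κ).isCompact.exists_thickening_subset_open
    (isOpen_interior (s := {y | κ p y = y})) fun q hq => mem_interior_iff_mem_nhds.2 (hp q hq)
  have hsep : ∀ l ∈ movedGaps κ p, ∀ l' ∈ movedGaps κ p, l < l' → (l : ℝ) + δ ≤ l' := by
    rintro l ⟨x, hx, hl⟩ l' ⟨x', -, hl'⟩ hlt
    have h1 : x < l' := lt_of_not_ge fun h => hl.2.2 l' ⟨hlt, h⟩ hl'.1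
    have h2 : δ ≤ dist x l := by
      by_contra h
      have h4 : x ∈ {y | κ p y = y} :=
        interior_subset (hU (Metric.mem_thickening_iff.2 ⟨l, hl.1, not_le.1 h⟩))
      exact hx h4
    have h3 : (l : ℝ) < x := hl.2.1
    have h4 : (x : ℝ) < l' := h1
    rw [Subtype.dist_eq, Real.dist_eq, abs_of_pos (sub_pos.2 h3)] at h2
    linarith
  refine Set.Finite.of_injOn (f := fun l : I => ⌊(l : ℝ) / δ⌋₊) (t := Iic ⌊1 / δ⌋₊) ?_ ?_
    (finite_Iic _)
  · intro l _
    exact Nat.floor_le_floor (div_le_div_of_nonneg_right l.2.2 hδ.le)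
  · have key : ∀ l ∈ movedGaps κ p, ∀ l' ∈ movedGaps κ p, l < l' →
        ⌊(l : ℝ) / δ⌋₊ ≠ ⌊(l' : ℝ) / δ⌋₊ := by
      intro l hl l' hl' hlt
      have h1 : (l : ℝ) / δ + 1 ≤ (l' : ℝ) / δ := by
        rw [div_add_one hδ.ne']
        exact div_le_div_of_nonneg_right (hsep l hl l' hl' hlt) hδ.le
      have h2 := Nat.floor_le_floor h1
      rw [Nat.floor_add_one (div_nonneg l.2.1 hδ.le)] at h2
      omega
    intro l hl l' hl' e
    rcases lt_trichotomy l l' with h | h | h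
    · exact absurd e (key l hl l' hl' h)
    · exact h
    · exact absurd e.symm (key l' hl' l hl h)

/-- Otherwise the supremum of the orbit of `α` would be a common fixed point inside the gap. -/
theorem exists_lt_apply (hκ : ∀ p, StrictMono (κ p)) {m α β : I}
    (hF : ∀ z ∈ Ioo l m, z ∉ commonFixed κ) (hα : l < α) (hβ : β < m) : ∃ w, β < κ w α := by
  by_contra! hcon
  obtain ⟨z, hz⟩ : ∃ z, IsLUB (range fun w => κ w α) z :=
    ⟨_, isLUB_ciSup ⟨β, by rintro _ ⟨w, rfl⟩; exact hcon w⟩⟩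
  have hzα : α ≤ z := hz.1 ⟨1, by simp only [map_one]; rfl⟩
  have hzβ : z ≤ β := hz.2 (by rintro _ ⟨w, rfl⟩; exact hcon w)
  have hle : ∀ s, z ≤ κ s z := by
    refine fun s => hz.2 ?_
    rintro _ ⟨w, rfl⟩
    have h1 : κ (s⁻¹ * w) α ≤ z := hz.1 ⟨_, rfl⟩
    rw [map_mul, Homeomorph.mul_apply] at h1
    have h2 := (hκ s).monotone h1
    rwa [map_apply_inv_apply] at h2
  refine hF z ⟨hα.trans_le hzα, hzβ.trans_lt hβ⟩ fun s => le_antisymm ?_ (hle s)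
  have := (hκ s).monotone (hle s⁻¹)
  rwa [map_apply_inv_apply] at this

theorem IsLocallyTrivial.exists_bounds (hp : IsLocallyTrivial κ p) {m : I}
    (hl : l ∈ commonFixed κ) (hm : m ∈ commonFixed κ) (hlm : l < m) :
    ∃ α β, l < α ∧ β < m ∧ ∀ x ∈ Ioo l m, κ p x ≠ x → α ≤ x ∧ x ≤ β := by
  obtain ⟨α, hα, h1⟩ := exists_Ico_subset_of_mem_nhds (hp l hl) ⟨m, hlm⟩
  obtain ⟨β, hβ, h2⟩ := exists_Ioc_subset_of_mem_nhds (hp m hm) ⟨l, hlm⟩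
  refine ⟨α, β, hα, hβ, fun x hx hne => ⟨?_, ?_⟩⟩
  · exact le_of_not_gt fun h => hne (h1 ⟨hx.1.le, h⟩)
  · exact le_of_not_gt fun h => hne (h2 ⟨h, hx.2.le⟩)

/-- An action of a commutation transitive group whose nontrivial elements do not commute with all
their conjugates has no nontrivial elements trivial near the common fixed points. -/
theorem IsLocallyTrivial.eq_one (hinj : Function.Injective κ) (hκ : ∀ p, StrictMono (κ p))
    (htrans : ∀ r s t : S, r ≠ 1 → Commute r s → Commute r t → Commute s t)
    (hconj : ∀ r : S, (∀ s, Commute r (s * r * s⁻¹)) → r = 1) (hr : IsLocallyTrivial κ r) :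
    r = 1 := by
  induction hn : (movedGaps κ r).ncard using Nat.strong_induction_on generalizing r with
  | h n ih =>
  by_contra hr1
  obtain ⟨l, hl⟩ : (movedGaps κ r).Nonempty := by
    rw [nonempty_iff_ne_empty]
    exact fun h => hr1 (eq_one_of_movedGaps_eq_empty hinj hκ h)
  obtain ⟨x₀, hx₀, hgap⟩ := id hl
  have hone : (1 : I) ∈ commonFixed κ := fun p => map_one_of_strictMono (hκ p)
  obtain ⟨m, hm⟩ := ((isClosed_commonFixed κ).inter isClosed_Ici).isCompact.exists_isLeast
    ⟨1, hone, (unitInterval.le_one' : x₀ ≤ 1)⟩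
  have hlm : l < m := hgap.2.1.trans_le hm.1.2
  have hF : ∀ z ∈ Ioo l m, z ∉ commonFixed κ := by
    intro z hz hzF
    rcases le_total z x₀ with h | h
    · exact hgap.2.2 z ⟨hz.1, h⟩ hzF
    · exact not_le_of_gt hz.2 (hm.2 ⟨hzF, h⟩)
  have hIoo : ∀ {x}, IsGap κ l x → x ∈ Ioo l m := fun hx =>
    ⟨hx.2.1, lt_of_not_ge fun h => hx.2.2 m ⟨hlm, h⟩ hm.1.1⟩
  refine hr1 (hconj r fun s => ?_)
  have hr₂ := hr.conj s
  obtain ⟨α₁, β₁, hα₁, hβ₁, h₁⟩ := hr.exists_bounds hgap.1 hm.1.1 hlm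
  obtain ⟨α₂, β₂, hα₂, hβ₂, h₂⟩ := hr₂.exists_bounds hgap.1 hm.1.1 hlm
  -- Within the chosen gap, `w` pushes the support of `r` beyond the supports of `r` and `s * r *
  -- s⁻¹`.
  obtain ⟨w, hw⟩ := exists_lt_apply hκ hF hα₁ (max_lt hβ₁ hβ₂)
  have hr₃ := hr.conj w
  have hfar : ∀ x, IsGap κ l x → κ (w * r * w⁻¹) x ≠ x → max β₁ β₂ < x := by
    intro x hx hne
    have h3 := (h₁ _ (hIoo (hx.map hκ w⁻¹)) (conj_moved hne)).1
    have h4 := (hκ w).monotone h3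
    rw [map_apply_inv_apply] at h4
    exact hw.trans_le h4
  have hcomm : ∀ p, (∀ x ∈ Ioo l m, κ p x ≠ x → x ≤ max β₁ β₂) → Commute (w * r * w⁻¹) p := by
    intro p hp
    -- The commutator is locally trivial and moves only gaps moved by `r`, but not the gap at `l`;
    -- the induction hypothesis applies.
    rw [← commutatorElement_eq_one_iff_commute]
    refine ih _ ?_ (hr₃.commutator p) rfl
    rw [← hn]
    refine ncard_lt_ncard ?_ hr.finite_movedGaps
    refine (ssubset_iff_of_subset ?_).2 ⟨l, hl, ?_⟩
    · intro l' hl'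
      obtain ⟨x, hx, h3, -⟩ := exists_moved_of_mem_movedGaps_commutator hκ hl'
      exact movedGaps_conj_subset hκ ⟨x, h3, hx⟩
    · intro hl'
      obtain ⟨x, hx, h3, h4⟩ := exists_moved_of_mem_movedGaps_commutator hκ hl'
      exact not_le_of_gt (hfar x hx h3) (hp x (hIoo hx) h4)
  have hne : w * r * w⁻¹ ≠ 1 := by rwa [Ne, conj_eq_one_iff]
  exact htrans _ _ _ hne (hcomm r fun x hx h => (h₁ x hx h).2.trans (le_max_left _ _))
    (hcomm _ fun x hx h => (h₂ x hx h).2.trans (le_max_right _ _))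

end Compression

theorem pow_ne_one_of_strictMono {f : I ≃ₜ I} (hf : StrictMono f) (h : f ≠ 1) {n : ℕ}
    (hn : n ≠ 0) : f ^ n ≠ 1 := by
  intro e
  refine h (Homeomorph.ext fun x => ?_)
  have hit : f^[n] x = x := by
    have h1 : ∀ k : ℕ, (f ^ k) x = f^[k] x := by
      intro k
      induction k with
      | zero => rfl
      | succ k ih => rw [pow_succ', Homeomorph.mul_apply, ih, Function.iterate_succ_apply']
    rw [← h1, e]
    rfl
  exact ((Function.Commute.id_right (f := f)).iterate_pos_eq_iff_map_eq hf.monotone strictMono_id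
    (Nat.pos_of_ne_zero hn)).1 (by rw [hit, Function.iterate_id, id])

theorem zpow_ne_one_of_strictMono {f : I ≃ₜ I} (hf : StrictMono f) (h : f ≠ 1) {n : ℤ}
    (hn : n ≠ 0) : f ^ n ≠ 1 := by
  rw [Ne, ← pow_natAbs_eq_one]
  exact pow_ne_one_of_strictMono hf h (Int.natAbs_ne_zero.2 hn)

/-- The homomorphism from `ℤ²` to a product given by an element of each factor. -/
def latticeHom {G H : Type*} [Group G] [Group H] (g : G) (h : H) :
    Multiplicative (ℤ × ℤ) →* G × H where
  toFun m := (g ^ m.toAdd.1, h ^ m.toAdd.2)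
  map_one' := by simp
  map_mul' m n := by simp [zpow_add]

/-- A permutation representation of the free product detecting `killingWord`. -/
def permRep : FreeProd →* Equiv.Perm (Fin 4) :=
  Monoid.CoprodI.lift fun b =>
    (zpowersHom (Equiv.Perm (Fin 4)) (bif b then Equiv.swap 0 1 * Equiv.swap 1 2
      else Equiv.swap 2 3)).comp (AddMonoidHom.toMultiplicative
        (AddMonoidHom.fst ℤ ℤ + AddMonoidHom.snd ℤ ℤ))

theorem permRep_of (b : Bool) (i j : ℤ) :
    permRep (Monoid.CoprodI.of (i := b) (Multiplicative.ofAdd (i, j))) =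
      (bif b then Equiv.swap 0 1 * Equiv.swap 1 2 else Equiv.swap 2 3) ^ (i + j) := by
  simp [permRep]

theorem killingWord_freeProd_ne_one :
    killingWord (Monoid.CoprodI.of (i := false) (Multiplicative.ofAdd ((1, 0) : ℤ × ℤ)) : FreeProd)
      (Monoid.CoprodI.of (i := false) (Multiplicative.ofAdd (0, 1)))
      (Monoid.CoprodI.of (i := true) (Multiplicative.ofAdd (0, 1)))
      (Monoid.CoprodI.of (i := true) (Multiplicative.ofAdd (1, 0))) ≠ 1 := by
  intro h
  have := congrArg permRep h
  rw [map_killingWord, map_one] at this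
  simp only [permRep_of, add_zero, zero_add, zpow_one, cond_true, cond_false] at this
  -- The letters `a, b` become one transposition, `c, d` one 3-cycle, and the image of the word
  -- moves the point `0`.
  have h0 := Equiv.congr_fun this 0
  simp only [killingWord, conjWord, commutatorElement_def, mul_inv_rev, Equiv.swap_inv,
    Equiv.Perm.mul_apply, Equiv.Perm.one_apply] at h0
  simp [Equiv.swap_apply_def] at h0

/-- Two nontrivial elements with disjoint supports prevent embeddings of the free product. -/
theorem not_injective_of_disjoint_support {G H : Type*} [Group G] [Group H]
    {Γ : Subgroup (I ≃ₜ I)} (hΓ : Γ ≤ Diff 0)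
    (ψ : Monoid.Coprod (G × H) (Multiplicative ℤ) →* Γ) {g : G} {h : H} (hg : g ≠ 1) (hh : h ≠ 1)
    (hgh : ∀ x, (ψ (.inl (g, 1)) : I ≃ₜ I) x = x ∨ (ψ (.inl (1, h)) : I ≃ₜ I) x = x) :
    ¬ Function.Injective ψ := by
  intro hψ
  obtain ⟨ρ, hρ⟩ : ∃ ρ : Monoid.Coprod (G × H) (Multiplicative ℤ) →* (I ≃ₜ I),
    ∀ p, ρ p = ψ p := ⟨Γ.subtype.comp ψ, fun _ => rfl⟩
  have hρinj : Function.Injective ρ := fun p p' e =>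
    hψ (Subtype.ext (by rw [← hρ, ← hρ, e]))
  have hC : ∀ p, IsC1Holder 0 (ρ p) := fun p => by
    rw [hρ]
    exact hΓ (ψ p).2
  simp only [← hρ] at hgh
  -- Increasing homeomorphisms have no torsion, so `g` and `h` span a copy of `ℤ²`.
  have htf : ∀ p : G × H, p ≠ 1 → ∀ n : ℤ, n ≠ 0 → p ^ n ≠ 1 := by
    intro p hp n hn e
    have h1 : ρ (.inl p) ≠ 1 := fun e =>
      hp (Monoid.Coprod.inl_injective (hρinj (e.trans (map_one ρ).symm) |>.trans (map_one _).symm))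
    refine zpow_ne_one_of_strictMono (hC _).strictMono h1 hn ?_
    rw [← map_zpow, ← map_zpow, e, map_one, map_one]
  have hφ : Function.Injective (latticeHom g h) := by
    rw [injective_iff_map_eq_one]
    rintro ⟨i, j⟩ e
    have e1 : g ^ i = 1 := congrArg Prod.fst e
    have e2 : h ^ j = 1 := congrArg Prod.snd e
    have hi : i = 0 := by
      by_contra hi
      refine htf (g, 1) (fun e => hg (congrArg Prod.fst e)) i hi ?_
      rw [Prod.pow_mk, e1, one_zpow]; rfl
    have hj : j = 0 := by
      by_contra hj
      refine htf (1, h) (fun e => hh (congrArg Prod.snd e)) j hj ?_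
      rw [Prod.pow_mk, e2, one_zpow]; rfl
    rw [hi, hj]; rfl
  let κ : FreeProd →* (I ≃ₜ I) := ρ.comp (freeProdHom (latticeHom g h))
  have hκinj : Function.Injective κ := hρinj.comp (freeProdHom_injective hφ)
  have hκC : ∀ p, IsC1Holder 0 (κ p) := fun p => hC _
  have hφ1 : latticeHom g h (Multiplicative.ofAdd (1, 0)) = (g, 1) := by simp [latticeHom]
  have hφ2 : latticeHom g h (Multiplicative.ofAdd (0, 1)) = (1, h) := by simp [latticeHom]
  have hconj : ∀ t f : I ≃ₜ I, ∀ x, f (t⁻¹ x) = t⁻¹ x → (t * f * t⁻¹) x = x := by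
    intro t f x e
    rw [Homeomorph.mul_apply, Homeomorph.mul_apply, e, apply_inv_apply]
  refine killingWord_freeProd_ne_one (IsLocallyTrivial.eq_one (κ := κ) hκinj
    (fun p => (hκC p).strictMono) (fun r s t => freeProd_commute_trans)
    (fun r => freeProd_eq_one_of_commute_conj) fun q hq => ?_)
  rw [map_killingWord]
  refine eventually_killingWord ?_ ?_ (hq _) (hq _) (hq _) (hq _) (hκC _) (hκC _) (hκC _) (hκC _)
  · intro x
    simp only [κ, MonoidHom.comp_apply, freeProdHom_of_false, hφ1, hφ2]
    exact hgh x
  · intro x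
    simp only [κ, MonoidHom.comp_apply, freeProdHom_of_true, hφ1, hφ2, map_mul, map_inv]
    exact (hgh _).symm.imp (hconj _ _ _) (hconj _ _ _)

end IntervalDiff

/-! ### Assembly of the obstructions -/

namespace IntervalDiff

open Set Filter Topology
open scoped commutatorElement

section Obstruction

variable {G H : Type*} [Group G] [Group H]

theorem obstructs_of_exists_disjoint_support {Γ : Subgroup (I ≃ₜ I)} (hΓ : Γ ≤ Diff 0)
    (h : ∀ φ : G × H →* Γ, Function.Injective φ → ∃ g : G, ∃ h : H, g ≠ 1 ∧ h ≠ 1 ∧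
      ∀ x : I, (φ (g, 1) : I ≃ₜ I) x = x ∨ (φ (1, h) : I ≃ₜ I) x = x) : Obstructs Γ G H := by
  refine ⟨?_, fun φ hφ => ?_⟩
  · rintro ⟨ψ, hψ⟩
    obtain ⟨g, h, hg, hh, hgh⟩ := h (ψ.comp Monoid.Coprod.inl)
      (hψ.comp Monoid.Coprod.inl_injective)
    exact not_injective_of_disjoint_support hΓ ψ hg hh hgh hψ
  · obtain ⟨g, h, hg, hh, hgh⟩ := h φ hφ
    refine ⟨fun hov => ?_, g, h, hg, hh, hgh⟩
    obtain ⟨x, h1, h2⟩ := hov (g, 1) (1, h) (fun e => hg (congrArg Prod.fst e))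
      (fun e => hh (congrArg Prod.snd e))
    exact (hgh x).elim h1 h2

/-- The inequality excludes `τ = 0`. For `τ > 1` the regularity is lowered to one, where the
inequality holds for every `k`. -/
theorem exists_disjoint_support_of_derivedSeries {τ : ℝ≥0} (Φ : G →* (I ≃ₜ I))
    (Ψ : H →* (I ≃ₜ I)) (hcomm : ∀ g h, Commute (Φ g) (Ψ h)) (hΦC : ∀ g, IsC1Holder τ (Φ g))
    (hΨC : ∀ h, IsC1Holder τ (Ψ h)) {k : ℕ} (hk : 1 ≤ (τ : ℝ) * (1 + (τ : ℝ)) ^ k)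
    (hG : derivedSeries G (k + 1) ≠ ⊥) (hH : derivedSeries H (k + 1) ≠ ⊥) :
    ∃ g h, g ≠ 1 ∧ h ≠ 1 ∧ ∀ x, Φ g x = x ∨ Ψ h x = x := by
  have hτ : 0 < τ := by
    rw [pos_iff_ne_zero]
    rintro rfl
    norm_num at hk
  rcases le_total τ 1 with hτ1 | hτ1
  · exact exists_disjoint_support hτ hτ1 Φ Ψ hcomm hΦC hΨC hk hG hH
  · refine exists_disjoint_support one_pos le_rfl Φ Ψ hcomm (fun g => (hΦC g).mono hτ1)
      (fun h => (hΨC h).mono hτ1) (k := k) ?_ hG hH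
    rw [NNReal.coe_one, one_mul]
    exact one_le_pow₀ (by norm_num)

theorem exists_disjoint_support_of_not_isSolvable {τ : ℝ≥0} (hτ : 0 < τ) (Φ : G →* (I ≃ₜ I))
    (Ψ : H →* (I ≃ₜ I)) (hcomm : ∀ g h, Commute (Φ g) (Ψ h)) (hΦC : ∀ g, IsC1Holder τ (Φ g))
    (hΨC : ∀ h, IsC1Holder τ (Ψ h)) (hG : ¬ Group.IsSolvable G) (hH : ¬ Group.IsSolvable H) :
    ∃ g h, g ≠ 1 ∧ h ≠ 1 ∧ ∀ x, Φ g x = x ∨ Ψ h x = x := by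
  have hτ' : (0 : ℝ) < τ := hτ
  obtain ⟨k, hk⟩ := pow_unbounded_of_one_lt (τ : ℝ)⁻¹ (lt_add_of_pos_right 1 hτ')
  rw [Group.isSolvable_def, not_exists] at hG hH
  refine exists_disjoint_support_of_derivedSeries Φ Ψ hcomm hΦC hΨC (k := k) ?_ (hG _) (hH _)
  calc (1 : ℝ) = τ * (τ : ℝ)⁻¹ := (mul_inv_cancel₀ hτ'.ne').symm
    _ ≤ _ := by gcongr

theorem commute_map_prod {M : Type*} [Group M] (φ : G × H →* M) (g : G) (h : H) :
    Commute (φ (g, 1)) (φ (1, h)) := by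
  refine Commute.map ?_ φ
  ext <;> simp

theorem obstructs_diff {τ : ℝ≥0} (h : ∀ (Φ : G →* (I ≃ₜ I)) (Ψ : H →* (I ≃ₜ I)),
      (∀ g h, Commute (Φ g) (Ψ h)) → (∀ g, IsC1Holder τ (Φ g)) → (∀ h, IsC1Holder τ (Ψ h)) →
      ∃ g h, g ≠ 1 ∧ h ≠ 1 ∧ ∀ x, Φ g x = x ∨ Ψ h x = x) : Obstructs (Diff τ) G H := by
  refine obstructs_of_exists_disjoint_support (fun f hf => IsC1Holder.mono zero_le hf)
    fun φ _ => ?_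
  exact h (((Diff τ).subtype.comp φ).comp (MonoidHom.inl G H))
    (((Diff τ).subtype.comp φ).comp (MonoidHom.inr G H))
    (fun g h => commute_map_prod ((Diff τ).subtype.comp φ) g h) (fun g => (φ (g, 1)).2)
    (fun h => (φ (1, h)).2)

/-- The least exponent of finitely many generators works for the subgroup; for infinitely many the
infimum could be zero. -/
theorem exists_common_exponent (Φ : G →* (I ≃ₜ I)) (hΦ : ∀ g, Φ g ∈ DiffUnion) {K : Subgroup G}
    (hK : K.FG) : ∃ τ : ℝ≥0, 0 < τ ∧ ∀ g ∈ K, IsC1Holder τ (Φ g) := by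
  obtain ⟨s, rfl⟩ := hK
  have key : ∃ τ : ℝ≥0, 0 < τ ∧ ∀ g ∈ s, IsC1Holder τ (Φ g) := by
    classical
    induction s using Finset.induction_on with
    | empty => exact ⟨1, one_pos, by simp⟩
    | insert g s _ ih =>
      obtain ⟨τ, hτ, h⟩ := ih
      obtain ⟨r, hr, hg⟩ := hΦ g
      refine ⟨min r τ, lt_min hr hτ, fun g' hg' => ?_⟩
      rcases Finset.mem_insert.1 hg' with rfl | hg'
      · exact IsC1Holder.mono (min_le_left _ _) hg
      · exact (h g' hg').mono (min_le_right _ _)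
  obtain ⟨τ, hτ, h⟩ := key
  refine ⟨τ, hτ, fun g hg => ?_⟩
  have : Subgroup.closure (s : Set G) ≤ (Diff τ).comap Φ := (Subgroup.closure_le _).2 h
  exact this hg

theorem obstructs_diffUnion {K : Subgroup G} (hK : K.FG) (hKs : ¬ Group.IsSolvable K)
    {L : Subgroup H} (hL : L.FG) (hLs : ¬ Group.IsSolvable L) : Obstructs DiffUnion G H := by
  refine obstructs_of_exists_disjoint_support ?_ fun φ _ => ?_
  · rintro f ⟨τ, -, hf⟩
    exact IsC1Holder.mono zero_le hf
  · let Φ := (DiffUnion.subtype.comp φ).comp (MonoidHom.inl G H)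
    let Ψ := (DiffUnion.subtype.comp φ).comp (MonoidHom.inr G H)
    obtain ⟨r, hr, h₁⟩ := exists_common_exponent Φ (fun g => (φ (g, 1)).2) hK
    obtain ⟨τ, hτ, h₂⟩ := exists_common_exponent Ψ (fun h => (φ (1, h)).2) hL
    obtain ⟨g, h, hg, hh, hgh⟩ := exists_disjoint_support_of_not_isSolvable (lt_min hr hτ)
      (Φ.comp K.subtype) (Ψ.comp L.subtype)
      (fun g h => commute_map_prod (DiffUnion.subtype.comp φ) g h)
      (fun g => (h₁ g g.2).mono (min_le_left _ _)) (fun h => (h₂ h h.2).mono (min_le_right _ _))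
      hKs hLs
    exact ⟨g, h, fun e => hg (Subtype.ext e), fun e => hh (Subtype.ext e), hgh⟩

end Obstruction

end IntervalDiff

theorem theoremt {G : Type*} {H : Type*} [Group G] [Group H] :
    (∀ (k : ℕ) (τ : ℝ≥0), 3 ≤ k → derivedSeries G k ≠ ⊥ → derivedSeries H k ≠ ⊥ →
      1 ≤ (τ : ℝ) * (1 + (τ : ℝ)) ^ (k - 2) →
      IntervalDiff.Obstructs (IntervalDiff.Diff τ) G H) ∧
    (¬ Group.IsSolvable G → ¬ Group.IsSolvable H →
      ∀ τ : ℝ≥0, 0 < τ → IntervalDiff.Obstructs (IntervalDiff.Diff τ) G H) ∧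
    ((∃ K : Subgroup G, K.FG ∧ ¬ Group.IsSolvable K) → (∃ L : Subgroup H, L.FG ∧ ¬ Group.IsSolvable L) →
      IntervalDiff.Obstructs IntervalDiff.DiffUnion G H) := by
  refine ⟨fun k τ hk hG hH hτ => ?_, fun hG hH τ hτ => ?_, ?_⟩
  · obtain ⟨k, rfl⟩ : ∃ j, k = j + 1 := ⟨k - 1, by omega⟩
    -- The lemma asks for the exponent `k`, one less than the derived length index `k + 1`. The
    -- hypothesis has the smaller exponent `k + 1 - 2` and is stronger because `1 + τ ≥ 1`.
    refine IntervalDiff.obstructs_diff fun Φ Ψ h₁ h₂ h₃ =>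
      IntervalDiff.exists_disjoint_support_of_derivedSeries Φ Ψ h₁ h₂ h₃ (hτ.trans ?_) hG hH
    have h1 : (1 : ℝ) ≤ 1 + τ := le_add_of_nonneg_right τ.2
    gcongr
    omega
  · exact IntervalDiff.obstructs_diff fun Φ Ψ h₁ h₂ h₃ =>
      IntervalDiff.exists_disjoint_support_of_not_isSolvable hτ Φ Ψ h₁ h₂ h₃ hG hH
  · rintro ⟨K, hK, hKs⟩ ⟨L, hL, hLs⟩
    exact IntervalDiff.obstructs_diffUnion hK hKs hL hLs
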